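/- Let $M$ be a smooth supermanifold of dimension $p|q$ with an odd Poisson (Schouten) structure, i.e. an odd function $\mathfrak S$ on $T^*M$, quadratic in the momenta, with $(\mathfrak S,\mathfrak S)=0$ for the canonical even Poisson bracket $(\ ,\ )$ on $T^*M$. Put $\{f,g\}=(f,(\mathfrak S,g))$ and $X_f=(-1)^{\tilde f+1}\{f,\ \}$ for functions on $M$ (where $\tilde f$ is the parity of $f$). By a volume form we mean a non-degenerate one: $\boldsymbol\rho=r\,Dx$ in local coordinates, with $r$ even and invertible and $Dx'=\mathrm{Ber}(\partial x'/\partial x)\,Dx$. For a volume form $\boldsymbol\rho$ let $\Delta_{\boldsymbol\rho}f=(\mathcal L_{X_f}\boldsymbol\rho)/\boldsymbol\rho$ be the odd Laplace operator on functions; it is well defined. (1) Let $\boldsymbol\rho$, $\boldsymbol\rho'$ be volume forms with $\boldsymbol\rho'=e^{\sigma}\boldsymbol\rho$ for an even function $\sigma$. Then $$\Delta_{\boldsymbol\rho'}^2=\Delta_{\boldsymbol\rho}^2-X_{H(\boldsymbol\rho',\boldsymbol\rho)},\qquad H(\boldsymbol\rho',\boldsymbol\rho):=\Delta_{\boldsymbol\rho}\sigma-\tfrac12\{\sigma,\sigma\}=2e^{-\sigma/2}\Delta_{\boldsymbol\rho}e^{\sigma/2},$$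 and the function $H(\boldsymbol\rho',\boldsymbol\rho)$ is odd. (2) The functions $H$ satisfy exactly the cocycle conditions $H(\boldsymbol\rho,\boldsymbol\rho)=0$, $H(\boldsymbol\rho',\boldsymbol\rho)=-H(\boldsymbol\rho,\boldsymbol\rho')$ and $H(\boldsymbol\rho'',\boldsymbol\rho)=H(\boldsymbol\rho'',\boldsymbol\rho')+H(\boldsymbol\rho',\boldsymbol\rho)$, for volume forms with $\boldsymbol\rho'=e^{\sigma}\boldsymbol\rho$ and $\boldsymbol\rho''=e^{\tau}\boldsymbol\rho'$, where $\sigma,\tau$ are even functions. (3) For every volume form $\boldsymbol\rho$ the operator $\Delta_{\boldsymbol\rho}^2$ is a vector field which, as a fibrewise linear function on $T^*M$, is a cocycle of the Schouten–Lichnerowicz complex (the fibrewise polynomial functions on $T^*M$ with the differential $D=(\mathfrak S,\ )$), and its class $[\Delta_{\boldsymbol\rho}^2]$ in the first cohomology group is the same for all volume forms $\boldsymbol\rho$ on $M$. -/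

import Mathlib

open CategoryTheory Opposite TopologicalSpace
open scoped ContDiff

universe u

noncomputable section

namespace OddPoisson

/-! ### Superalgebra

A `ℤ/2`-grading on a real algebra is given by its parity involution `α` (`α a = a` on even and
`α a = -a` on odd elements). -/

section Superalgebra

variable {R : Type*} [Ring R] [Algebra ℝ R]

/-- The even component of an element. -/
def evenPart (α : R →ₗ[ℝ] R) : R →ₗ[ℝ] R := (2⁻¹ : ℝ) • (LinearMap.id + α)

/-- The odd component of an element. -/
def oddPart (α : R →ₗ[ℝ] R) : R →ₗ[ℝ] R := (2⁻¹ : ℝ) • (LinearMap.id - α)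

/-- The supercommutator, `[a, b] = a b - (-1)^{ab} b a` on homogeneous elements, extended
bilinearly. -/
def superComm (α : R →ₗ[ℝ] R) : R →ₗ[ℝ] R →ₗ[ℝ] R :=
  LinearMap.mk₂ ℝ (fun a b => a * b - (evenPart α b * a + oddPart α b * α a))
    (fun a a' b => by simp only [map_add, add_mul, mul_add]; abel)
    (fun c a b => by
      simp only [map_smul, smul_mul_assoc, mul_smul_comm, smul_sub, smul_add])
    (fun a b b' => by simp only [map_add, add_mul, mul_add]; abel)
    (fun c a b => by
      simp only [map_smul, smul_mul_assoc, mul_smul_comm, smul_sub, smul_add])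

lemma superComm_apply (α : R →ₗ[ℝ] R) (a b : R) :
    superComm α a b = a * b - (evenPart α b * a + oddPart α b * α a) := rfl

/-- The parity involution induced on linear operators by a parity involution `α`. -/
def opParity (α : R →ₐ[ℝ] R) : Module.End ℝ R →ₗ[ℝ] Module.End ℝ R :=
  (LinearMap.mulLeft ℝ (α.toLinearMap : Module.End ℝ R)).comp
    (LinearMap.mulRight ℝ (α.toLinearMap : Module.End ℝ R))

lemma opParity_apply (α : R →ₐ[ℝ] R) (A : Module.End ℝ R) (x : R) :
    opParity α A x = α (A (α x)) := rfl

/-- Multiplication by a function, as an operator. -/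
def mulOp : R →ₗ[ℝ] Module.End ℝ R := LinearMap.mul ℝ R

@[simp] lemma mulOp_apply (f x : R) : mulOp f x = f * x := rfl

/-- `diffOps α k`: the linear differential operators of order `< k` on a supercommutative algebra,
i.e. those whose `k`-fold supercommutators with functions vanish. -/
def diffOps (α : R →ₐ[ℝ] R) : ℕ → Submodule ℝ (Module.End ℝ R)
  | 0 => ⊥
  | k + 1 => ⨅ f : R, (diffOps α k).comap ((superComm (opParity α)).flip (mulOp f))

lemma mem_diffOps_zero {α : R →ₐ[ℝ] R} {A : Module.End ℝ R} : A ∈ diffOps α 0 ↔ A = 0 :=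
  Submodule.mem_bot ℝ

lemma mem_diffOps_succ {α : R →ₐ[ℝ] R} {k : ℕ} {A : Module.End ℝ R} :
    A ∈ diffOps α (k + 1) ↔ ∀ f, superComm (opParity α) A (mulOp f) ∈ diffOps α k := by
  simp [diffOps]

lemma diffOps_le_succ (α : R →ₐ[ℝ] R) (k : ℕ) : diffOps α k ≤ diffOps α (k + 1) := by
  induction k with
  | zero => exact bot_le
  | succ k ih =>
    intro A hA
    rw [mem_diffOps_succ] at hA ⊢
    exact fun f => ih (hA f)

/-- The super Jacobi identity. -/
lemma superComm_superComm {α : R →ₗ[ℝ] R} (hm : ∀ x y, α (x * y) = α x * α y)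
    (hα : ∀ x, α (α x) = x) (a b c : R) :
    superComm α (superComm α a b) c =
      superComm α a (superComm α b c) +
      superComm α (superComm α a (evenPart α c)) b +
      superComm α (superComm α a (oddPart α c)) (α b) := by
  simp only [superComm_apply, evenPart, oddPart, LinearMap.smul_apply, LinearMap.add_apply,
    LinearMap.sub_apply, LinearMap.id_apply, map_add, map_sub, hm,
    map_smul, hα, smul_mul_assoc, add_mul, sub_mul, smul_add, smul_sub, mul_assoc, smul_smul]
  module

lemma superComm_superComm_self {α : R →ₗ[ℝ] R} (hm : ∀ x y, α (x * y) = α x * α y)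
    (hα : ∀ x, α (α x) = x) {a : R} (ha : α a = -a) (b : R) :
    superComm α a (superComm α a b) = (2⁻¹ : ℝ) • superComm α (superComm α a a) b := by
  have h0 : superComm α a a = (2 : ℝ) • (a * a) := by
    simp only [superComm_apply, evenPart, oddPart, LinearMap.smul_apply, LinearMap.add_apply,
      LinearMap.sub_apply, LinearMap.id_apply, ha, smul_mul_assoc, add_mul, sub_mul, neg_mul,
      mul_neg]
    module
  rw [h0]
  simp only [superComm_apply, evenPart, oddPart, LinearMap.smul_apply, LinearMap.add_apply,
    LinearMap.sub_apply, LinearMap.id_apply, map_add, map_sub, hm, map_smul, hα, ha,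
    smul_mul_assoc, add_mul, sub_mul, smul_add, smul_sub,
    mul_assoc, smul_smul, neg_mul, mul_neg, neg_neg, map_neg, smul_neg]
  module

lemma map_superComm {α : R →ₗ[ℝ] R} (hm : ∀ x y, α (x * y) = α x * α y) (a b : R) :
    α (superComm α a b) = superComm α (α a) (α b) := by
  simp only [superComm_apply, evenPart, oddPart, LinearMap.smul_apply, LinearMap.add_apply,
    LinearMap.sub_apply, LinearMap.id_apply, map_add, map_sub, hm, map_smul]

variable {α : R →ₐ[ℝ] R}

lemma opParity_opParity (hα : ∀ x, α (α x) = x) (A : Module.End ℝ R) :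
    opParity α (opParity α A) = A := by
  ext x; simp [opParity_apply, hα]

lemma opParity_mul (hα : ∀ x, α (α x) = x) (A B : Module.End ℝ R) :
    opParity α (A * B) = opParity α A * opParity α B := by
  ext x; simp [opParity_apply, hα]

lemma opParity_mulOp (hα : ∀ x, α (α x) = x) (f : R) :
    opParity α (mulOp f) = mulOp (α f) := by
  ext x; simp [opParity_apply, hα]

lemma evenPart_mulOp (hα : ∀ x, α (α x) = x) (f : R) :
    evenPart (opParity α) (mulOp f) = mulOp (evenPart α.toLinearMap f) := by
  simp [evenPart, opParity_mulOp hα]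

lemma oddPart_mulOp (hα : ∀ x, α (α x) = x) (f : R) :
    oddPart (opParity α) (mulOp f) = mulOp (oddPart α.toLinearMap f) := by
  simp [oddPart, opParity_mulOp hα]

lemma opParity_mem_diffOps (hα : ∀ x, α (α x) = x) {k : ℕ} {A : Module.End ℝ R}
    (hA : A ∈ diffOps α k) : opParity α A ∈ diffOps α k := by
  induction k generalizing A with
  | zero => rw [mem_diffOps_zero] at hA ⊢; simp [hA]
  | succ k ih =>
    rw [mem_diffOps_succ] at hA ⊢
    intro f
    have h := ih (hA (α f))
    rwa [map_superComm (opParity_mul hα), opParity_mulOp hα, hα] at h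

/-- Operators of order `0` are the multiplications by functions. -/
lemma eq_mulOp_of_mem (hα : ∀ x, α (α x) = x)
    (hc : ∀ a b : R, superComm α.toLinearMap a b = 0) {A : Module.End ℝ R}
    (hA : A ∈ diffOps α 1) : A = mulOp (A 1) := by
  ext f
  have h1 := mem_diffOps_zero.1 (mem_diffOps_succ.1 hA f)
  have h2 := congrArg (fun B : Module.End ℝ R => B 1) h1
  have h3 := hc (A 1) f
  rw [superComm_apply, evenPart_mulOp hα, oddPart_mulOp hα] at h2
  rw [superComm_apply] at h3
  simp [opParity_apply] at h2
  simp only [AlgHom.toLinearMap_apply] at h3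
  rw [sub_eq_zero] at h2 h3
  rw [h2, mulOp_apply, h3]

lemma superComm_mulOp_mulOp (hα : ∀ x, α (α x) = x)
    (hc : ∀ a b : R, superComm α.toLinearMap a b = 0) (f g : R) :
    superComm (opParity α) (mulOp f) (mulOp g) = 0 := by
  ext x
  have h3 := congrArg (· * x) (hc f g)
  rw [superComm_apply] at h3
  rw [superComm_apply, evenPart_mulOp hα, oddPart_mulOp hα, opParity_mulOp hα]
  simpa [sub_mul, add_mul, mul_assoc] using h3

/-- The supercommutator of operators of orders `≤ m` and `≤ n` has order `≤ m + n - 1`. -/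
lemma superComm_mem_diffOps (hα : ∀ x, α (α x) = x)
    (hc : ∀ a b : R, superComm α.toLinearMap a b = 0) (N : ℕ) :
    ∀ (m n : ℕ) (_ : m + n = N) {A B : Module.End ℝ R}
      (_ : A ∈ diffOps α (m + 1)) (_ : B ∈ diffOps α (n + 1)),
      superComm (opParity α) A B ∈ diffOps α N := by
  induction N with
  | zero =>
    intro m n h A B hA hB
    obtain ⟨rfl, rfl⟩ : m = 0 ∧ n = 0 := by omega
    rw [eq_mulOp_of_mem hα hc hA, eq_mulOp_of_mem hα hc hB, superComm_mulOp_mulOp hα hc]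
    exact zero_mem _
  | succ N ih =>
    intro m n h A B hA hB
    rw [mem_diffOps_succ]
    intro f
    rw [superComm_superComm (opParity_mul hα) (opParity_opParity hα), evenPart_mulOp hα,
      oddPart_mulOp hα]
    have hr : ∀ g, ∀ C ∈ diffOps α (n + 1),
        superComm (opParity α) (superComm (opParity α) A (mulOp g)) C ∈ diffOps α N := by
      intro g C hC
      have hAg := mem_diffOps_succ.1 hA g
      cases m with
      | zero => rw [mem_diffOps_zero.1 hAg]; simp
      | succ m => exact ih m n (by omega) hAg hC
    refine add_mem (add_mem ?_ (hr _ _ hB)) (hr _ _ (opParity_mem_diffOps hα hB))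
    have hBf := mem_diffOps_succ.1 hB f
    cases n with
    | zero => rw [mem_diffOps_zero.1 hBf]; simp
    | succ n => exact ih m n (by omega) hA hBf

end Superalgebra

/-! ### Grassmann algebras -/

/-- The Grassmann algebra on `q` odd generators. -/
abbrev Grassmann (q : ℕ) : Type := ExteriorAlgebra ℝ (Fin q → ℝ)

/-- The basis of monomials in the generators. -/
def grassmannBasis (q : ℕ) : Module.Basis (Finset (Fin q)) ℝ (Grassmann q) :=
  (Pi.basisFun ℝ (Fin q)).ExteriorAlgebra

/- A norm, fixed only to speak of smooth maps into this finite-dimensional vector space. -/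
instance (q : ℕ) : NormedAddCommGroup (Grassmann q) :=
  NormedAddCommGroup.induced _ (Finset (Fin q) → ℝ) (grassmannBasis q).equivFun.toLinearMap
    (grassmannBasis q).equivFun.injective

instance (q : ℕ) : NormedSpace ℝ (Grassmann q) :=
  NormedSpace.induced ℝ (Grassmann q) (Finset (Fin q) → ℝ) (grassmannBasis q).equivFun.toLinearMap

instance (q : ℕ) : FiniteDimensional ℝ (Grassmann q) := (grassmannBasis q).finiteDimensional_of_finite

/-- The parity involution of the Grassmann algebra. -/
def gParity (q : ℕ) : Grassmann q →ₐ[ℝ] Grassmann q := CliffordAlgebra.involute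

/-- The left partial derivative with respect to the `j`-th odd generator. -/
def gDeriv {q : ℕ} (j : Fin q) : Grassmann q →ₗ[ℝ] Grassmann q :=
  CliffordAlgebra.contractLeft (LinearMap.proj j)

/-- The exponential: `e^{b + ν} = e^b ∑ ν^k / k!` for `b` real and `ν` nilpotent (`ν ^ (q+1) = 0`). -/
def gExp {q : ℕ} (a : Grassmann q) : Grassmann q :=
  Real.exp (ExteriorAlgebra.algebraMapInv a) •
    ∑ k ∈ Finset.range (q + 1),
      ((k.factorial : ℝ)⁻¹) • (a - algebraMap ℝ _ (ExteriorAlgebra.algebraMapInv a)) ^ k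

lemma contDiffOn_grassmann_mul {E : Type*} [NormedAddCommGroup E] [NormedSpace ℝ E] {q : ℕ}
    {f g : E → Grassmann q} {s : Set E} (hf : ContDiffOn ℝ ∞ f s) (hg : ContDiffOn ℝ ∞ g s) :
    ContDiffOn ℝ ∞ (fun y => f y * g y) s := by
  let B : Grassmann q →L[ℝ] Grassmann q →L[ℝ] Grassmann q :=
    LinearMap.toContinuousLinearMap
      (LinearMap.toContinuousLinearMap.toLinearMap ∘ₗ LinearMap.mul ℝ (Grassmann q))
  exact (B.isBoundedBilinearMap.contDiff.comp_contDiffOn (hf.prodMk hg) :)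

/-! ### Supermanifolds -/

/-- A space with a sheaf of supercommutative real algebras. -/
structure SuperSpace where
  /-- The underlying topological space. -/
  space : TopCat.{u}
  /-- The structure sheaf. -/
  sheaf : TopCat.Sheaf (AlgCat.{u} ℝ) space
  /-- The parity involution. -/
  parity : ∀ U : Opens space, sheaf.1.obj (op U) →ₐ[ℝ] sheaf.1.obj (op U)
  parity_parity : ∀ U f, parity U (parity U f) = f
  parity_res : ∀ {U V : Opens space} (h : V ≤ U) (f : sheaf.1.obj (op U)),
    (sheaf.1.map (homOfLE h).op).hom (parity U f) = parity V ((sheaf.1.map (homOfLE h).op).hom f)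
  supercommutative : ∀ (U : Opens space) (f g : sheaf.1.obj (op U)),
    superComm (parity U).toLinearMap f g = 0

namespace SuperSpace

/-- The algebra of functions on an open subset. -/
abbrev Fn (X : SuperSpace.{u}) (U : Opens X.space) : Type u := X.sheaf.1.obj (op U)

variable {X : SuperSpace.{u}} {U V : Opens X.space}

/-- Restriction of functions. -/
def res (h : V ≤ U) : X.Fn U →ₐ[ℝ] X.Fn V := (X.sheaf.1.map (homOfLE h).op).hom

/-- Restriction of global functions. -/
abbrev resTop (U : Opens X.space) : X.Fn ⊤ →ₐ[ℝ] X.Fn U := res le_top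

def IsEven (f : X.Fn U) : Prop := X.parity U f = f

def IsOdd (f : X.Fn U) : Prop := X.parity U f = -f

end SuperSpace

section Model

variable {S : Type u} [TopologicalSpace S] {p : ℕ}
  (e : OpenPartialHomeomorph S (EuclideanSpace ℝ (Fin p)))

/-- The part of the target of `e` that corresponds to the open set `W`. -/
def chartImage (W : Opens S) : Set (EuclideanSpace ℝ (Fin p)) := e.target ∩ e.symm ⁻¹' W

open Classical in
/-- A function on `W`, read in the coordinates `e` (and extended by zero). -/
def inChart {q : ℕ} (W : Opens S) (g : W → Grassmann q) :
    EuclideanSpace ℝ (Fin p) → Grassmann q :=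
  fun y => if h : e.symm y ∈ W then g ⟨e.symm y, h⟩ else 0

lemma isOpen_chartImage (W : Opens S) : IsOpen (chartImage e W) :=
  e.symm.isOpen_inter_preimage W.2

lemma inChart_of_mem {q : ℕ} {W : Opens S} (g : W → Grassmann q)
    {y : EuclideanSpace ℝ (Fin p)} (hy : y ∈ chartImage e W) :
    inChart e W g y = g ⟨e.symm y, hy.2⟩ := dif_pos hy.2

/-- The functions of the superdomain of dimension `p|q` over the image of `W` under `e`, that is
`C^∞(e(W)) ⊗ Λ(θ₁, …, θ_q)`, realised as smooth maps with values in the Grassmann algebra and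
transported to `W` along `e`. -/
def modelFn (q : ℕ) (W : Opens S) : Subalgebra ℝ (W → Grassmann q) where
  carrier := {g | ContDiffOn ℝ ∞ (inChart e W g) (chartImage e W)}
  mul_mem' {f g} hf hg := by
    refine (contDiffOn_grassmann_mul hf hg).congr fun y hy => ?_
    simp only [inChart_of_mem e _ hy, Pi.mul_apply]
  add_mem' {f g} hf hg := by
    refine (ContDiffOn.add hf hg).congr fun y hy => ?_
    simp only [inChart_of_mem e _ hy, Pi.add_apply]
  algebraMap_mem' r := by
    refine (contDiffOn_const (c := algebraMap ℝ (Grassmann q) r)).congr fun y hy => ?_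
    rw [inChart_of_mem e _ hy]; rfl

variable {e} {q : ℕ} {W : Opens S}

/-- Composition with a linear map of Grassmann algebras. -/
def modelPost (L : Grassmann q →ₗ[ℝ] Grassmann q) (g : modelFn e q W) : modelFn e q W :=
  ⟨fun w => L (g.1 w), by
    refine ((LinearMap.toContinuousLinearMap L).contDiff.comp_contDiffOn g.2).congr
      fun y hy => ?_
    rw [Function.comp_apply, inChart_of_mem e _ hy, inChart_of_mem e _ hy]; rfl⟩

/-- The partial derivative along the `i`-th even coordinate. -/
def modelDeriv (i : Fin p) (g : modelFn e q W) : modelFn e q W :=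
  ⟨fun w => fderiv ℝ (inChart e W g.1) (e w) (EuclideanSpace.single i 1), by
    have h1 : ContDiffOn ℝ ∞ (fderiv ℝ (inChart e W g.1)) (chartImage e W) :=
      ContDiffOn.fderiv_of_isOpen g.2 (isOpen_chartImage e W) (by simp)
    refine (h1.clm_apply (contDiffOn_const (c := EuclideanSpace.single i 1))).congr
      fun y hy => ?_
    rw [inChart_of_mem e _ hy]
    simp only [e.right_inv hy.1]⟩

/-- The `i`-th even coordinate function. -/
def modelEvenCoord (e : OpenPartialHomeomorph S (EuclideanSpace ℝ (Fin p))) (q : ℕ)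
    (W : Opens S) (i : Fin p) : modelFn e q W :=
  ⟨fun w => algebraMap ℝ (Grassmann q) (e w i), by
    let L : EuclideanSpace ℝ (Fin p) →L[ℝ] Grassmann q :=
      (LinearMap.toContinuousLinearMap (Algebra.linearMap ℝ (Grassmann q))).comp
        (EuclideanSpace.proj i)
    refine (L.contDiff.contDiffOn).congr fun y hy => ?_
    rw [inChart_of_mem e _ hy]
    simp only [e.right_inv hy.1]
    rfl⟩

/-- The `j`-th odd coordinate function. -/
def modelOddCoord (e : OpenPartialHomeomorph S (EuclideanSpace ℝ (Fin p))) (W : Opens S)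
    (j : Fin q) : modelFn e q W :=
  ⟨fun _ => ExteriorAlgebra.ι ℝ (Pi.single j 1), by
    refine (contDiffOn_const (c := ExteriorAlgebra.ι ℝ (Pi.single j 1))).congr fun y hy => ?_
    rw [inChart_of_mem e _ hy]⟩

end Model

/-- A chart of dimension `p|q`: an isomorphism of an open part of `X` with a superdomain, i.e. a
homeomorphism of the underlying spaces and a parity-preserving isomorphism of the sheaves. -/
structure Chart (X : SuperSpace.{u}) (p q : ℕ) where
  base : OpenPartialHomeomorph X.space (EuclideanSpace ℝ (Fin p))
  iso : ∀ W : Opens X.space, (W : Set X.space) ⊆ base.source → X.Fn W ≃ₐ[ℝ] modelFn base q W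
  iso_res : ∀ (W W' : Opens X.space) (hW : (W : Set X.space) ⊆ base.source)
    (hW' : (W' : Set X.space) ⊆ base.source) (h : W' ≤ W) (f : X.Fn W) (w : W'),
    (iso W' hW' (SuperSpace.res h f)).1 w = (iso W hW f).1 ⟨w.1, h w.2⟩
  iso_parity : ∀ (W : Opens X.space) (hW : (W : Set X.space) ⊆ base.source) (f : X.Fn W) (w : W),
    (iso W hW (X.parity W f)).1 w = gParity q ((iso W hW f).1 w)

/-- A smooth supermanifold of dimension `p|q`. -/
structure Supermanifold (p q : ℕ) extends SuperSpace.{u} where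
  t2 : T2Space space
  secondCountable : SecondCountableTopology space
  exists_chart : ∀ x : space, ∃ c : Chart toSuperSpace p q, x ∈ c.base.source

namespace Chart

variable {X : SuperSpace.{u}} {p q : ℕ} (c : Chart X p q)

/-- The domain of a chart. -/
def dom : Opens X.space := ⟨c.base.source, c.base.open_source⟩

variable {W : Opens X.space}

/-- The coordinates `x^a`; `a = inl i` is even, `a = inr j` is odd. -/
def coord (hW : W ≤ c.dom) : Fin p ⊕ Fin q → X.Fn W
  | .inl i => (c.iso W hW).symm (modelEvenCoord c.base q W i)
  | .inr j => (c.iso W hW).symm (modelOddCoord c.base W j)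

/-- The (left) partial derivatives `∂/∂x^a`. -/
def partialDeriv (hW : W ≤ c.dom) : Fin p ⊕ Fin q → X.Fn W → X.Fn W
  | .inl i, f => (c.iso W hW).symm (modelDeriv i (c.iso W hW f))
  | .inr j, f => (c.iso W hW).symm (modelPost (gDeriv j) (c.iso W hW f))

end Chart

/-! ### Berezinian and volume forms -/

/-- The determinant of a square matrix over a ring whose entries commute (Leibniz formula). -/
def leibnizDet {R : Type*} [Ring R] {n : ℕ} (A : Matrix (Fin n) (Fin n) R) : R :=
  ∑ τ : Equiv.Perm (Fin n), (Equiv.Perm.sign τ : ℤ) • (List.ofFn fun i => A (τ i) i).prod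

/-- The Berezinian `det(A - B D⁻¹ C) det(D)⁻¹` of an even invertible supermatrix
`[[A, B], [C, D]]`. -/
def berezinian {R : Type*} [Ring R] {p q : ℕ} (J : Matrix (Fin p ⊕ Fin q) (Fin p ⊕ Fin q) R) : R :=
  leibnizDet (J.toBlocks₁₁ - J.toBlocks₁₂ * Ring.inverse J.toBlocks₂₂ * J.toBlocks₂₁) *
    Ring.inverse (leibnizDet J.toBlocks₂₂)

/-- The Jacobian `∂x'/∂x`: the row index is that of the old coordinate `x` (of `c`), the column
index that of the new coordinate `x'` (of `c'`), so that `∂_a = ∑_b (∂_a x'^b) ∂'_b`. -/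
def jacobian {X : SuperSpace.{u}} {p q : ℕ} (c c' : Chart X p q) {W : Opens X.space}
    (hc : W ≤ c.dom) (hc' : W ≤ c'.dom) : Matrix (Fin p ⊕ Fin q) (Fin p ⊕ Fin q) (X.Fn W) :=
  Matrix.of fun a b => c.partialDeriv hc a (c'.coord hc' b)

/-- A non-degenerate volume form: in every chart `r Dx` with `r` even and invertible, where
`Dx' = Ber(∂x'/∂x) Dx`. -/
structure VolumeForm (X : SuperSpace.{u}) (p q : ℕ) where
  coeff : ∀ c : Chart X p q, X.Fn c.dom
  even : ∀ c, SuperSpace.IsEven (coeff c)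
  nondegenerate : ∀ c, IsUnit (coeff c)
  transform : ∀ c c' : Chart X p q,
    SuperSpace.res (inf_le_left : c.dom ⊓ c'.dom ≤ c.dom) (coeff c) =
      berezinian (jacobian c c' inf_le_left inf_le_right) *
        SuperSpace.res (inf_le_right : c.dom ⊓ c'.dom ≤ c'.dom) (coeff c')

/-- `E = e^σ`, where the exponential is the one of the Grassmann algebra pointwise in charts. -/
def IsExp {X : SuperSpace.{u}} (p q : ℕ) (σ E : X.Fn ⊤) : Prop :=
  ∀ (c : Chart X p q) (w : c.dom),
    (c.iso c.dom subset_rfl (SuperSpace.resTop c.dom E)).1 w =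
      gExp ((c.iso c.dom subset_rfl (SuperSpace.resTop c.dom σ)).1 w)

/-- `ρ' = e^σ ρ` with an even function `σ`. -/
def IsExpMul {X : SuperSpace.{u}} {p q : ℕ} (σ : X.Fn ⊤) (ρ ρ' : VolumeForm X p q) : Prop :=
  SuperSpace.IsEven σ ∧ ∃ E : X.Fn ⊤, IsExp p q σ E ∧
    ∀ c, ρ'.coeff c = SuperSpace.resTop c.dom E * ρ.coeff c

/-! ### Fibrewise polynomial functions on the cotangent bundle -/

section Symbols

variable (X : SuperSpace.{u})

/-- Families of linear operators on functions over all open subsets. -/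
abbrev OpFamily : Type u := ∀ U : Opens X.space, Module.End ℝ (X.Fn U)

/-- `DiffOp X k`: the differential operators of order `< k` on `X` (operators on the structure
sheaf). -/
def DiffOp (k : ℕ) : Submodule ℝ (OpFamily X) where
  carrier := {A | (∀ (U V : Opens X.space) (h : V ≤ U) (f : X.Fn U),
    SuperSpace.res h (A U f) = A V (SuperSpace.res h f)) ∧ ∀ U, A U ∈ diffOps (X.parity U) k}
  add_mem' {A B} hA hB := ⟨fun U V h f => by simp [hA.1 U V h, hB.1 U V h],
    fun U => add_mem (hA.2 U) (hB.2 U)⟩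
  zero_mem' := ⟨fun U V h f => by simp, fun U => zero_mem _⟩
  smul_mem' r A hA := ⟨fun U V h f => by simp [hA.1 U V h],
    fun U => Submodule.smul_mem _ r (hA.2 U)⟩

lemma DiffOp_le_succ (k : ℕ) : DiffOp X k ≤ DiffOp X (k + 1) :=
  fun _ hA => ⟨hA.1, fun U => diffOps_le_succ _ _ (hA.2 U)⟩

instance (k : ℕ) : AddCommGroup (DiffOp X k) := Submodule.addCommGroup _

instance (k : ℕ) : Module ℝ (DiffOp X k) := Submodule.module _

variable {X}

/-- The supercommutator of operators. -/
def opBracket : OpFamily X →ₗ[ℝ] OpFamily X →ₗ[ℝ] OpFamily X :=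
  LinearMap.mk₂ ℝ (fun A B U => superComm (opParity (X.parity U)) (A U) (B U))
    (fun A A' B => by ext; simp) (fun r A B => by ext; simp)
    (fun A B B' => by ext; simp) (fun r A B => by ext; simp)

lemma opBracket_apply (A B : OpFamily X) (U : Opens X.space) :
    opBracket A B U = superComm (opParity (X.parity U)) (A U) (B U) := rfl

lemma opBracket_mem {m n k : ℕ} (h : m + n = k) {A B : OpFamily X}
    (hA : A ∈ DiffOp X (m + 1)) (hB : B ∈ DiffOp X (n + 1)) : opBracket A B ∈ DiffOp X k := by
  refine ⟨fun U V hVU f => ?_, fun U =>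
    superComm_mem_diffOps (X.parity_parity U) (X.supercommutative U) k m n h (hA.2 U) (hB.2 U)⟩
  have hp : ∀ g : X.Fn U, SuperSpace.res hVU (X.parity U g) =
    X.parity V (SuperSpace.res hVU g) := X.parity_res hVU
  simp [opBracket_apply, superComm_apply, evenPart, oddPart, opParity_apply, hA.1 U V hVU,
    hB.1 U V hVU, hp]

lemma opBracket_mem_left {m n k : ℕ} (h : m + n = k + 1) {A B : OpFamily X}
    (hA : A ∈ DiffOp X m) (hB : B ∈ DiffOp X (n + 1)) : opBracket A B ∈ DiffOp X k := by
  cases m with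
  | zero =>
    have : A = 0 := funext fun U => mem_diffOps_zero.1 (hA.2 U)
    rw [this]; simp
  | succ m => exact opBracket_mem (by omega) hA hB

lemma opBracket_mem_right {m n k : ℕ} (h : m + n = k + 1) {A B : OpFamily X}
    (hA : A ∈ DiffOp X (m + 1)) (hB : B ∈ DiffOp X n) : opBracket A B ∈ DiffOp X k := by
  cases n with
  | zero =>
    have : B = 0 := funext fun U => mem_diffOps_zero.1 (hB.2 U)
    rw [this]; simp
  | succ n => exact opBracket_mem (by omega) hA hB

variable (X) in
/-- The functions on `T^*X` that are homogeneous polynomials of degree `n` in the momenta, realised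
as the principal symbols of differential operators of order `≤ n`, i.e. operators of order `≤ n`
modulo operators of order `≤ n - 1`; the momentum `p_a` is the symbol of `∂/∂x^a`. -/
abbrev Sym (n : ℕ) : Type u :=
  DiffOp X (n + 1) ⧸ (DiffOp X n).submoduleOf (DiffOp X (n + 1))

/-- The principal symbol of degree `n`. -/
abbrev symb {n : ℕ} : DiffOp X (n + 1) →ₗ[ℝ] Sym X n :=
  ((DiffOp X n).submoduleOf (DiffOp X (n + 1))).mkQ

/-- The canonical even Poisson bracket on `T^*X`, normalised by `(p_a, x^b) = δ_a^b`: the bracket of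
the symbols of `A` and `B` is the symbol of the supercommutator `[A, B]`. -/
def symBracket {m n k : ℕ} (h : m + n = k + 1) : Sym X m →ₗ[ℝ] Sym X n →ₗ[ℝ] Sym X k :=
  let L : DiffOp X (m + 1) →ₗ[ℝ] DiffOp X (n + 1) →ₗ[ℝ] Sym X k :=
    LinearMap.mk₂ ℝ (fun A B => symb ⟨opBracket A.1 B.1, opBracket_mem h A.2 B.2⟩)
      (fun A A' B => by rw [← map_add]; congr 1; ext1; simp)
      (fun r A B => by rw [← map_smul]; congr 1; ext1; simp)
      (fun A B B' => by rw [← map_add]; congr 1; ext1; simp)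
      (fun r A B => by rw [← map_smul]; congr 1; ext1; simp)
  let L' : DiffOp X (m + 1) →ₗ[ℝ] Sym X n →ₗ[ℝ] Sym X k :=
    (Submodule.liftQ _ L.flip (fun B hB => LinearMap.ext fun A =>
      (Submodule.Quotient.mk_eq_zero _).2 (opBracket_mem_right h A.2 hB))).flip
  Submodule.liftQ _ L' (fun A hA => LinearMap.ext fun B => by
    obtain ⟨B, rfl⟩ := Submodule.mkQ_surjective _ B
    exact (Submodule.Quotient.mk_eq_zero _).2 (opBracket_mem_left h hA B.2))

lemma symBracket_symb {m n k : ℕ} (h : m + n = k + 1) (A : DiffOp X (m + 1))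
    (B : DiffOp X (n + 1)) : symBracket h (symb A) (symb B) =
      symb ⟨opBracket A.1 B.1, opBracket_mem h A.2 B.2⟩ := rfl

end Symbols

/-! ### Odd Poisson (Schouten) structures -/

/-- The function `(f, (F, g))` for `F` quadratic in the momenta and functions `f`, `g` on `V`. -/
def derivedBracket {X : SuperSpace.{u}} {V : Opens X.space} (f g : X.Fn V) :
    Sym X 2 →ₗ[ℝ] X.Fn V :=
  Submodule.liftQ _
    { toFun := fun A => superComm (opParity (X.parity V)) (mulOp f)
        (superComm (opParity (X.parity V)) (A.1 V) (mulOp g)) 1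
      map_add' := fun A B => by simp
      map_smul' := fun r A => by simp }
    (fun A hA => by
      have h1 : superComm (opParity (X.parity V)) (A.1 V) (mulOp g) ∈ diffOps (X.parity V) 1 :=
        mem_diffOps_succ.1 (hA.2 V) g
      rw [LinearMap.mem_ker]
      change superComm (opParity (X.parity V)) (mulOp f)
        (superComm (opParity (X.parity V)) (A.1 V) (mulOp g)) 1 = 0
      rw [eq_mulOp_of_mem (X.parity_parity V) (X.supercommutative V) h1,
        superComm_mulOp_mulOp (X.parity_parity V) (X.supercommutative V)]
      rfl)

/-- An odd Poisson (Schouten) structure: an odd function `𝔖` on `T^*X`, quadratic in the momenta,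
with `(𝔖, 𝔖) = 0`. -/
structure SchoutenStructure (X : SuperSpace.{u}) where
  symbol : Sym X 2
  odd : ∃ A : DiffOp X 3, symb A = symbol ∧ ∀ U, opParity (X.parity U) (A.1 U) = -A.1 U
  bracket_self : symBracket (m := 2) (n := 2) (k := 3) rfl symbol symbol = 0

namespace SchoutenStructure

variable {X : SuperSpace.{u}} (P : SchoutenStructure X)

/-- The odd Poisson bracket `{f, g} = (f, (𝔖, g))`. -/
def bracket {V : Opens X.space} (f g : X.Fn V) : X.Fn V := derivedBracket f g P.symbol

/-- The Hamiltonian vector field `X_f = (-1)^{f + 1} {f, ·}` of a function `f` on `U`, acting on the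
functions on `V ≤ U`. -/
def ham {U : Opens X.space} (f : X.Fn U) (V : Opens X.space) (h : V ≤ U) (g : X.Fn V) : X.Fn V :=
  -P.bracket (X.parity V (SuperSpace.res h f)) g

/-- The differential `D = (𝔖, ·)` of the Schouten–Lichnerowicz complex of fibrewise polynomial
functions on `T^*X`. -/
def slDiff (n : ℕ) : Sym X n →ₗ[ℝ] Sym X (n + 1) :=
  symBracket (m := 2) (by omega) P.symbol

lemma slDiff_slDiff (n : ℕ) (F : Sym X n) : P.slDiff (n + 1) (P.slDiff n F) = 0 := by
  obtain ⟨A, hA, hodd⟩ := P.odd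
  obtain ⟨B, rfl⟩ := Submodule.mkQ_surjective _ F
  have h0 := P.bracket_self
  unfold slDiff
  rw [← hA] at h0 ⊢
  rw [symBracket_symb] at h0
  have h1 : opBracket A.1 A.1 ∈ DiffOp X 3 :=
    (Submodule.Quotient.mk_eq_zero ((DiffOp X 3).submoduleOf (DiffOp X 4))).1 h0
  have h2 : opBracket (opBracket A.1 A.1) B.1 ∈ DiffOp X (n + 2) :=
    opBracket_mem (m := 2) (by omega) h1 B.2
  have h3 : opBracket A.1 (opBracket A.1 B.1) =
      (2⁻¹ : ℝ) • opBracket (opBracket A.1 A.1) B.1 := by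
    funext U
    have hp := X.parity_parity U
    exact superComm_superComm_self (opParity_mul hp) (opParity_opParity hp) (hodd U) (B.1 U)
  have h4 : opBracket A.1 (opBracket A.1 B.1) ∈ DiffOp X (n + 2) := by
    rw [h3]; exact Submodule.smul_mem _ _ h2
  exact (Submodule.Quotient.mk_eq_zero _).2 h4

/-- The cohomology group `H^{n+1}` of the Schouten–Lichnerowicz complex. -/
abbrev Cohomology (n : ℕ) : Type u :=
  LinearMap.ker (P.slDiff (n + 1)) ⧸
    (LinearMap.range (P.slDiff n)).submoduleOf (LinearMap.ker (P.slDiff (n + 1)))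

variable {p q : ℕ}

/-- The coefficient of the Lie derivative of the volume form `r Dx` along the vector field
`Y = Y^a ∂_a`, `L_Y (r Dx) = (-1)^{a(Y + 1)} ∂_a (r Y^a) Dx`. For odd `a` the sign is the parity of
`Y^a`. -/
def _root_.OddPoisson.lieCoeff (c : Chart X p q) {W : Opens X.space} (hW : W ≤ c.dom) (r : X.Fn W)
    (Y : X.Fn W → X.Fn W) : X.Fn W :=
  ∑ i : Fin p, c.partialDeriv hW (.inl i) (r * Y (c.coord hW (.inl i))) +
  ∑ j : Fin q, c.partialDeriv hW (.inr j) (r * X.parity W (Y (c.coord hW (.inr j))))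

/-- `h = div_ρ X_f`, that is, `L_{X_f} ρ = h ρ` on `U`. -/
def IsLaplacian (ρ : VolumeForm X p q) {U : Opens X.space} (f h : X.Fn U) : Prop :=
  ∀ c : Chart X p q,
    lieCoeff c (inf_le_left : c.dom ⊓ U ≤ c.dom) (SuperSpace.res inf_le_left (ρ.coeff c))
        (P.ham f (c.dom ⊓ U) inf_le_right) =
      SuperSpace.res inf_le_right h * SuperSpace.res inf_le_left (ρ.coeff c)

/-- The odd Laplace operator `Δ_ρ f = (L_{X_f} ρ) / ρ`. -/
def laplacian (ρ : VolumeForm X p q) {U : Opens X.space} (f : X.Fn U) : X.Fn U :=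
  Classical.epsilon (P.IsLaplacian ρ f)

/-- `H(ρ', ρ) = Δ_ρ σ - ½ {σ, σ}`, where `ρ' = e^σ ρ`. -/
def masterH (ρ' ρ : VolumeForm X p q) : X.Fn ⊤ :=
  let σ : X.Fn ⊤ := Classical.epsilon (fun σ => IsExpMul σ ρ ρ')
  P.laplacian ρ σ - (2⁻¹ : ℝ) • P.bracket σ σ

/-- `m = [Δ_ρ²]`: the operator `Δ_ρ²` is of order `≤ 1`, its symbol (the fibrewise linear function
on `T^*X` given by the vector field `Δ_ρ²`) is a cocycle, and `m` is the class of it. -/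
def IsModularClass (ρ : VolumeForm X p q) (m : P.Cohomology 0) : Prop :=
  ∃ (Y : DiffOp X 2) (hY : symb Y ∈ LinearMap.ker (P.slDiff 1)),
    (∀ (U : Opens X.space) (f : X.Fn U), Y.1 U f = P.laplacian ρ (P.laplacian ρ f)) ∧
    m = Submodule.Quotient.mk ⟨symb Y, hY⟩

end SchoutenStructure

end OddPoisson

end

/-! The structure `𝔖` is replaced by an odd operator `D` of order at most 2 with `D 1 = 0` and
symbol `𝔖`. Its failure to be a derivation, `polar`, is additive in `f` and satisfies `polar f g =
X_f g` with exactly the sign of the Hamiltonian field (`ham_eq`). Because `D` has order at most 2,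
each `X_f` is a superderivation (`polar_isSDer`). The equation `(𝔖, 𝔖) = 0` says that `D²` also has
order at most 2, so that the polarisation of `D²` is a derivation too; written out, this is the
Jacobi identity (`IsBV.jacobi`).

In coordinates, `Δ f = div X_f + r⁻¹ X_f r`. Two properties of divergences suffice: the rule for
`div (g Y)` gives `Δ(fg) = Δf g + α(f) Δg + 2 X_f g` (`laplace_mul`), and the rule for the
divergence of a commutator, together with Jacobi, shows that `Δ` is a derivation of the odd bracket
(`laplace_polar`). These two identities are recorded as `IsOddLaplace`, and the rest is algebra.
They make `Δ²` a derivation. If the volume form is multiplied by an even invertible `g`, then `Δ' =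
Δ + g⁻¹ X_g`, and squaring gives `Δ'² = Δ² - X_H` with `H = g⁻¹ Δg - ½ g⁻² X_g g`
(`IsOddLaplace.rescale_sq`). For `g = e^σ` the chain rule turns this `H` into `Δσ - ½ {σ, σ}`; the
cocycle conditions follow from `Δ' = Δ + X_σ` and the symmetry of `X_σ τ` for even functions.

For the cohomology class no logarithm of the ratio of two volume forms is needed: the formula for
`H` makes sense for every invertible ratio, also a negative one, and `D` sends the function `H` to
the symbol of `X_H`. The cocycle property holds because `Δ` and twice the chosen operator differ by
a derivation, and `Δ` commutes with `Δ²`.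

The analytic and geometric work lies in the passage to supermanifolds. A superderivation is
determined by its values on coordinates, by Hadamard's lemma (`IsSDer.eq_zero_of_coord`). The local
`Δ` does not depend on the chart, by the formula for the derivative of a Berezinian
(`IsSDer.map_berezinian`, `Coords.lie_change`). The exponential does not depend on the chart,
because it is pinned down by its logarithmic derivatives and its underlying real function
(`Chart.exp_eq`). Gluing then produces the global objects. -/

noncomputable section

namespace OddPoisson

/-! ### Homogeneous elements and superderivations -/

section Parity

variable {R : Type*} [Ring R] [Algebra ℝ R]

/-- The sign `(-1)^k` of a parity `k`. -/
def sgn (k : Bool) : ℝ := bif k then -1 else 1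

@[simp] lemma sgn_true : sgn true = -1 := rfl

@[simp] lemma sgn_false : sgn false = 1 := rfl

/-- The `k`-th power of the parity involution. -/
def twist (α : R →ₐ[ℝ] R) (k : Bool) : R →ₐ[ℝ] R := bif k then α else AlgHom.id ℝ R

@[simp] lemma twist_true (α : R →ₐ[ℝ] R) (x : R) : twist α true x = α x := rfl

@[simp] lemma twist_false (α : R →ₐ[ℝ] R) (x : R) : twist α false x = x := rfl

/-- The element `f` is homogeneous of parity `k`. -/
def HasParity (α : R →ₐ[ℝ] R) (k : Bool) (f : R) : Prop := α f = sgn k • f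

/-- The operator `Y` is homogeneous of parity `k`. -/
def OpHasParity (α : R →ₐ[ℝ] R) (k : Bool) (Y : R →ₗ[ℝ] R) : Prop :=
  ∀ f, α (Y f) = sgn k • Y (α f)

/-- Superderivations of parity `k`. -/
structure IsSDer (α : R →ₐ[ℝ] R) (k : Bool) (Y : R →ₗ[ℝ] R) : Prop where
  parity : OpHasParity α k Y
  leibniz : ∀ f g, Y (f * g) = Y f * g + twist α k f * Y g

/-- The parity involution of a supercommutative algebra. -/
structure IsSuperParity (α : R →ₐ[ℝ] R) : Prop where
  invol : ∀ x, α (α x) = x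
  comm : ∀ a b, superComm α.toLinearMap a b = 0

variable {α : R →ₐ[ℝ] R} {k l : Bool} {f g : R}

lemma HasParity.twist (hf : HasParity α k f) (l : Bool) :
    OddPoisson.twist α l f = sgn (k && l) • f := by
  cases l <;> cases k <;> simp_all [HasParity]

lemma HasParity.add (hf : HasParity α k f) (hg : HasParity α k g) : HasParity α k (f + g) := by
  simp_all [HasParity]

lemma HasParity.sub (hf : HasParity α k f) (hg : HasParity α k g) : HasParity α k (f - g) := by
  simp_all [HasParity, smul_sub]

lemma HasParity.smul (hf : HasParity α k f) (c : ℝ) : HasParity α k (c • f) := by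
  unfold HasParity at *
  rw [map_smul, hf, smul_comm]

lemma HasParity.neg (hf : HasParity α k f) : HasParity α k (-f) := by
  simp_all [HasParity]

lemma HasParity.one : HasParity α false 1 := by simp [HasParity]

lemma HasParity.sum {ι : Type*} {s : Finset ι} {f : ι → R} (h : ∀ i ∈ s, HasParity α k (f i)) :
    HasParity α k (∑ i ∈ s, f i) := by
  simp only [HasParity, map_sum, Finset.smul_sum] at *
  exact Finset.sum_congr rfl h

lemma HasParity.mul (hf : HasParity α k f) (hg : HasParity α l g) :
    HasParity α (xor k l) (f * g) := by
  cases k <;> cases l <;> simp_all [HasParity]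

lemma OpHasParity.apply {Y : R →ₗ[ℝ] R} (hY : OpHasParity α k Y) (hf : HasParity α l f) :
    HasParity α (xor k l) (Y f) := by
  have := hY f
  cases k <;> cases l <;> simp_all [HasParity]

lemma IsSDer.apply {Y : R →ₗ[ℝ] R} (hY : IsSDer α k Y) (hf : HasParity α l f) :
    HasParity α (xor k l) (Y f) := hY.parity.apply hf

lemma hasParity_evenPart (hα : IsSuperParity α) (f : R) :
    HasParity α false (evenPart α.toLinearMap f) := by
  simp [HasParity, evenPart, hα.invol, add_comm]

lemma hasParity_oddPart (hα : IsSuperParity α) (f : R) :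
    HasParity α true (oddPart α.toLinearMap f) := by
  simp only [HasParity, oddPart, LinearMap.smul_apply, LinearMap.sub_apply, LinearMap.id_apply,
    AlgHom.toLinearMap_apply, map_smul, map_sub, hα.invol, sgn_true]
  module

lemma evenPart_add_oddPart (f : R) :
    evenPart α.toLinearMap f + oddPart α.toLinearMap f = f := by
  simp only [evenPart, oddPart, LinearMap.smul_apply, LinearMap.sub_apply, LinearMap.id_apply,
    AlgHom.toLinearMap_apply, LinearMap.add_apply]
  module

/-- An additive property holds for all elements if it holds for the homogeneous ones. -/
lemma IsSuperParity.induction (hα : IsSuperParity α) {P : R → Prop}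
    (hom : ∀ k f, HasParity α k f → P f) (add : ∀ f g, P f → P g → P (f + g)) (f : R) : P f := by
  rw [← evenPart_add_oddPart (α := α) f]
  exact add _ _ (hom _ _ (hasParity_evenPart hα f)) (hom _ _ (hasParity_oddPart hα f))

lemma IsSuperParity.mul_eq (hα : IsSuperParity α) (f g : R) :
    f * g = evenPart α.toLinearMap g * f + oddPart α.toLinearMap g * α f := by
  have := hα.comm f g
  rwa [superComm_apply, sub_eq_zero] at this

lemma HasParity.mul_comm (hf : HasParity α k f) (hα : IsSuperParity α) (g : R) :
    f * g = OddPoisson.twist α k g * f := by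
  rw [hα.mul_eq f g, hf]
  cases k <;> simp only [evenPart, oddPart, LinearMap.smul_apply, LinearMap.sub_apply,
    LinearMap.id_apply, AlgHom.toLinearMap_apply, LinearMap.add_apply, smul_mul_assoc, add_mul,
    sub_mul, sgn_false, sgn_true, mul_smul_comm, twist_true, twist_false] <;> module

lemma HasParity.mul_comm_of (hf : HasParity α k f) (hα : IsSuperParity α) (hg : HasParity α l g) :
    f * g = sgn (l && k) • (g * f) := by
  rw [hf.mul_comm hα, hg.twist, smul_mul_assoc]

/-- Even elements are central. -/
lemma HasParity.comm (hf : HasParity α false f) (hα : IsSuperParity α) (g : R) : f * g = g * f := by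
  simpa using hf.mul_comm hα g

lemma IsSDer.map_one {Y : R →ₗ[ℝ] R} (hY : IsSDer α k Y) : Y 1 = 0 := by
  simpa using hY.leibniz 1 1

lemma IsSDer.smul {Y : R →ₗ[ℝ] R} (hα : IsSuperParity α) (hg : HasParity α k g)
    (hY : IsSDer α l Y) : IsSDer α (xor k l) ((LinearMap.mulLeft ℝ g).comp Y) := by
  refine ⟨fun f => ?_, fun u v => ?_⟩
  · have := hY.parity f
    have hg' := hg
    cases k <;> cases l <;> simp_all [HasParity]
  · simp only [LinearMap.comp_apply, LinearMap.mulLeft_apply, hY.leibniz, mul_add, ← mul_assoc]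
    rw [hg.mul_comm hα (OddPoisson.twist α l u)]
    cases k <;> cases l <;> simp [hα.invol]

lemma IsSDer.add {Y Z : R →ₗ[ℝ] R} (hY : IsSDer α k Y) (hZ : IsSDer α k Z) :
    IsSDer α k (Y + Z) := by
  refine ⟨fun f => ?_, fun u v => ?_⟩
  · simp [hY.parity f, hZ.parity f]
  · simp only [LinearMap.add_apply, hY.leibniz, hZ.leibniz, add_mul, mul_add]; abel

lemma IsSDer.zero : IsSDer α k (0 : R →ₗ[ℝ] R) := ⟨fun f => by simp, by simp⟩

lemma IsSDer.const_smul {Y : R →ₗ[ℝ] R} (hY : IsSDer α k Y) (c : ℝ) : IsSDer α k (c • Y) :=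
  ⟨fun f => by rw [LinearMap.smul_apply, map_smul, hY.parity f, LinearMap.smul_apply, smul_comm], fun u v => by simp [hY.leibniz]⟩

lemma IsSDer.sub {Y Z : R →ₗ[ℝ] R} (hY : IsSDer α k Y) (hZ : IsSDer α k Z) :
    IsSDer α k (Y - Z) := by
  rw [sub_eq_add_neg, ← neg_one_smul ℝ Z]
  exact hY.add (hZ.const_smul _)

lemma IsSDer.sum {ι : Type*} {s : Finset ι} {Y : ι → R →ₗ[ℝ] R}
    (h : ∀ i ∈ s, IsSDer α k (Y i)) : IsSDer α k (∑ i ∈ s, Y i) := by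
  classical
  induction s using Finset.induction_on with
  | empty => exact IsSDer.zero
  | insert i s hi ih =>
    rw [Finset.sum_insert hi]
    exact (h i (by simp)).add (ih fun j hj => h j (by simp [hj]))

/-- The supercommutator of superderivations. -/
lemma IsSDer.commutator {Y Z : R →ₗ[ℝ] R} (hα : IsSuperParity α) (hY : IsSDer α k Y)
    (hZ : IsSDer α l Z) : IsSDer α (xor k l) (Y.comp Z - sgn (k && l) • Z.comp Y) := by
  refine ⟨fun f => ?_, fun u v => ?_⟩
  · have h1 := hY.parity (Z f)
    have h2 := hZ.parity (Y f)
    have h3 := hY.parity f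
    have h4 := hZ.parity f
    cases k <;> cases l <;> simp_all <;> abel
  · have h1 := fun f => hY.parity f
    have h2 := fun f => hZ.parity f
    cases k <;> cases l <;>
      simp_all [hY.leibniz, hZ.leibniz, mul_add, add_mul, mul_sub, sub_mul, hα.invol] <;>
      abel

/-- A superderivation is a differential operator of order `≤ 1`. -/
lemma IsSDer.mem_diffOps {Y : R →ₗ[ℝ] R} (hα : IsSuperParity α) (hY : IsSDer α k Y) :
    Y ∈ diffOps α 2 := by
  -- The Leibniz rule says that the commutator of `Y` with a function is again a function.
  have key : ∀ f, superComm (opParity α) Y (mulOp f) = mulOp (Y f) := by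
    intro f
    ext x
    have hp : opParity α Y = sgn k • Y := by
      ext x; rw [opParity_apply, hY.parity, hα.invol, LinearMap.smul_apply]
    rw [superComm_apply, hp]
    simp only [evenPart_mulOp hα.invol, oddPart_mulOp hα.invol, LinearMap.sub_apply,
      LinearMap.add_apply, Module.End.mul_apply, mulOp_apply, hY.leibniz, LinearMap.smul_apply]
    cases k <;> simp only [evenPart, oddPart, LinearMap.smul_apply, LinearMap.sub_apply,
      LinearMap.id_apply, AlgHom.toLinearMap_apply, LinearMap.add_apply, smul_mul_assoc, add_mul,
      sub_mul, sgn_false, sgn_true, mul_smul_comm, twist_true, twist_false] <;> module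
  rw [mem_diffOps_succ]
  intro f
  rw [key, mem_diffOps_succ]
  intro g
  rw [mem_diffOps_zero, superComm_mulOp_mulOp hα.invol hα.comm]

lemma mulOp_mem_diffOps (hα : IsSuperParity α) (f : R) : mulOp f ∈ diffOps α 1 := by
  rw [mem_diffOps_succ]
  intro g
  rw [mem_diffOps_zero, superComm_mulOp_mulOp hα.invol hα.comm]

end Parity

/-! ### Second-order operators and the odd bracket they generate -/

section SecondOrder

variable {R : Type*} [Ring R] [Algebra ℝ R]

/-- The failure of the operator `D` of parity `e` to be a superderivation. -/
def polar (α : R →ₐ[ℝ] R) (e : Bool) (D : R →ₗ[ℝ] R) : R →ₗ[ℝ] R →ₗ[ℝ] R :=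
  LinearMap.mk₂ ℝ (fun f g => D (f * g) - D f * g - twist α e f * D g)
    (fun f f' g => by simp only [add_mul, map_add]; abel)
    (fun c f g => by simp only [smul_mul_assoc, map_smul, smul_sub])
    (fun f g g' => by simp only [mul_add, map_add]; abel)
    (fun c f g => by simp only [mul_smul_comm, map_smul, smul_sub])

variable {α : R →ₐ[ℝ] R} {e k l : Bool} {f g h : R} {D : R →ₗ[ℝ] R}

lemma polar_apply (f g : R) :
    polar α e D f g = D (f * g) - D f * g - twist α e f * D g := rfl

lemma map_mul_eq_polar (f g : R) :
    D (f * g) = D f * g + twist α e f * D g + polar α e D f g := by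
  rw [polar_apply]; abel

lemma opParity_eq_smul (hα : IsSuperParity α) (hD : OpHasParity α e D) :
    opParity α D = sgn e • D := by
  ext x; rw [opParity_apply, hD, hα.invol, LinearMap.smul_apply]

lemma superComm_mulOp_apply (hα : IsSuperParity α) (hD : OpHasParity α e D)
    (hf : HasParity α k f) (x : R) :
    superComm (opParity α) D (mulOp f) x = D (f * x) - twist α e f * D x := by
  rw [superComm_apply, evenPart_mulOp hα.invol, oddPart_mulOp hα.invol, opParity_eq_smul hα hD,
    hf.twist]
  have hf' : α f = sgn k • f := hf
  cases k <;> cases e <;> simp_all [evenPart, oddPart] <;> module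

lemma superComm_mulOp_parity (hα : IsSuperParity α) (hD : OpHasParity α e D)
    (hf : HasParity α k f) :
    OpHasParity α (xor e k) (superComm (opParity α) D (mulOp f)) := by
  intro x
  have h1 := hD
  have hf' : α f = sgn k • f := hf
  simp only [superComm_mulOp_apply hα hD hf, map_sub, map_mul, hD _]
  rw [hf.twist]
  cases k <;> cases e <;> simp_all <;> abel

/-- An operator of order `≤ 2` without a term of order `0` polarises to superderivations. -/
lemma polar_isSDer (hα : IsSuperParity α) (hD : OpHasParity α e D) (hD1 : D 1 = 0)
    (hD3 : D ∈ diffOps α 3) (hf : HasParity α k f) : IsSDer α (xor e k) (polar α e D f) := by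
  have hB := superComm_mulOp_parity hα hD hf
  have key : ∀ l g, HasParity α l g → ∀ x,
      D (f * (g * x)) - twist α e f * D (g * x) -
        twist α (xor e k) g * (D (f * x) - twist α e f * D x) = polar α e D f g * x := by
    intro l g hg x
    -- The double commutator `[[D, f], g]` has order 0, hence is multiplication by its value at `1`.
    -- Since `D 1 = 0`, that value is `polar f g`.
    have h1 := eq_mulOp_of_mem hα.invol hα.comm (mem_diffOps_succ.1 (mem_diffOps_succ.1 hD3 f) g)
    have h2 := fun x => congrArg (fun A : Module.End ℝ R => A x) h1
    simp only [superComm_mulOp_apply hα hB hg, superComm_mulOp_apply hα hD hf, mulOp_apply,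
      mul_one, hD1, mul_zero, sub_zero] at h2
    rw [h2 x, ← (hD.apply hf).mul_comm hα, polar_apply]
    congr 1
    abel
  refine ⟨fun g => ?_, ?_⟩
  · have hf' : α f = sgn k • f := hf
    simp only [polar_apply, map_sub, map_mul, hD _, hf.twist]
    cases e <;> cases k <;> simp_all <;> abel
  · intro g
    refine hα.induction (P := fun g => ∀ x, polar α e D f (g * x) =
      polar α e D f g * x + twist α (xor e k) g * polar α e D f x) ?_ ?_ g
    · intro l g hg x
      rw [← key l g hg x]
      simp only [polar_apply, mul_sub]
      rw [← mul_assoc (twist α (xor e k) g) (D f), ← (hD.apply hf).mul_comm hα]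
      noncomm_ring
    · intro g g' h1 h2 x
      simp only [add_mul, map_add, h1, h2]; abel

/-- Only supercommutativity of the product enters: `f g` and `g f` differ by a sign, and the two
correction terms are exchanged. -/
lemma polar_symm (hα : IsSuperParity α) (hD : OpHasParity α e D) (hf : HasParity α k f)
    (hg : HasParity α l g) : polar α e D g f = sgn (k && l) • polar α e D f g := by
  simp only [polar_apply, hf.twist, hg.twist, smul_mul_assoc]
  rw [hg.mul_comm_of hα hf, (hD.apply hg).mul_comm_of hα hf, hg.mul_comm_of hα (hD.apply hf)]
  cases e <;> cases k <;> cases l <;> simp <;> abel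

/-- An odd operator of order `≤ 2` with `D 1 = 0` whose square has order `≤ 2`. -/
structure IsBV (α : R →ₐ[ℝ] R) (D : R →ₗ[ℝ] R) : Prop where
  odd : OpHasParity α true D
  map_one : D 1 = 0
  mem : D ∈ diffOps α 3
  sq_mem : D.comp D ∈ diffOps α 3

namespace IsBV

variable (hα : IsSuperParity α) (hD : IsBV α D)
include hα hD

lemma sder (hf : HasParity α k f) : IsSDer α (!k) (polar α true D f) := by
  simpa using polar_isSDer hα hD.odd hD.map_one hD.mem hf

lemma polar_hasParity (hf : HasParity α k f) (hg : HasParity α l g) :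
    HasParity α (xor (!k) l) (polar α true D f g) := (hD.sder hα hf).apply hg

lemma symm_of_even (hf : HasParity α false f) (g : R) :
    polar α true D f g = polar α true D g f := by
  induction g using hα.induction with
  | hom l g hg => simpa using (polar_symm hα hD.odd hf hg).symm
  | add g g' h1 h2 => simp [h1, h2]

omit hα in
lemma sq_hasParity : OpHasParity α false (D.comp D) := fun f => by
  simp [hD.odd _]

/-- This measures how far `D` is from being a derivation of its own bracket, and so links a
condition on `D²` to the bracket. -/
lemma polar_sq (f g : R) : polar α false (D.comp D) f g =
    D (polar α true D f g) + polar α true D (D f) g + polar α true D (α f) (D g) := by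
  simp only [polar_apply, LinearMap.comp_apply, map_sub, twist_false, twist_true, hD.odd f, hα.invol]
  simp only [sgn_true, neg_smul, one_smul]
  noncomm_ring

lemma polar_sq_isSDer (hf : HasParity α k f) :
    IsSDer α k (polar α false (D.comp D) f) := by
  simpa using polar_isSDer hα hD.sq_hasParity (by simp [hD.map_one]) hD.sq_mem hf

/-- The Jacobi identity. -/
lemma jacobi (hf : HasParity α k f) (hg : HasParity α l g) (h : R) :
    polar α true D (polar α true D f g) h =
      -sgn k • (polar α true D f (polar α true D g h) -
        sgn (!k && !l) • polar α true D g (polar α true D f h)) := by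
  -- As `D²` has order at most 2, its polarisation obeys the Leibniz rule. Rewriting it by
  -- `polar_sq` and expanding, all terms with a bare `D` cancel, and what is left is a relation
  -- between iterated brackets.
  have h1 := (hD.polar_sq_isSDer hα hf).leibniz g h
  simp only [hD.polar_sq hα] at h1
  have e1 := (hD.sder hα hf).leibniz
  have e2 := (hD.sder hα (hD.odd.apply hf)).leibniz
  have hf' : α f = sgn k • f := hf
  have hg' : α g = sgn l • g := hg
  have e3 := fun a b => map_mul_eq_polar (α := α) (D := D) (e := true) a b
  have e4 := hD.polar_hasParity hα hf hg
  have e5 := hD.odd.apply hg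
  simp only [e1, e2, e3, hf', map_smul, LinearMap.smul_apply, map_add] at h1
  rw [HasParity.twist hg, HasParity.twist e4, HasParity.twist hg, e5.twist] at h1
  cases k <;> cases l <;> simp_all <;> (try simp only [mul_add, add_mul, neg_mul, mul_neg] at h1) <;>
    (try rw [← sub_eq_zero] at h1 ⊢) <;> (rw [← h1]; abel)

/-- The Leibniz rule in the second argument is carried over to the first by `polar_symm`. -/
lemma polar_mul_left (hf : HasParity α k f) (hg : HasParity α l g) (h : R) :
    polar α true D (f * g) h =
      sgn k • (f * polar α true D g h) + sgn (l && !k) • (g * polar α true D f h) := by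
  induction h using hα.induction with
  | hom m h hh =>
    rw [polar_symm hα hD.odd hh (hf.mul hg), (hD.sder hα hh).leibniz,
      polar_symm hα hD.odd hf hh, polar_symm hα hD.odd hg hh, hf.twist, smul_mul_assoc,
      (hD.polar_hasParity hα hf hh).mul_comm_of hα hg]
    cases k <;> cases l <;> cases m <;> simp <;> abel
  | add h h' h1 h2 => simp only [map_add, h1, h2, mul_add, smul_add]; abel

end IsBV

end SecondOrder

/-! ### Coordinates, divergences and commutators -/

section Coordinates

variable {R : Type*} [Ring R] [Algebra ℝ R]

/-- Coordinates on a supercommutative algebra, with their partial derivatives: a superderivation is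
determined by its values on the coordinates. -/
structure Coords (α : R →ₐ[ℝ] R) (p q : ℕ) where
  x : Fin p ⊕ Fin q → R
  d : Fin p ⊕ Fin q → R →ₗ[ℝ] R
  parity_x : ∀ a, HasParity α a.isRight (x a)
  sder : ∀ a, IsSDer α a.isRight (d a)
  d_x : ∀ a b, d a (x b) = if a = b then 1 else 0
  ext : ∀ k Y, IsSDer α k Y → (∀ a, Y (x a) = 0) → Y = 0

namespace Coords

variable {α : R →ₐ[ℝ] R} {p q : ℕ} (c : Coords α p q) {k l : Bool} {Y Z : R →ₗ[ℝ] R}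
  {f g r s : R}

/-- The coefficient of the Lie derivative of the volume form `r Dx` along `Y`. -/
def lie (r : R) (Y : R →ₗ[ℝ] R) : R := ∑ a, c.d a (r * twist α a.isRight (Y (c.x a)))

/-- The coordinate divergence of `Y`. -/
def div (Y : R →ₗ[ℝ] R) : R := ∑ a, c.d a (twist α a.isRight (Y (c.x a)))

lemma lie_add (r : R) (Y Z : R →ₗ[ℝ] R) : c.lie r (Y + Z) = c.lie r Y + c.lie r Z := by
  simp [lie, mul_add, Finset.sum_add_distrib]

lemma lie_smul (r : R) (t : ℝ) (Y : R →ₗ[ℝ] R) : c.lie r (t • Y) = t • c.lie r Y := by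
  simp [lie, Finset.smul_sum]

lemma div_add (Y Z : R →ₗ[ℝ] R) : c.div (Y + Z) = c.div Y + c.div Z := by
  simp [div, Finset.sum_add_distrib]

lemma div_smul (t : ℝ) (Y : R →ₗ[ℝ] R) : c.div (t • Y) = t • c.div Y := by
  simp [div, Finset.smul_sum]

lemma div_sub (Y Z : R →ₗ[ℝ] R) : c.div (Y - Z) = c.div Y - c.div Z := by
  simp only [div, LinearMap.sub_apply, map_sub, Finset.sum_sub_distrib]

lemma div_sum {ι : Type*} (s : Finset ι) (Y : ι → R →ₗ[ℝ] R) :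
    c.div (∑ i ∈ s, Y i) = ∑ i ∈ s, c.div (Y i) := by
  simp only [div, LinearMap.sum_apply, map_sum]
  exact Finset.sum_comm

variable (hα : IsSuperParity α)

lemma twist_twist (hα : IsSuperParity α) (k : Bool) (f : R) : twist α k (twist α k f) = f := by
  cases k <;> simp [hα.invol]

include hα

/-- A superderivation in coordinates. -/
lemma eq_sum (hY : IsSDer α k Y) :
    Y = ∑ a, (LinearMap.mulLeft ℝ (Y (c.x a))).comp (c.d a) := by
  have h : IsSDer α k (Y - ∑ a, (LinearMap.mulLeft ℝ (Y (c.x a))).comp (c.d a)) := by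
    refine hY.sub (IsSDer.sum fun a _ => ?_)
    have := IsSDer.smul hα (hY.apply (c.parity_x a)) (c.sder a)
    simpa [Bool.xor_assoc] using this
  rw [← sub_eq_zero]
  refine c.ext k _ h fun b => ?_
  simp [c.d_x, -Fintype.sum_sum_type]

lemma apply_eq_sum (hY : IsSDer α k Y) (f : R) : Y f = ∑ a, Y (c.x a) * c.d a f := by
  conv_lhs => rw [c.eq_sum hα hY]
  simp

/-- Leibniz for each `∂_a`. The twist by the parity of `a` in the definition is exactly what moves
`∂_a r` past `Y x^a`, so that the remaining terms sum to `Y r`. -/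
lemma lie_eq (hY : IsSDer α k Y) (hr : HasParity α false r) :
    c.lie r Y = r * c.div Y + Y r := by
  rw [c.apply_eq_sum hα hY r, lie, div, Finset.mul_sum, ← Finset.sum_add_distrib]
  refine Finset.sum_congr rfl fun a _ => ?_
  have h1 : HasParity α a.isRight (c.d a r) := by simpa using (c.sder a).apply hr
  rw [(c.sder a).leibniz, hr.twist, h1.mul_comm hα, twist_twist hα]
  simp [add_comm]

/-- The source of the bracket term in the product rule for the Laplacian. -/
lemma div_mul (hg : HasParity α k g) (hY : IsSDer α l Y) :
    c.div ((LinearMap.mulLeft ℝ g).comp Y) = g * c.div Y + sgn (k && l) • Y g := by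
  rw [c.apply_eq_sum hα hY g, div, div, Finset.mul_sum, Finset.smul_sum, ← Finset.sum_add_distrib]
  refine Finset.sum_congr rfl fun a _ => ?_
  have h1 := hY.apply (c.parity_x a)
  have h2 := (c.sder a).apply hg
  simp only [LinearMap.comp_apply, LinearMap.mulLeft_apply, map_mul, (c.sder a).leibniz,
    twist_twist hα]
  rw [add_comm, h1.twist, hg.twist]
  simp only [map_smul, smul_mul_assoc, mul_smul_comm]
  rw [h2.mul_comm_of hα h1]
  cases k <;> cases l <;> cases a.isRight <;> simp

/-- Partial derivatives supercommute with each other. -/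
lemma d_comm (a b : Fin p ⊕ Fin q) (f : R) :
    c.d a (c.d b f) = sgn (a.isRight && b.isRight) • c.d b (c.d a f) := by
  have h := c.ext _ _ ((c.sder a).commutator hα (c.sder b)) fun e => by
    simp only [LinearMap.sub_apply, LinearMap.comp_apply, c.d_x, LinearMap.smul_apply]
    split_ifs <;> simp [(c.sder _).map_one]
  have h1 := LinearMap.congr_fun h f
  simpa [sub_eq_zero] using h1

/-- The divergence of a supercommutator. -/
lemma div_commutator (hY : IsSDer α k Y) (hZ : IsSDer α l Z) :
    c.div (Y.comp Z - sgn (k && l) • Z.comp Y) =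
      Y (c.div Z) - sgn (k && l) • Z (c.div Y) := by
  -- The composite is not a derivation, but its coordinate expression for the divergence still makes
  -- sense. It is `Y (div Z)` plus a double sum of products of first derivatives of the components;
  -- second derivatives are absorbed by commuting the partials.
  have key : ∀ k l (Y Z : R →ₗ[ℝ] R), IsSDer α k Y → IsSDer α l Z → c.div (Y.comp Z) =
      Y (c.div Z) + ∑ a, ∑ b, sgn (a.isRight && xor (xor k l) a.isRight) •
        (c.d a (Y (c.x b)) * c.d b (Z (c.x a))) := by
    intro k l Y Z hY hZ
    rw [c.apply_eq_sum hα hY (c.div Z)]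
    simp only [div, map_sum, Finset.mul_sum]
    rw [Finset.sum_comm, ← Finset.sum_add_distrib]
    refine Finset.sum_congr rfl fun a _ => ?_
    rw [LinearMap.comp_apply, c.apply_eq_sum hα hY (Z (c.x a)), map_sum, map_sum,
      ← Finset.sum_add_distrib]
    refine Finset.sum_congr rfl fun b _ => ?_
    have h1 := hY.apply (c.parity_x b)
    have h2 := hZ.apply (c.parity_x a)
    have h3 := (c.sder b).apply h2
    rw [(h1.mul h3).twist, h2.twist]
    simp only [map_smul, (c.sder a).leibniz, h1.twist, smul_mul_assoc, mul_smul_comm]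
    rw [c.d_comm hα a b, mul_smul_comm]
    cases k <;> cases l <;> cases a.isRight <;> cases b.isRight <;> simp <;> abel
  rw [div_sub, div_smul, key k l Y Z hY hZ, key l k Z Y hZ hY]
  -- The double sum is supersymmetric in `Y` and `Z`, as a relabelling of the indices shows, so it
  -- drops out of the commutator.
  have : ∑ a, ∑ b, sgn (a.isRight && xor (xor k l) a.isRight) •
        (c.d a (Y (c.x b)) * c.d b (Z (c.x a))) =
      sgn (k && l) • ∑ a, ∑ b, sgn (a.isRight && xor (xor l k) a.isRight) •
        (c.d a (Z (c.x b)) * c.d b (Y (c.x a))) := by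
    rw [Finset.sum_comm]
    simp only [Finset.smul_sum]
    refine Finset.sum_congr rfl fun a _ => Finset.sum_congr rfl fun b _ => ?_
    have h1 := (c.sder b).apply (hY.apply (c.parity_x a))
    have h2 := (c.sder a).apply (hZ.apply (c.parity_x b))
    rw [h1.mul_comm_of hα h2]
    cases k <;> cases l <;> cases a.isRight <;> cases b.isRight <;> simp
  rw [this, smul_add]
  abel

end Coords

/-! ### The odd Laplace operator in coordinates -/

namespace Coords

variable {α : R →ₐ[ℝ] R} {p q : ℕ} (c : Coords α p q) {k l : Bool} {f g h r s : R}
  {D : R →ₗ[ℝ] R}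

/-- The odd Laplace operator of the volume form `r Dx`, `s = r⁻¹`. -/
def laplace (D : R →ₗ[ℝ] R) (r s : R) : R →ₗ[ℝ] R where
  toFun f := s * c.lie r (polar α true D f)
  map_add' f g := by rw [map_add, lie_add, mul_add]
  map_smul' t f := by rw [map_smul, lie_smul, mul_smul_comm]; rfl

/-- A volume form `r Dx` with `s = r⁻¹`. -/
structure IsVol (α : R →ₐ[ℝ] R) (r s : R) : Prop where
  even : HasParity α false r
  even' : HasParity α false s
  inv : s * r = 1

/-- The image `α s` is also an inverse of `r`, and inverses are unique. -/
lemma _root_.OddPoisson.HasParity.of_mul_eq_one (hr : HasParity α false r) (h : s * r = 1)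
    (h' : r * s = 1) : HasParity α false s := by
  have hr' : α r = r := by simpa [HasParity] using hr
  have h1 : α s * r = 1 := by rw [← hr', ← map_mul, h, map_one]
  have : α s = s := left_inv_eq_right_inv h1 h'
  simpa [HasParity] using this

variable (hα : IsSuperParity α) (hD : IsBV α D) (hr : IsVol α r s)
include hα hD hr

omit hD hr in
lemma IsVol.mul_apply (hr : IsVol α r s) {Y : R →ₗ[ℝ] R} (hY : IsSDer α k Y) :
    s * c.lie r Y = c.div Y + s * Y r := by
  rw [c.lie_eq hα hY hr.even, mul_add, ← mul_assoc, hr.inv, one_mul]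

omit hα hD hr in
lemma _root_.OddPoisson.twist_of_even (hf : HasParity α false f) : twist α k f = f := by
  rw [hf.twist]; simp

/-- The working form of the Laplacian: coordinate divergence plus logarithmic derivative of the
density. It needs `f` homogeneous, because only then is `X_f` a superderivation of definite parity.
-/
lemma laplace_apply (hf : HasParity α k f) :
    c.laplace D r s f = c.div (polar α true D f) + s * polar α true D f r :=
  hr.mul_apply (c := c) hα (hD.sder hα hf)

lemma laplace_parity : OpHasParity α true (c.laplace D r s) := by
  intro f
  induction f using hα.induction with
  | hom k f hf =>
    have h1 : HasParity α (!k) (c.laplace D r s f) := by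
      rw [c.laplace_apply hα hD hr hf]
      refine HasParity.add (HasParity.sum fun a _ => ?_) ?_
      · have h2 := hD.polar_hasParity hα hf (c.parity_x a)
        rw [h2.twist]
        have h3 := ((c.sder a).apply h2).smul (sgn (a.isRight && (xor (!k) a.isRight)))
        rw [map_smul]
        cases k <;> cases h : a.isRight <;> simp_all
      · have := hr.even'.mul (hD.polar_hasParity hα hf hr.even)
        simpa using this
    have hf' : α f = sgn k • f := hf
    rw [h1, hf', map_smul]
    cases k <;> simp
  | add f g h1 h2 => simp only [map_add, h1, h2, smul_add]

/-- The odd Laplace operator on a product. -/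
lemma laplace_mul (f g : R) : c.laplace D r s (f * g) =
    c.laplace D r s f * g + α f * c.laplace D r s g + (2 : ℝ) • polar α true D f g := by
  induction f using hα.induction with
  | add f f' h1 h2 => simp only [add_mul, map_add, h1, h2, LinearMap.add_apply, smul_add]; abel
  | hom k f hf =>
  induction g using hα.induction with
  | add g g' h1 h2 => simp only [mul_add, map_add, h1, h2, smul_add]; abel
  | hom l g hg =>
  -- The field `X_{fg}` is a combination of `f X_g` and `g X_f`. By `div_mul` each contributes one
  -- mixed bracket, and the two agree by symmetry; hence the factor 2.
  have e1 : polar α true D (f * g) = sgn k • (LinearMap.mulLeft ℝ f).comp (polar α true D g) +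
      sgn (l && !k) • (LinearMap.mulLeft ℝ g).comp (polar α true D f) :=
    LinearMap.ext fun h => hD.polar_mul_left hα hf hg h
  have hf' : α f = sgn k • f := hf
  have h1 : HasParity α (!k) (c.laplace D r s f) := by
    simpa using (c.laplace_parity hα hD hr).apply hf
  have e2 := h1.mul_comm_of hα hg
  rw [e2, c.laplace_apply hα hD hr (hf.mul hg), e1, div_add, div_smul, div_smul,
    c.div_mul hα hf (hD.sder hα hg), c.div_mul hα hg (hD.sder hα hf), hf',
    c.laplace_apply hα hD hr hf, c.laplace_apply hα hD hr hg, polar_symm hα hD.odd hf hg]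
  simp only [LinearMap.add_apply, LinearMap.smul_apply, LinearMap.comp_apply,
    LinearMap.mulLeft_apply, mul_add, mul_smul_comm, smul_mul_assoc, ← mul_assoc,
    hr.even'.comm hα f, hr.even'.comm hα g]
  cases k <;> cases l <;> simp <;> module

/-- The odd Laplace operator is a derivation of the odd bracket. -/
lemma laplace_polar (hf : HasParity α k f) (g : R) :
    c.laplace D r s (polar α true D f g) + polar α true D (c.laplace D r s f) g +
      sgn k • polar α true D f (c.laplace D r s g) = 0 := by
  induction g using hα.induction with
  | add g g' h1 h2 =>
    rw [map_add, map_add, map_add, map_add, map_add, smul_add]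
    rw [← add_zero (0 : R)]
    nth_rw 1 [← h1]
    rw [← h2]
    abel
  | hom l g hg =>
  have hX := hD.sder hα hf
  have hY := hD.sder hα hg
  -- By Jacobi the field of a bracket is, up to sign, the commutator of the fields, so
  -- `div_commutator` applies.
  have e1 : polar α true D (polar α true D f g) =
      -sgn k • ((polar α true D f).comp (polar α true D g) -
        sgn (!k && !l) • (polar α true D g).comp (polar α true D f)) :=
    LinearMap.ext fun h => hD.jacobi hα hf hg h
  have h1 : HasParity α (!k) (c.laplace D r s f) := by
    simpa using (c.laplace_parity hα hD hr).apply hf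
  rw [c.laplace_apply hα hD hr (hD.polar_hasParity hα hf hg), polar_symm hα hD.odd hg h1, e1,
    div_smul, c.div_commutator hα hX hY, c.laplace_apply hα hD hr hf,
    c.laplace_apply hα hD hr hg]
  rw [map_add, map_add, hX.leibniz, hY.leibniz, LinearMap.smul_apply, LinearMap.sub_apply,
    LinearMap.smul_apply, LinearMap.comp_apply, LinearMap.comp_apply]
  have h2 : ∀ k (Y : R →ₗ[ℝ] R), IsSDer α k Y → Y s = - (s * s * Y r) := by
    intro k Y hY
    have := hY.leibniz s r
    rw [hr.inv, hY.map_one, twist_of_even hr.even'] at this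
    have h3 := congrArg (· * s) this
    simp only [zero_mul, add_mul, mul_assoc] at h3
    have h4 : r * s = 1 := by rw [hr.even.comm hα, hr.inv]
    rw [h4, mul_one, ← hr.even'.comm hα (Y r)] at h3
    rw [mul_assoc]
    exact eq_neg_of_add_eq_zero_left h3.symm
  -- These products come from differentiating `r⁻¹`; supercommutativity makes them cancel in the
  -- commutator.
  have h3 : polar α true D g r * polar α true D f r =
      sgn (!k && !l) • (polar α true D f r * polar α true D g r) := by
    have h4 := hD.polar_hasParity hα hf hr.even
    have h5 := hD.polar_hasParity hα hg hr.even
    rw [h5.mul_comm_of hα h4]; simp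
  rw [h2 _ _ hX, h2 _ _ hY, twist_of_even hr.even', twist_of_even hr.even']
  simp only [neg_mul, mul_assoc, h3, mul_smul_comm]
  cases k <;> cases l <;> simp [mul_sub, mul_add] <;> abel

/-- The odd Laplace operator of the volume form `g r Dx`. -/
lemma laplace_rescale {u : R} (hg : IsVol α g u) (f : R) :
    c.laplace D (g * r) (u * s) f = c.laplace D r s f + u * polar α true D g f := by
  have hgr : IsVol α (g * r) (u * s) := by
    refine ⟨by simpa using hg.even.mul hr.even, by simpa using hg.even'.mul hr.even', ?_⟩
    rw [mul_assoc u s (g * r), ← mul_assoc s g r, hr.even'.comm hα g, mul_assoc g s r, hr.inv,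
      mul_one, hg.inv]
  induction f using hα.induction with
  | add f f' h1 h2 => simp only [map_add, h1, h2, mul_add]; abel
  | hom k f hf =>
    -- Only the logarithmic derivative of the density changes, by `u X_f g`, and for even `g` this
    -- is `u X_g f`.
    rw [c.laplace_apply hα hD hgr hf, c.laplace_apply hα hD hr hf, (hD.sder hα hf).leibniz,
      hD.symm_of_even hα hg.even, twist_of_even hg.even, add_assoc, add_left_cancel_iff, mul_add, add_comm]
    congr 1
    · rw [mul_assoc u s _, ← mul_assoc s g,
        hr.even'.comm hα g, mul_assoc g, ← mul_assoc u, hg.inv, one_mul]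
    · rw [mul_assoc u s, hr.even'.comm hα, mul_assoc (polar α true D f g) r s,
        hr.even.comm hα s, hr.inv, mul_one]

end Coords

end Coordinates

/-! ### Algebra of odd Laplace operators: squares and rescaling -/

section OddLaplace

variable {R : Type*} [Ring R] [Algebra ℝ R]

/-- `L` is an odd Laplace operator of the odd bracket defined by `D`. -/
structure IsOddLaplace (α : R →ₐ[ℝ] R) (D L : R →ₗ[ℝ] R) : Prop where
  odd : OpHasParity α true L
  mul : ∀ f g, L (f * g) = L f * g + α f * L g + (2 : ℝ) • polar α true D f g
  map_polar : ∀ k f g, HasParity α k f →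
    L (polar α true D f g) + polar α true D (L f) g + sgn k • polar α true D f (L g) = 0

/-- The function `u Δ g - ½ u² (g, g)` with `u = g⁻¹`; up to the sign conventions it is
`2 g^{-1/2} Δ g^{1/2}`. -/
def rescaleH (α : R →ₐ[ℝ] R) (D L : R →ₗ[ℝ] R) (g u : R) : R :=
  u * L g - (2⁻¹ : ℝ) • (u * u * polar α true D g g)

variable {α : R →ₐ[ℝ] R} {D L : R →ₗ[ℝ] R} {g u : R}

open Coords

variable (hα : IsSuperParity α) (hD : IsBV α D) (hL : IsOddLaplace α D L)
include hα hD hL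

omit hα in
lemma IsOddLaplace.map_one : L 1 = 0 := by
  have := hL.mul 1 1
  simpa [polar_apply, hD.map_one] using this

omit hD in
/-- `Δ²` is a derivation. -/
lemma IsOddLaplace.sq_isSDer : IsSDer α false (L.comp L) := by
  refine ⟨fun f => by simp [hL.odd _], fun f g => ?_⟩
  induction f using hα.induction with
  | add f f' h1 h2 => simp only [add_mul, map_add, h1, h2]; abel
  | hom k f hf =>
    have h1 := hL.map_polar k f g hf
    have hf' : α f = sgn k • f := hf
    have h2 : α (L f) = -sgn k • L f := by rw [hL.odd, hf', map_smul]; simp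
    simp only [LinearMap.comp_apply, hL.mul, map_add, map_smul, twist_false, h2, hf',
      LinearMap.smul_apply]
    rw [← sub_eq_zero]
    -- Expanding `L (L (f g))` by the product rule twice, the defect from the Leibniz rule is twice
    -- the compatibility of `L` with the bracket.
    trans (2 : ℝ) • (L (polar α true D f g) + polar α true D (L f) g +
      sgn k • polar α true D f (L g))
    · have : sgn k * sgn k = 1 := by cases k <;> simp
      have h3 : α (α f) = f := hα.invol f
      rw [hf', map_smul, hf', smul_smul, this, one_smul] at *
      simp only [smul_mul_assoc, smul_smul]
      module
    · rw [h1, smul_zero]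

omit hL

omit hD in
/-- Superderivations of an inverse. -/
lemma IsSDer.map_inv {k : Bool} {Y : R →ₗ[ℝ] R} (hY : IsSDer α k Y) (hg : IsVol α g u) :
    Y u = -(u * u * Y g) := by
  have := hY.leibniz u g
  rw [hg.inv, hY.map_one, twist_of_even hg.even'] at this
  have h3 := congrArg (· * u) this
  simp only [zero_mul, add_mul, mul_assoc] at h3
  have h4 : g * u = 1 := by rw [hg.even.comm hα, hg.inv]
  rw [h4, mul_one, ← hg.even'.comm hα (Y g)] at h3
  rw [mul_assoc]
  exact eq_neg_of_add_eq_zero_left h3.symm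

lemma polar_inv_left (hg : IsVol α g u) (f : R) :
    polar α true D u f = -(u * u * polar α true D g f) := by
  induction f using hα.induction with
  | add f f' h1 h2 => simp only [map_add, h1, h2, mul_add]; abel
  | hom k f hf =>
    rw [hD.symm_of_even hα hg.even', hD.symm_of_even hα hg.even,
      (hD.sder hα hf).map_inv hα hg]

/-- For even `g` the field `X_g` is odd, so its square is half of its commutator with itself, which
Jacobi turns into a Hamiltonian field. -/
lemma HasParity.polar_self (hg : HasParity α false g) (f : R) :
    polar α true D g (polar α true D g f) =
      -(2⁻¹ : ℝ) • polar α true D (polar α true D g g) f := by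
  rw [hD.jacobi hα hg hg]
  simp
  module

include hL

lemma rescaleH_parity (hg : IsVol α g u) : HasParity α true (rescaleH α D L g u) := by
  have h1 := hL.odd.apply hg.even
  have h2 := hD.polar_hasParity hα hg.even hg.even
  exact (hg.even'.mul h1).sub (((hg.even'.mul hg.even').mul h2).smul _)

/-- The change of the square of the odd Laplace operator. -/
lemma IsOddLaplace.rescale_sq {L' : R →ₗ[ℝ] R} (hg : IsVol α g u)
    (hL' : ∀ f, L' f = L f + u * polar α true D g f) (f : R) :
    L' (L' f) = L (L f) - polar α true D (rescaleH α D L g u) f := by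
  have hu := hg.even'
  have hgu : g * u = 1 := by rw [hg.even.comm hα, hg.inv]
  have cu := fun x => hu.comm hα x
  have hw := hD.polar_hasParity hα hg.even hg.even
  have hLg := hL.odd.apply hg.even
  simp only [Bool.not_false, Bool.xor_false] at hw hLg
  -- Obtained by applying `L` to `u g = 1` and solving for `L u`; the second-order nature of `L`
  -- adds the bracket term.
  have e1 : L u = -(u * u * L g) + (2 : ℝ) • (u * u * u * polar α true D g g) := by
    have h1 := hL.mul u g
    rw [hg.inv, hL.map_one hD, polar_inv_left hα hD hg,
      show α u = u by simpa [HasParity] using hu] at h1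
    have h2 := congrArg (· * u) h1
    simp only [zero_mul, add_mul, mul_assoc, hgu, mul_one, smul_mul_assoc, neg_mul] at h2
    rw [← cu (L g), ← cu (polar α true D g g)] at h2
    rw [← sub_eq_zero, h2]
    simp only [mul_assoc]
    module
  have e2 : L (u * polar α true D g f) = L u * polar α true D g f -
      u * polar α true D (L g) f - u * polar α true D g (L f) +
      (u * u) • polar α true D (polar α true D g g) f := by
    have h1 := hL.map_polar _ g f hg.even
    rw [sgn_false, one_smul, add_assoc, add_eq_zero_iff_eq_neg] at h1
    rw [hL.mul, show α u = u by simpa [HasParity] using hu, h1, polar_inv_left hα hD hg,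
      hg.even.polar_self hα hD]
    simp only [mul_add, mul_neg, mul_smul_comm, smul_eq_mul, neg_smul]
    module
  have e3 : polar α true D g (u * polar α true D g f) =
      -(u * u * polar α true D g g * polar α true D g f) -
        (2⁻¹ : ℝ) • (u * polar α true D (polar α true D g g) f) := by
    rw [(hD.sder hα hg.even).leibniz, twist_of_even hu, (hD.sder hα hg.even).map_inv hα hg,
      hg.even.polar_self hα hD]
    simp only [mul_smul_comm, neg_smul, mul_neg, neg_mul]
    abel
  -- The expansion of `X_H f`; with `e1`, `e2` and `e3` it matches the square of `L + u X_g` term by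
  -- term.
  have e4 : polar α true D (rescaleH α D L g u) f =
      u * polar α true D (L g) f + u * u * L g * polar α true D g f -
      (2⁻¹ : ℝ) • (u * u * polar α true D (polar α true D g g) f) -
      u * u * u * polar α true D g g * polar α true D g f := by
    rw [rescaleH, map_sub, map_smul, LinearMap.sub_apply, LinearMap.smul_apply,
      hD.polar_mul_left hα hu hLg, hD.polar_mul_left hα (hu.mul hu) hw,
      hD.polar_mul_left hα hu hu, polar_inv_left hα hD hg]
    simp only [Bool.not_false, Bool.and_true, sgn_true, sgn_false, one_smul,
      Bool.xor_false, mul_neg, mul_add, neg_smul, neg_neg, ← mul_assoc]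
    rw [← cu (L g), mul_assoc u (L g) u, ← cu (L g), ← cu (polar α true D g g),
      mul_assoc u (polar α true D g g) u, ← cu (polar α true D g g),
      ← mul_assoc u u (polar α true D g g), mul_assoc (u * u) (polar α true D g g) u,
      ← cu (polar α true D g g)]
    simp only [mul_assoc]
    module
  rw [hL', hL' f, map_add, map_add, e2, e3, e4, e1]
  simp only [mul_add, add_mul, mul_sub, neg_mul, mul_neg, smul_mul_assoc, mul_smul_comm,
    smul_eq_mul, ← mul_assoc]
  module

end OddLaplace

/-! ### Exponentials -/

section Exponential

variable {R : Type*} [Ring R] [Algebra ℝ R] {α : R →ₐ[ℝ] R} {D : R →ₗ[ℝ] R} {σ g u : R}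

/-- The chain rule for `g = e^σ`. -/
def IsLogOf (α : R →ₐ[ℝ] R) (σ g : R) : Prop :=
  ∀ k (Y : R →ₗ[ℝ] R), IsSDer α k Y → Y g = g * Y σ

open Coords

variable (hα : IsSuperParity α) (hD : IsBV α D)
include hα hD

/-- The chain rule is assumed for derivations, that is in the second slot; evenness allows the
arguments to be exchanged. -/
lemma IsLogOf.polar_left (h : IsLogOf α σ g) (hσ : HasParity α false σ) (hg : HasParity α false g)
    (f : R) : polar α true D g f = g * polar α true D σ f := by
  induction f using hα.induction with
  | add f f' h1 h2 => simp only [map_add, h1, h2, mul_add]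
  | hom k f hf =>
    rw [hD.symm_of_even hα hg, hD.symm_of_even hα hσ, h _ _ (hD.sder hα hf)]

/-- Since `X_g = g X_σ`, the rule for `div (g Y)` produces the extra term `X_σ g = g X_σ σ`. -/
lemma Coords.laplace_exp {p q : ℕ} (c : Coords α p q) {r s : R} (hr : IsVol α r s)
    (h : IsLogOf α σ g) (hσ : HasParity α false σ) (hg : HasParity α false g) :
    c.laplace D r s g = g * (c.laplace D r s σ + polar α true D σ σ) := by
  have e1 : polar α true D g = (LinearMap.mulLeft ℝ g).comp (polar α true D σ) :=
    LinearMap.ext fun f => h.polar_left hα hD hσ hg f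
  have hY := hD.sder hα hσ
  rw [c.laplace_apply hα hD hr hg, c.laplace_apply hα hD hr hσ, e1, c.div_mul hα hg hY,
    h _ _ hY]
  simp only [Bool.false_and, sgn_false, one_smul, mul_add, LinearMap.comp_apply,
    LinearMap.mulLeft_apply, ← mul_assoc, hg.comm hα s]
  abel

end Exponential

/-! ### The Berezinian -/

/-- Jacobi's formula for the derivative of a determinant. -/
lemma _root_.Derivation.map_det {K A M n : Type*} [CommRing K] [CommRing A] [Algebra K A]
    [AddCommGroup M] [Module A M] [Module K M] [Fintype n] [DecidableEq n]
    (δ : Derivation K A M) (N : Matrix n n A) :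
    δ N.det = ∑ i, ∑ k, N.adjugate i k • δ (N k i) := by
  have hp : ∀ (s : Finset n) (f : n → A), δ (∏ i ∈ s, f i) =
      ∑ i ∈ s, (∏ j ∈ s.erase i, f j) • δ (f i) := by
    intro s f
    induction s using Finset.induction_on with
    | empty => simp
    | insert a s ha ih =>
      rw [Finset.prod_insert ha, Derivation.leibniz, ih, Finset.sum_insert ha,
        Finset.erase_insert ha, add_comm, Finset.smul_sum]
      congr 1
      refine Finset.sum_congr rfl fun i hi => ?_
      have : i ≠ a := fun h => ha (h ▸ hi)
      rw [Finset.erase_insert_of_ne this.symm, Finset.prod_insert (by simp [ha]), smul_smul]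
  rw [Matrix.det_apply, map_sum]
  -- An adjugate entry is the determinant with column `i` replaced by a basis vector, so only the
  -- permutations with `σ i = k` survive.
  have h1 : ∀ i k, N.adjugate i k = ∑ σ : Equiv.Perm n, if σ i = k then
      Equiv.Perm.sign σ • ∏ j ∈ Finset.univ.erase i, N (σ j) j else 0 := by
    intro i k
    have h0 : N.adjugate i k = (N.updateCol i (Pi.single k 1)).det := by
      rw [← Matrix.cramer_apply, Matrix.cramer_eq_adjugate_mulVec, Matrix.mulVec_single_one]
      rfl
    rw [h0, Matrix.det_apply]
    refine Finset.sum_congr rfl fun σ _ => ?_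
    rw [← Finset.mul_prod_erase _ _ (Finset.mem_univ i), Matrix.updateCol_self, Pi.single_apply]
    have : ∏ j ∈ Finset.univ.erase i, N.updateCol i (Pi.single k 1) (σ j) j =
        ∏ j ∈ Finset.univ.erase i, N (σ j) j :=
      Finset.prod_congr rfl fun j hj => by
        rw [Matrix.updateCol_ne (Finset.ne_of_mem_erase hj)]
    rw [this]
    split_ifs <;> simp
  simp only [h1, Finset.sum_smul]
  have h2 : ∀ i, ∑ k, ∑ σ : Equiv.Perm n, (if σ i = k then
      Equiv.Perm.sign σ • ∏ j ∈ Finset.univ.erase i, N (σ j) j else 0) • δ (N k i) =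
      ∑ σ : Equiv.Perm n, (Equiv.Perm.sign σ • ∏ j ∈ Finset.univ.erase i, N (σ j) j) •
        δ (N (σ i) i) := by
    intro i
    rw [Finset.sum_comm]
    refine Finset.sum_congr rfl fun σ _ => ?_
    simp [ite_smul]
  simp only [h2]
  rw [Finset.sum_comm]
  refine Finset.sum_congr rfl fun σ _ => ?_
  rw [Units.smul_def, map_zsmul, hp, Finset.smul_sum]
  exact Finset.sum_congr rfl fun i _ => by rw [Units.smul_def, smul_assoc]

/-! ### Determinants of matrices with even entries -/

section Even

variable {R : Type*} [Ring R] [Algebra ℝ R]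

/-- The subalgebra of even elements. -/
def evenSubalgebra (α : R →ₐ[ℝ] R) : Subalgebra ℝ R := AlgHom.equalizer α (AlgHom.id ℝ R)

variable {α : R →ₐ[ℝ] R} {k l : Bool}

lemma mem_evenSubalgebra {f : R} : f ∈ evenSubalgebra α ↔ HasParity α false f := by
  simp [evenSubalgebra, HasParity, AlgHom.mem_equalizer]

/-- The commutative ring of even elements. -/
@[reducible] def evenCommRing (hα : IsSuperParity α) : CommRing (evenSubalgebra α) :=
  { (inferInstance : Ring (evenSubalgebra α)) with
    mul_comm := fun a b => Subtype.ext ((mem_evenSubalgebra.1 a.2).comm hα b) }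

/-- All entries of the matrix `A` are homogeneous of parity `k`. -/
def MatParity (α : R →ₐ[ℝ] R) (k : Bool) {m n : Type*} (A : Matrix m n R) : Prop :=
  ∀ i j, HasParity α k (A i j)

section

variable {m n o : Type*} [Fintype m] [Fintype n] [Fintype o]

omit [Fintype m] [Fintype o] in
lemma MatParity.mul {A : Matrix m n R} {B : Matrix n o R} (hA : MatParity α k A)
    (hB : MatParity α l B) : MatParity α (xor k l) (A * B) :=
  fun i j => HasParity.sum fun e _ => (hA i e).mul (hB e j)

omit [Fintype m] [Fintype n] in
lemma MatParity.sub {A B : Matrix m n R} (hA : MatParity α k A)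
    (hB : MatParity α k B) : MatParity α k (A - B) := fun i j => (hA i j).sub (hB i j)

omit [Fintype m] [Fintype n] in
lemma MatParity.map {A : Matrix m n R} (hA : MatParity α k A) {Y : R →ₗ[ℝ] R}
    (hY : IsSDer α l Y) : MatParity α (xor l k) (A.map Y) := fun i j => hY.apply (hA i j)

lemma MatParity.trace_mul {A : Matrix m n R} {B : Matrix n m R} (hα : IsSuperParity α)
    (hA : MatParity α k A) (hB : MatParity α l B) :
    (A * B).trace = sgn (k && l) • (B * A).trace := by
  simp only [Matrix.trace, Matrix.diag, Matrix.mul_apply, Finset.smul_sum]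
  rw [Finset.sum_comm]
  refine Finset.sum_congr rfl fun i _ => Finset.sum_congr rfl fun j _ => ?_
  rw [(hA j i).mul_comm_of hα (hB i j), Bool.and_comm]

omit [Fintype m] [Fintype o] in
lemma IsSDer.map_matrix_mul {Y : R →ₗ[ℝ] R} (hY : IsSDer α l Y) {A : Matrix m n R}
    {B : Matrix n o R} (hA : MatParity α k A) :
    (A * B).map Y = A.map Y * B + sgn (l && k) • (A * B.map Y) := by
  ext i j
  simp only [Matrix.map_apply, Matrix.mul_apply, map_sum, hY.leibniz, Matrix.add_apply,
    Matrix.smul_apply, Finset.sum_add_distrib, Finset.smul_sum]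
  congr 1
  exact Finset.sum_congr rfl fun e _ => by
    rw [(hA i e).twist, smul_mul_assoc, Bool.and_comm]

end

variable {n : ℕ} {N N' : Matrix (Fin n) (Fin n) R}

/-- The lift of a matrix with even entries to the commutative ring of even elements. -/
def evenLift {m n : Type*} {N : Matrix m n R} (hN : MatParity α false N) :
    Matrix m n (evenSubalgebra α) :=
  Matrix.of fun i j => ⟨N i j, mem_evenSubalgebra.2 (hN i j)⟩

/-- Even elements commute, so the ordered products in the Leibniz formula lose their ordering and
the theory of determinants over commutative rings becomes available. -/
lemma leibnizDet_eq (hα : IsSuperParity α) (hN : MatParity α false N) :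
    letI := evenCommRing hα
    leibnizDet N = ((evenLift hN).det : R) := by
  let _ := evenCommRing hα
  rw [Matrix.det_apply, leibnizDet]
  change _ = (evenSubalgebra α).val _
  rw [map_sum]
  refine Finset.sum_congr rfl fun σ _ => ?_
  rw [Units.smul_def, map_zsmul, ← List.prod_ofFn, map_list_prod, List.map_ofFn]
  rfl

lemma leibnizDet_parity (hα : IsSuperParity α) (hN : MatParity α false N) :
    HasParity α false (leibnizDet N) := by
  rw [leibnizDet_eq hα hN]
  exact mem_evenSubalgebra.1 (Subtype.property _)

lemma leibnizDet_isUnit (hα : IsSuperParity α) (hN : MatParity α false N)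
    (hN' : MatParity α false N') (h : N * N' = 1) : IsUnit (leibnizDet N) := by
  let _ := evenCommRing hα
  rw [leibnizDet_eq hα hN]
  have h1 : evenLift hN * evenLift hN' = 1 := by
    ext i j
    have := congrFun (congrFun h i) j
    have h2 : (((evenLift hN * evenLift hN') i j : evenSubalgebra α) : R) = (N * N') i j := by
      rw [Matrix.mul_apply, Matrix.mul_apply]
      exact map_sum (evenSubalgebra α).val _ _
    rw [h2, this, Matrix.one_apply, Matrix.one_apply]
    split_ifs <;> rfl
  have h2 : IsUnit (evenLift hN).det :=
    IsUnit.of_mul_eq_one (evenLift hN').det (by rw [← Matrix.det_mul, h1, Matrix.det_one])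
  exact h2.map (evenSubalgebra α).val

/-- Jacobi's formula for superderivations of determinants of even matrices. -/
lemma IsSDer.map_leibnizDet {Y : R →ₗ[ℝ] R} (hα : IsSuperParity α) (hY : IsSDer α k Y)
    (hN : MatParity α false N) (h : N * N' = 1) :
    Y (leibnizDet N) = leibnizDet N * (N' * N.map Y).trace := by
  let _ := evenCommRing hα
  -- Restricted to even elements, a superderivation of either parity is an ordinary derivation into
  -- the module `R`.
  let δ : Derivation ℝ (evenSubalgebra α) R := Derivation.mk' (Y.comp (evenSubalgebra α).val.toLinearMap) (by
    intro a b
    have ha := mem_evenSubalgebra.1 a.2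
    have hb := mem_evenSubalgebra.1 b.2
    change Y (a.1 * b.1) = a.1 * Y b.1 + b.1 * Y a.1
    rw [hY.leibniz, twist_of_even ha, hb.comm hα, add_comm])
  have h1 : Y (leibnizDet N) = δ (evenLift hN).det := by
    rw [leibnizDet_eq hα hN]; rfl
  have h2 : (evenLift hN).adjugate.map (evenSubalgebra α).val = leibnizDet N • N' := by
    have h3 := congrArg (fun A => A.map (evenSubalgebra α).val) (Matrix.adjugate_mul (evenLift hN))
    have h4 : (evenLift hN).map (evenSubalgebra α).val = N := rfl
    have h5 : ∀ A B : Matrix (Fin n) (Fin n) (evenSubalgebra α),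
        (A * B).map (evenSubalgebra α).val =
          A.map (evenSubalgebra α).val * B.map (evenSubalgebra α).val := by
      intro A B
      ext i j
      rw [Matrix.mul_apply, Matrix.map_apply, Matrix.mul_apply, map_sum]
      rfl
    have h6 : (((evenLift hN).det • (1 : Matrix (Fin n) (Fin n) (evenSubalgebra α))).map
        (evenSubalgebra α).val) = leibnizDet N • (1 : Matrix (Fin n) (Fin n) R) := by
      ext i j
      rw [leibnizDet_eq hα hN]
      simp only [Matrix.map_apply, Matrix.smul_apply, Matrix.one_apply, smul_eq_mul]
      split_ifs <;> simp
    simp only [h5, h4, h6] at h3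
    have h7 := congrArg (· * N') h3
    simpa [mul_assoc, h] using h7
  rw [h1, Derivation.map_det, Matrix.trace, Finset.mul_sum]
  refine Finset.sum_congr rfl fun i _ => ?_
  rw [Matrix.diag, Matrix.mul_apply, Finset.mul_sum]
  refine Finset.sum_congr rfl fun j _ => ?_
  have := congrFun (congrFun h2 i) j
  rw [Matrix.smul_apply, smul_eq_mul] at this
  rw [← mul_assoc, ← this]
  rfl

/-- An even matrix that is invertible modulo products of odd elements is invertible. -/
lemma exists_inverse_of_odd_mul {m : Type*} [Fintype m] (hα : IsSuperParity α)
    (hN : MatParity α false N) (hN' : MatParity α false N') {A : Matrix (Fin n) m R}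
    {B : Matrix m (Fin n) R} (hA : MatParity α true A) (hB : MatParity α true B)
    (h : A * B + N * N' = 1) :
    ∃ M, MatParity α false M ∧ N * M = 1 ∧ M * N = 1 := by
  let _ := evenCommRing hα
  have hAB : MatParity α false (A * B) := hA.mul hB
  have hsq : ∀ f, HasParity α true f → f * f = 0 := by
    intro f hf
    have h1 := hf.mul_comm_of hα hf
    simp only [Bool.and_self, sgn_true, neg_smul, one_smul] at h1
    have h2 : (2 : ℝ) • (f * f) = 0 := by rw [two_smul]; nth_rw 1 [h1]; simp
    simpa using h2
  -- A product of two odd elements squares to zero, and in a commutative ring sums of nilpotents are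
  -- nilpotent.
  have hnil : ∀ i j, IsNilpotent (evenLift hAB i j) := by
    intro i j
    have h1 : ∀ e, HasParity α false (A i e * B e j) := fun e => (hA i e).mul (hB e j)
    have : evenLift hAB i j =
        ∑ e, (⟨A i e * B e j, mem_evenSubalgebra.2 (h1 e)⟩ : evenSubalgebra α) := by
      apply Subtype.ext
      change (A * B) i j = (evenSubalgebra α).val _
      rw [map_sum]
      rfl
    rw [this]
    refine isNilpotent_sum fun e _ => ⟨2, Subtype.ext ?_⟩
    rw [pow_two]
    change A i e * B e j * (A i e * B e j) = 0
    rw [mul_assoc, ← mul_assoc (B e j), (hB e j).mul_comm_of hα (hA i e)]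
    simp only [smul_mul_assoc, mul_assoc, hsq _ (hB e j), mul_zero, smul_zero]
  have h1 : evenLift hN * evenLift hN' = 1 - evenLift hAB := by
    rw [eq_sub_iff_add_eq, add_comm]
    ext i j
    have := congrFun (congrFun h i) j
    have h2 : (((evenLift hAB + evenLift hN * evenLift hN') i j : evenSubalgebra α) : R) =
        (A * B + N * N') i j := by
      rw [Matrix.add_apply, Matrix.add_apply, Matrix.mul_apply (M := N), Matrix.mul_apply (M := evenLift hN)]
      change (A * B) i j + (evenSubalgebra α).val _ = _
      rw [map_sum]
      rfl
    rw [h2, this, Matrix.one_apply, Matrix.one_apply]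
    split_ifs <;> rfl
  have h2 : IsUnit (evenLift hN).det := by
    refine isUnit_of_mul_isUnit_left (y := (evenLift hN').det) ?_
    rw [← Matrix.det_mul, h1]
    let φ := Ideal.Quotient.mk (nilradical (evenSubalgebra α))
    -- Modulo the nilradical the matrix is the identity, so its determinant is `1` plus a nilpotent
    -- element.
    have h3 : φ ((1 - evenLift hAB).det) = 1 := by
      rw [RingHom.map_det, map_sub, map_one]
      have : φ.mapMatrix (evenLift hAB) = 0 := by
        ext i j
        exact Ideal.Quotient.eq_zero_iff_mem.2 (mem_nilradical.2 (hnil i j))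
      rw [this, sub_zero, Matrix.det_one]
    rw [← map_one φ, Ideal.Quotient.eq, mem_nilradical] at h3
    simpa using h3.isUnit_add_one
  refine ⟨(evenLift hN)⁻¹.map (evenSubalgebra α).val,
    fun i j => mem_evenSubalgebra.1 ((evenLift hN)⁻¹ i j).2, ?_, ?_⟩
  · have h3 := congrArg (fun A => A.map (evenSubalgebra α).val) (Matrix.mul_nonsing_inv _ h2)
    convert h3 using 1
    · ext i j
      rw [Matrix.mul_apply, Matrix.map_apply, Matrix.mul_apply, map_sum]
      rfl
    · rw [Matrix.map_one _ rfl rfl]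
  · have h3 := congrArg (fun A => A.map (evenSubalgebra α).val) (Matrix.nonsing_inv_mul _ h2)
    convert h3 using 1
    · ext i j
      rw [Matrix.mul_apply, Matrix.map_apply, Matrix.mul_apply, map_sum]
      rfl
    · rw [Matrix.map_one _ rfl rfl]

end Even

/-! ### The derivative of the Berezinian and the change of coordinates -/

section Berezin

variable {R : Type*} [Ring R] [Algebra ℝ R] {α : R →ₐ[ℝ] R} {p q : ℕ} {k l : Bool} {r s r' s' : R}

lemma _root_.Ring.inverse_eq_of_mul_eq_one {S : Type*} [Ring S] {a b : S} (h : a * b = 1)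
    (h' : b * a = 1) : Ring.inverse a = b := by
  let v : Sˣ := ⟨a, b, h, h'⟩
  exact Ring.inverse_unit v

/-- The derivative of the Berezinian of an even invertible supermatrix. -/
lemma IsSDer.map_berezinian (hα : IsSuperParity α) {Y : R →ₗ[ℝ] R} (hY : IsSDer α k Y)
    {J K : Matrix (Fin p ⊕ Fin q) (Fin p ⊕ Fin q) R}
    (hJ : ∀ a b, HasParity α (xor a.isRight b.isRight) (J a b))
    (hK : ∀ a b, HasParity α (xor a.isRight b.isRight) (K a b))
    (hJK : J * K = 1) (hKJ : K * J = 1) :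
    Y (berezinian J) = berezinian J * ∑ b, ∑ e,
      sgn (xor (b.isRight && !k) (k && e.isRight)) • (K b e * Y (J e b)) := by
  obtain ⟨A, hA⟩ : ∃ A, A = J.toBlocks₁₁ := ⟨_, rfl⟩
  obtain ⟨B, hB⟩ : ∃ B, B = J.toBlocks₁₂ := ⟨_, rfl⟩
  obtain ⟨C, hC⟩ : ∃ C, C = J.toBlocks₂₁ := ⟨_, rfl⟩
  obtain ⟨D, hD⟩ : ∃ D, D = J.toBlocks₂₂ := ⟨_, rfl⟩
  obtain ⟨K1, hK1⟩ : ∃ A, A = K.toBlocks₁₁ := ⟨_, rfl⟩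
  obtain ⟨K2, hK2⟩ : ∃ A, A = K.toBlocks₁₂ := ⟨_, rfl⟩
  obtain ⟨K3, hK3⟩ : ∃ A, A = K.toBlocks₂₁ := ⟨_, rfl⟩
  obtain ⟨K4, hK4⟩ : ∃ A, A = K.toBlocks₂₂ := ⟨_, rfl⟩
  have pA : MatParity α false A := fun i j => by rw [hA]; exact hJ (.inl i) (.inl j)
  have pB : MatParity α true B := fun i j => by rw [hB]; exact hJ (.inl i) (.inr j)
  have pC : MatParity α true C := fun i j => by rw [hC]; exact hJ (.inr i) (.inl j)
  have pD : MatParity α false D := fun i j => by rw [hD]; exact hJ (.inr i) (.inr j)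
  have pK1 : MatParity α false K1 := fun i j => by rw [hK1]; exact hK (.inl i) (.inl j)
  have pK2 : MatParity α true K2 := fun i j => by rw [hK2]; exact hK (.inl i) (.inr j)
  have pK4 : MatParity α false K4 := fun i j => by rw [hK4]; exact hK (.inr i) (.inr j)
  have eJ : J = Matrix.fromBlocks A B C D := by
    rw [hA, hB, hC, hD, Matrix.fromBlocks_toBlocks]
  have eK : K = Matrix.fromBlocks K1 K2 K3 K4 := by
    rw [hK1, hK2, hK3, hK4, Matrix.fromBlocks_toBlocks]
  have h1 := hJK
  have h2 := hKJ
  rw [eJ, eK, Matrix.fromBlocks_multiply, ← Matrix.fromBlocks_one, Matrix.fromBlocks_inj] at h1 h2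
  obtain ⟨a1, a2, a3, a4⟩ := h1
  obtain ⟨b1, b2, b3, b4⟩ := h2
  -- The lower right block of `J K = 1` reads `C K2 + D K4 = 1` with `C`, `K2` odd; hence `D` is
  -- invertible. The identities that follow express the blocks of `K` through `E = D⁻¹` and `K1`.
  obtain ⟨E, pE, hDE, hED⟩ := exists_inverse_of_odd_mul hα pD pK4 pC pK2 a4
  have e3 : K3 = -(E * C * K1) := by
    have := congrArg (E * ·) a3
    simp only [Matrix.mul_add, Matrix.mul_zero, ← Matrix.mul_assoc, hED, Matrix.one_mul] at this
    rw [Matrix.mul_assoc] at this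
    rw [eq_neg_iff_add_eq_zero, add_comm, Matrix.mul_assoc]; exact this
  have e2 : K2 = -(K1 * B * E) := by
    have := congrArg (· * E) b2
    simp only [Matrix.zero_mul, Matrix.add_mul, Matrix.mul_assoc, hDE, Matrix.mul_one] at this
    rw [eq_neg_iff_add_eq_zero, add_comm, Matrix.mul_assoc]; exact this
  have e4 : K4 = E + E * C * K1 * B * E := by
    have := congrArg (E * ·) a4
    simp only [Matrix.mul_add, ← Matrix.mul_assoc, hED, Matrix.one_mul, Matrix.mul_one] at this
    rw [e2] at this
    simp only [Matrix.mul_neg, ← Matrix.mul_assoc] at this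
    have h : K4 = (-(E * C * K1 * B * E) + K4) + E * C * K1 * B * E := by abel
    rwa [this] at h
  -- The Schur complement, whose inverse turns out to be `K1`.
  obtain ⟨S, hS⟩ : ∃ S, S = A - B * E * C := ⟨_, rfl⟩
  have pS : MatParity α false S := by
    rw [hS]; exact pA.sub ((pB.mul pE).mul pC)
  have hSK : S * K1 = 1 := by
    rw [hS, Matrix.sub_mul, ← a1, e3, Matrix.mul_neg, sub_eq_add_neg]
    simp only [Matrix.mul_assoc]
  have hKS : K1 * S = 1 := by
    rw [hS, Matrix.mul_sub, ← b1, e2, Matrix.neg_mul, sub_eq_add_neg]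
    simp only [Matrix.mul_assoc]
  have hber : berezinian J = leibnizDet S * Ring.inverse (leibnizDet D) := by
    rw [berezinian, ← hA, ← hB, ← hC, ← hD, Ring.inverse_eq_of_mul_eq_one hDE hED, ← hS]
  obtain ⟨v, hv⟩ := leibnizDet_isUnit hα pD pE hDE
  have hv1 : leibnizDet D * (↑v⁻¹ : R) = 1 := by rw [← hv]; simp
  have hv2 : (↑v⁻¹ : R) * leibnizDet D = 1 := by rw [← hv]; simp
  have pv : HasParity α false (↑v⁻¹ : R) := (leibnizDet_parity hα pD).of_mul_eq_one hv2 hv1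
  have hvol : Coords.IsVol α (leibnizDet D) (↑v⁻¹ : R) := ⟨leibnizDet_parity hα pD, pv, hv2⟩
  have dE : E.map Y = -(E * D.map Y * E) := by
    have h1 := hY.map_matrix_mul (A := E) (B := D) pE
    have h2 : (1 : Matrix (Fin q) (Fin q) R).map Y = 0 := by
      ext i j
      rw [Matrix.map_apply, Matrix.one_apply]
      split_ifs <;> simp [hY.map_one]
    rw [hED, h2] at h1
    have h3 := congrArg (· * E) h1
    simp only [Bool.and_false, sgn_false, one_smul, Matrix.add_mul, Matrix.zero_mul,
      Matrix.mul_assoc, hDE, Matrix.mul_one] at h3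
    rw [eq_neg_iff_add_eq_zero, Matrix.mul_assoc]; exact h3.symm
  have dS : S.map Y = A.map Y - B.map Y * E * C + sgn k • (B * E * D.map Y * E * C) -
      sgn k • (B * E * C.map Y) := by
    have h1 : S.map Y = A.map Y - (B * E * C).map Y := by
      rw [hS]; ext i j; simp
    rw [h1, hY.map_matrix_mul (pB.mul pE), hY.map_matrix_mul pB, dE]
    simp only [Bool.and_true, Bool.xor_false, Matrix.add_mul, Matrix.smul_mul, Matrix.mul_neg,
      Matrix.neg_mul, smul_neg, Matrix.mul_assoc]
    abel
  have hsum : ∑ b, ∑ e, sgn (xor (b.isRight && !k) (k && e.isRight)) • (K b e * Y (J e b)) =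
      (K1 * A.map Y).trace + sgn k • (K2 * C.map Y).trace + sgn (!k) • (K3 * B.map Y).trace -
        (K4 * D.map Y).trace := by
    simp only [Fintype.sum_sum_type, eJ, eK, Matrix.trace, Matrix.diag, Matrix.mul_apply,
      Matrix.map_apply, Matrix.fromBlocks_apply₁₁, Matrix.fromBlocks_apply₁₂,
      Matrix.fromBlocks_apply₂₁, Matrix.fromBlocks_apply₂₂, Sum.isRight_inl, Sum.isRight_inr,
      Finset.sum_add_distrib, Finset.smul_sum]
    cases k <;> simp <;> abel
  have t1 : (K1 * (B.map Y * E * C)).trace = -sgn (!k) • (K3 * B.map Y).trace := by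
    have h1 := MatParity.trace_mul hα (pK1.mul (pB.map hY)) (pE.mul pC)
    rw [e3]
    simp only [Matrix.neg_mul, Matrix.trace_neg, Matrix.mul_assoc] at h1 ⊢
    rw [h1]
    cases k <;> simp
  have t2 : sgn k • (K1 * (B * E * D.map Y * E * C)).trace =
      (E * D.map Y).trace - (K4 * D.map Y).trace := by
    have h1 := MatParity.trace_mul hα ((pK1.mul (pB.mul pE)).mul (pD.map hY)) (pE.mul pC)
    rw [e4]
    simp only [Matrix.add_mul, Matrix.trace_add, Matrix.mul_assoc] at h1 ⊢
    rw [h1]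
    cases k <;> simp
  have t3 : (K1 * (B * E * C.map Y)).trace = -(K2 * C.map Y).trace := by
    rw [e2, Matrix.neg_mul, Matrix.trace_neg, neg_neg]
    simp only [Matrix.mul_assoc]
  -- The left side is the logarithmic derivative of `det S / det D` by Jacobi's formula. Cyclicity
  -- of the trace, with signs for odd blocks, turns it into the supertrace-type sum.
  have htr : (K1 * S.map Y).trace - (E * D.map Y).trace =
      ∑ b, ∑ e, sgn (xor (b.isRight && !k) (k && e.isRight)) • (K b e * Y (J e b)) := by
    rw [hsum, dS]
    simp only [Matrix.mul_add, Matrix.mul_sub, Matrix.mul_smul, Matrix.trace_add,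
      Matrix.trace_sub, Matrix.trace_smul, t1, t2, t3]
    module
  have hi : Ring.inverse (leibnizDet D) = (↑v⁻¹ : R) := Ring.inverse_eq_of_mul_eq_one hv1 hv2
  rw [← htr, hber, hi, hY.leibniz, twist_of_even (leibnizDet_parity hα pS),
    hY.map_leibnizDet hα pS hSK, hY.map_inv hα hvol, hY.map_leibnizDet hα pD hDE, mul_sub]
  rw [mul_assoc _ _ (↑v⁻¹ : R), ← pv.comm hα, ← mul_assoc, sub_eq_add_neg, mul_neg]
  congr 2
  rw [mul_assoc (↑v⁻¹ : R) (↑v⁻¹ : R), ← mul_assoc (↑v⁻¹ : R) (leibnizDet D), hv2, one_mul, mul_assoc]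

namespace Coords

variable (c c' : Coords α p q)

/-- The Jacobian matrix of a change of coordinates. -/
def jac : Matrix (Fin p ⊕ Fin q) (Fin p ⊕ Fin q) R := Matrix.of fun a b => c.d a (c'.x b)

variable (hα : IsSuperParity α)
include hα

/-- The chain rule: `∂_a` expanded in the other coordinates and applied to `x^b`. -/
lemma jac_mul : c.jac c' * c'.jac c = 1 := by
  ext a b
  simp only [Matrix.mul_apply, jac, Matrix.of_apply]
  rw [← c'.apply_eq_sum hα (c.sder a), c.d_x, Matrix.one_apply]

omit hα in
lemma jac_parity (a b) : HasParity α (xor a.isRight b.isRight) (c.jac c' a b) :=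
  (c.sder a).apply (c'.parity_x b)

/-- The divergence in other coordinates. -/
lemma berezinian_mul_div {Y : R →ₗ[ℝ] R} (hY : IsSDer α k Y)
    (hB : HasParity α false (berezinian (c.jac c'))) :
    berezinian (c.jac c') * c'.div Y =
      berezinian (c.jac c') * c.div Y + Y (berezinian (c.jac c')) := by
  -- For a coordinate field the old divergence is zero. Its new divergence involves `∂'_b (∂_a
  -- x'^b)`; expanding `∂'_b` in the old partials and exchanging these with `∂_a` gives the sum in
  -- the derivative of the Berezinian.
  have h1 : ∀ a, berezinian (c.jac c') * c'.div (c.d a) = c.d a (berezinian (c.jac c')) := by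
    intro a
    rw [(c.sder a).map_berezinian hα (c.jac_parity c') (c'.jac_parity c) (c.jac_mul c' hα)
      (c'.jac_mul c hα), div]
    congr 1
    refine Finset.sum_congr rfl fun b _ => ?_
    rw [((c.sder a).apply (c'.parity_x b)).twist, map_smul, c.apply_eq_sum hα (c'.sder b),
      Finset.smul_sum]
    refine Finset.sum_congr rfl fun e _ => ?_
    rw [c.d_comm hα e a, mul_smul_comm, smul_smul]
    simp only [jac, Matrix.of_apply]
    cases a.isRight <;> cases b.isRight <;> cases e.isRight <;> simp
  -- The general field is a combination of coordinate fields, and the derivatives of its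
  -- coefficients make up the old divergence.
  have h2 : c'.div Y = ∑ a, Y (c.x a) * c'.div (c.d a) + c.div Y := by
    conv_lhs => rw [c.eq_sum hα hY]
    rw [div_sum, div, ← Finset.sum_add_distrib]
    refine Finset.sum_congr rfl fun a _ => ?_
    have h3 := hY.apply (c.parity_x a)
    rw [c'.div_mul hα h3 (c.sder a), h3.twist, map_smul]
  rw [h2, mul_add, add_comm, c.apply_eq_sum hα hY (berezinian _), Finset.mul_sum]
  congr 1
  refine Finset.sum_congr rfl fun a _ => ?_
  rw [← h1, ← mul_assoc, ← mul_assoc, hB.comm hα]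

/-- The divergence with respect to a volume form does not depend on the coordinates. -/
lemma lie_change {Y : R →ₗ[ℝ] R} (hY : IsSDer α k Y) (hr : IsVol α r s) (hr' : IsVol α r' s')
    (h : r = berezinian (c.jac c') * r') : s * c.lie r Y = s' * c'.lie r' Y := by
  have hrs' : r' * s' = 1 := by rw [hr'.even.comm hα, hr'.inv]
  have hrs : r * s = 1 := by rw [hr.even.comm hα, hr.inv]
  have e1 : berezinian (c.jac c') = r * s' := by rw [h, mul_assoc, hrs', mul_one]
  have hB : HasParity α false (berezinian (c.jac c')) := by
    rw [e1]; exact hr.even.mul hr'.even'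
  have h1 := c.berezinian_mul_div c' hα hY hB
  -- The logarithmic derivative of the density picks up that of the Berezinian, which compensates
  -- the change of the coordinate divergence.
  have h2 : Y r = Y (berezinian (c.jac c')) * r' + berezinian (c.jac c') * Y r' := by
    conv_lhs => rw [h]
    rw [hY.leibniz, twist_of_even hB]
  have h3 : r' * s * berezinian (c.jac c') = 1 := by
    rw [mul_assoc, ← hB.comm hα, ← mul_assoc, ← hB.comm hα, ← h, hrs]
  have h4 : s * berezinian (c.jac c') = s' := by
    rw [e1, ← mul_assoc, hr.inv, one_mul]
  rw [hr.mul_apply c hα hY, hr'.mul_apply c' hα hY, h2, mul_add, ← mul_assoc s _ (Y r'), h4,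
    ← add_assoc, add_left_inj]
  have h5 := congrArg (r' * s * ·) h1
  simp only [mul_add, ← mul_assoc, h3, one_mul] at h5
  rw [h5, mul_assoc r' s, hr'.even.comm hα, mul_assoc]

end Coords

end Berezin

/-! ### Calculus in Grassmann algebras -/

section GrassmannAlgebra

variable {q : ℕ}

lemma gParity_ι (v : Fin q → ℝ) : gParity q (ExteriorAlgebra.ι ℝ v) = -ExteriorAlgebra.ι ℝ v :=
  CliffordAlgebra.involute_ι v

lemma gDeriv_ι_mul (j : Fin q) (v : Fin q → ℝ) (a : Grassmann q) :
    gDeriv j (ExteriorAlgebra.ι ℝ v * a) = v j • a - ExteriorAlgebra.ι ℝ v * gDeriv j a :=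
  CliffordAlgebra.contractLeft_ι_mul (Q := (0 : QuadraticForm ℝ (Fin q → ℝ))) (d := LinearMap.proj j) v a

lemma gDeriv_algebraMap (j : Fin q) (r : ℝ) : gDeriv j (algebraMap ℝ (Grassmann q) r) = 0 :=
  CliffordAlgebra.contractLeft_algebraMap (Q := (0 : QuadraticForm ℝ (Fin q → ℝ))) (LinearMap.proj j) r

lemma gDeriv_ι (j : Fin q) (v : Fin q → ℝ) :
    gDeriv j (ExteriorAlgebra.ι ℝ v) = algebraMap ℝ (Grassmann q) (v j) :=
  CliffordAlgebra.contractLeft_ι (Q := (0 : QuadraticForm ℝ (Fin q → ℝ))) (LinearMap.proj j) v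

/-- Induction on the number of factors of a product of generators. -/
lemma grassmann_induction {P : Grassmann q → Prop}
    (algebraMap : ∀ r : ℝ, P (algebraMap ℝ (Grassmann q) r))
    (add : ∀ a b, P a → P b → P (a + b))
    (ι_mul : ∀ a v, P a → P (ExteriorAlgebra.ι ℝ v * a)) (a : Grassmann q) : P a :=
  CliffordAlgebra.left_induction (Q := (0 : QuadraticForm ℝ (Fin q → ℝ))) algebraMap add ι_mul a

lemma gDeriv_mul (j : Fin q) (a b : Grassmann q) :
    gDeriv j (a * b) = gDeriv j a * b + gParity q a * gDeriv j b := by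
  induction a using grassmann_induction with
  | algebraMap r =>
    rw [gDeriv_algebraMap, ← Algebra.smul_def, map_smul, AlgHom.commutes, zero_mul, zero_add,
      Algebra.smul_def]
  | add a a' h h' => simp only [add_mul, map_add, h, h']; abel
  | ι_mul a v h =>
    rw [mul_assoc, gDeriv_ι_mul, h, gDeriv_ι_mul, map_mul, gParity_ι]
    simp only [sub_mul, mul_add, smul_mul_assoc, mul_assoc, neg_mul]
    abel

lemma gParity_gDeriv (j : Fin q) (a : Grassmann q) :
    gParity q (gDeriv j a) = -gDeriv j (gParity q a) := by
  induction a using grassmann_induction with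
  | algebraMap r => simp [gDeriv_algebraMap]
  | add a a' h h' => simp only [map_add, h, h']; abel
  | ι_mul a v h =>
    rw [gDeriv_ι_mul, map_sub, map_smul, map_mul, map_mul, h, gParity_ι, neg_mul, neg_mul, map_neg,
      gDeriv_ι_mul]
    simp

/-- The constant term. -/
abbrev gBody (q : ℕ) : Grassmann q →ₐ[ℝ] ℝ := ExteriorAlgebra.algebraMapInv

@[simp] lemma gBody_ι (v : Fin q → ℝ) : gBody q (ExteriorAlgebra.ι ℝ v) = 0 := by
  simp [gBody, ExteriorAlgebra.algebraMapInv]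

/-- Each generator passed costs a sign, and the parity involution counts these signs. -/
lemma mul_ι_eq (a : Grassmann q) (v : Fin q → ℝ) :
    a * ExteriorAlgebra.ι ℝ v = ExteriorAlgebra.ι ℝ v * gParity q a := by
  induction a using grassmann_induction with
  | algebraMap r => rw [AlgHom.commutes, Algebra.commutes]
  | add a a' h h' => simp only [map_add, add_mul, mul_add, h, h']
  | ι_mul a w h =>
    rw [mul_assoc, h, map_mul, gParity_ι, ← mul_assoc, ← mul_assoc, mul_neg]
    congr 1
    exact eq_neg_of_add_eq_zero_left (ExteriorAlgebra.ι_add_mul_swap w v)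

/-- Elements without constant term are nilpotent. -/
lemma grassmann_pow_eq_zero {a : Grassmann q} (ha : gBody q a = 0) : a ^ (q + 1) = 0 := by
  let V : Submodule ℝ (Grassmann q) := LinearMap.range (ExteriorAlgebra.ι ℝ)
  have h1 : ∀ b : Grassmann q, b - algebraMap ℝ _ (gBody q b) ∈ V * ⊤ := by
    intro b
    induction b using grassmann_induction with
    | algebraMap r => simp
    | add a a' h h' =>
      have := add_mem h h'
      rw [map_add, map_add]
      convert this using 1
      abel
    | ι_mul a v h =>
      rw [map_mul, gBody_ι, zero_mul, map_zero, sub_zero]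
      exact Submodule.mul_mem_mul ⟨v, rfl⟩ trivial
  -- Generators can be collected on the left, so the `n`-th power of the ideal `V * ⊤` lies in `V ^
  -- n * ⊤`; for `n = q + 1` this is zero, as any `q + 1` vectors are dependent.
  have h2 : (⊤ : Submodule ℝ (Grassmann q)) * V ≤ V * ⊤ := by
    rw [Submodule.mul_le]
    rintro b - _ ⟨v, rfl⟩
    rw [mul_ι_eq]
    exact Submodule.mul_mem_mul ⟨v, rfl⟩ trivial
  have h3 : ∀ n : ℕ, (V * ⊤) ^ n ≤ V ^ n * ⊤ := by
    intro n
    induction n with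
    | zero => rw [pow_zero, pow_zero, one_mul]; exact le_top
    | succ n ih =>
      calc (V * ⊤) ^ (n + 1) = (V * ⊤) ^ n * (V * ⊤) := pow_succ _ _
        _ ≤ V ^ n * ⊤ * (V * ⊤) := mul_le_mul' ih le_rfl
        _ = V ^ n * (⊤ * V) * ⊤ := by simp only [mul_assoc]
        _ ≤ V ^ n * (V * ⊤) * ⊤ :=
          mul_le_mul' (mul_le_mul' le_rfl h2) le_rfl
        _ = V ^ (n + 1) * (⊤ * ⊤) := by rw [pow_succ]; simp only [mul_assoc]
        _ ≤ V ^ (n + 1) * ⊤ := mul_le_mul' le_rfl le_top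
  have h4 : V ^ (q + 1) = ⊥ := by
    change ⋀[ℝ]^(q + 1) (Fin q → ℝ) = ⊥
    rw [← ExteriorAlgebra.ιMulti_span_fixedDegree, Submodule.span_eq_bot]
    rintro _ ⟨v, rfl⟩
    refine AlternatingMap.map_linearDependent _ v fun h => ?_
    have := h.fintype_card_le_finrank
    simp at this
  have h5 : a ∈ V * ⊤ := by simpa [ha] using h1 a
  have h6 := h3 (q + 1) (Submodule.pow_mem_pow _ h5 (q + 1))
  rw [h4, Submodule.bot_mul] at h6
  exact (Submodule.mem_bot ℝ).1 h6

/-- An element all of whose derivatives vanish is constant. -/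
lemma eq_algebraMap_of_gDeriv {a : Grassmann q} (ha : ∀ j, gDeriv j a = 0) :
    a = algebraMap ℝ _ (gBody q a) := by
  -- The Euler operator `∑ θ_j ∂_j`. It multiplies a monomial by its degree, so an element killed by
  -- all `∂_j` has only a component of degree 0.
  let E : Grassmann q →ₗ[ℝ] Grassmann q :=
    ∑ j, (LinearMap.mulLeft ℝ (ExteriorAlgebra.ι ℝ (Pi.single j 1))).comp (gDeriv j)
  have hE : ∀ v b, E (ExteriorAlgebra.ι ℝ v * b) =
      ExteriorAlgebra.ι ℝ v * b + ExteriorAlgebra.ι ℝ v * E b := by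
    intro v b
    have h1 : ExteriorAlgebra.ι ℝ v = ∑ j, v j • ExteriorAlgebra.ι ℝ (Pi.single j 1) := by
      conv_lhs => rw [pi_eq_sum_univ' v]
      simp only [map_sum, map_smul]
    simp only [E, LinearMap.sum_apply, LinearMap.comp_apply, LinearMap.mulLeft_apply,
      gDeriv_ι_mul, mul_sub, Finset.sum_sub_distrib, Finset.mul_sum]
    rw [sub_eq_add_neg, ← Finset.sum_neg_distrib]
    congr 1
    · conv_rhs => rw [h1]
      rw [Finset.sum_mul]
      simp
    · refine Finset.sum_congr rfl fun j _ => ?_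
      rw [← mul_assoc, ← mul_assoc, ← neg_mul]
      congr 1
      exact (eq_neg_of_add_eq_zero_left (ExteriorAlgebra.ι_add_mul_swap v _)).symm
  have hE' : ∀ n (v : Fin n → Fin q → ℝ),
      E (ExteriorAlgebra.ιMulti ℝ n v) = (n : ℝ) • ExteriorAlgebra.ιMulti ℝ n v := by
    intro n
    induction n with
    | zero =>
      intro v
      have : ∀ j : Fin q, gDeriv j (1 : Grassmann q) = 0 := fun j => by
        simpa using gDeriv_algebraMap j 1
      simp [E, this]
    | succ n ih =>
      intro v
      rw [ExteriorAlgebra.ιMulti_succ_apply, hE, ih, mul_smul_comm]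
      push_cast
      module
  have hEb : ∀ I, E (grassmannBasis q I) = (I.card : ℝ) • grassmannBasis q I := by
    intro I
    rw [grassmannBasis, ExteriorAlgebra.basis_apply]
    exact hE' _ _
  have h0 : E a = 0 := by simp [E, ha]
  have h1 : ∀ I, (I.card : ℝ) * (grassmannBasis q).repr a I = 0 := by
    intro I
    have h2 : E a = ∑ I, ((grassmannBasis q).repr a I * I.card) • grassmannBasis q I := by
      conv_lhs => rw [← (grassmannBasis q).sum_repr a]
      rw [map_sum]
      exact Finset.sum_congr rfl fun I _ => by rw [map_smul, hEb, smul_smul]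
    rw [h0] at h2
    have h3 := congrArg (fun b => (grassmannBasis q).repr b I) h2
    simp only [map_zero, Module.Basis.repr_sum_self] at h3
    rw [mul_comm]; exact h3.symm
  have h2 : a = algebraMap ℝ _ ((grassmannBasis q).repr a ∅) := by
    conv_lhs => rw [← (grassmannBasis q).sum_repr a]
    rw [Finset.sum_eq_single ∅]
    · rw [Algebra.algebraMap_eq_smul_one]
      congr 1
      rw [grassmannBasis, ExteriorAlgebra.basis_apply]
      exact ExteriorAlgebra.ιMulti_zero_apply _
    · intro I _ hI
      have := h1 I
      rw [mul_eq_zero, Nat.cast_eq_zero, Finset.card_eq_zero] at this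
      rw [this.resolve_left hI, zero_smul]
    · simp
  conv_rhs => rw [h2]
  rw [ExteriorAlgebra.algebraMap_leftInverse]
  exact h2

end GrassmannAlgebra

/-! ### Hadamard's lemma -/

section Hadamard

/-- Smoothness of a parametric integral over `[0, 1]`. -/
lemma contDiff_integral_unitInterval {E : Type*} [NormedAddCommGroup E] [NormedSpace ℝ E]
    {Φ : E × ℝ → ℝ} (hΦ : ContDiff ℝ ∞ Φ) :
    ContDiff ℝ ∞ (fun y => ∫ t in (0 : ℝ)..1, Φ (y, t)) := by
  -- The integral is the value at `0` of the convolution of the indicator of `(0, 1]` with `t ↦ χ t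
  -- * Φ (y, -t)`. The cutoff supplies compact support and equals `1` on `[-1, 1]`, so it does not
  -- affect the value; smoothness in `y` is then that of convolutions with parameters.
  let χ : ContDiffBump (0 : ℝ) := ⟨1, 2, one_pos, one_lt_two⟩
  have h := MeasureTheory.contDiffOn_convolution_right_with_param_comp (n := ⊤) (μ := MeasureTheory.volume)
    (ContinuousLinearMap.mul ℝ ℝ) (s := (Set.univ : Set E)) (v := fun _ => (0 : ℝ))
    (f := Set.indicator (Set.Ioc (0 : ℝ) 1) 1) (g := fun y t => χ t * Φ (y, -t))
    (k := Metric.closedBall (0 : ℝ) 2) contDiffOn_const isOpen_univ (isCompact_closedBall _ _)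
    (fun y t _ ht => by
      have : χ t = 0 := χ.zero_of_le_dist (by
        rw [Metric.mem_closedBall, not_le] at ht; exact ht.le)
      simp [this])
    ((MeasureTheory.integrable_indicator_iff measurableSet_Ioc).2 (by
      exact MeasureTheory.integrableOn_const (by simp))).locallyIntegrable
    (by
      have h1 : ContDiff ℝ ∞ (fun z : E × ℝ => χ z.2 * Φ (z.1, -z.2)) :=
        (χ.contDiff.comp contDiff_snd).mul (hΦ.comp (contDiff_fst.prodMk contDiff_snd.neg))
      exact h1.contDiffOn)
  rw [contDiffOn_univ] at h
  convert h using 1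
  funext y
  rw [intervalIntegral.integral_of_le zero_le_one, MeasureTheory.convolution_def,
    ← MeasureTheory.integral_indicator measurableSet_Ioc]
  refine MeasureTheory.integral_congr_ae (Filter.Eventually.of_forall fun t => ?_)
  by_cases ht : t ∈ Set.Ioc (0 : ℝ) 1
  · have : χ (0 - t) = 1 := χ.one_of_mem_closedBall (by
      rw [Metric.mem_closedBall, dist_zero_right, zero_sub, norm_neg, Real.norm_eq_abs,
        abs_of_pos ht.1]
      exact ht.2)
    simp only [Set.indicator_of_mem ht, ContinuousLinearMap.mul_apply', this]
    simp
  · simp [Set.indicator_of_notMem ht]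

/-- Hadamard's lemma. -/
lemma exists_hadamard {p : ℕ} {F : EuclideanSpace ℝ (Fin p) → ℝ} (hF : ContDiff ℝ ∞ F)
    (w : EuclideanSpace ℝ (Fin p)) :
    ∃ h : Fin p → EuclideanSpace ℝ (Fin p) → ℝ, (∀ i, ContDiff ℝ ∞ (h i)) ∧
      ∀ y, F y = F w + ∑ i, (y i - w i) * h i y := by
  have hF' : ContDiff ℝ ∞ (fderiv ℝ F) := hF.fderiv_right (by simp)
  have hline : ContDiff ℝ ∞ (fun z : EuclideanSpace ℝ (Fin p) × ℝ => w + z.2 • (z.1 - w)) :=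
    contDiff_const.add (contDiff_snd.smul (contDiff_fst.sub contDiff_const))
  have hΦ : ∀ i, ContDiff ℝ ∞ (fun z : EuclideanSpace ℝ (Fin p) × ℝ =>
      fderiv ℝ F (w + z.2 • (z.1 - w)) (EuclideanSpace.single i 1)) := fun i =>
    (hF'.comp hline).clm_apply contDiff_const
  refine ⟨fun i y => ∫ t in (0 : ℝ)..1, fderiv ℝ F (w + t • (y - w)) (EuclideanSpace.single i 1),
    fun i => contDiff_integral_unitInterval (hΦ i), fun y => ?_⟩
  have hc : ∀ i, Continuous fun t : ℝ =>
      fderiv ℝ F (w + t • (y - w)) (EuclideanSpace.single i 1) := fun i =>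
    (hΦ i).continuous.comp (Continuous.prodMk_right y)
  have hsum : ∀ t : ℝ, fderiv ℝ F (w + t • (y - w)) (y - w) =
      ∑ i, (y i - w i) * fderiv ℝ F (w + t • (y - w)) (EuclideanSpace.single i 1) := by
    intro t
    have : y - w = ∑ i, (y i - w i) • EuclideanSpace.single i (1 : ℝ) := by
      ext j
      simp [Finset.sum_apply, Pi.single_apply]
    conv_lhs => rw [this]
    simp only [map_sum, map_smul, smul_eq_mul]
    rw [← this]
  -- The fundamental theorem of calculus along the segment from `w` to `y`.
  have hd : ∀ t ∈ Set.uIcc (0 : ℝ) 1, HasDerivAt (fun t : ℝ => F (w + t • (y - w)))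
      (fderiv ℝ F (w + t • (y - w)) (y - w)) t := by
    intro t _
    have h1 : HasDerivAt (fun t : ℝ => w + t • (y - w)) (y - w) t := by
      simpa using ((hasDerivAt_id t).smul_const (y - w)).const_add w
    exact ((hF.differentiable (by simp)) _).hasFDerivAt.comp_hasDerivAt t h1
  have h2 := intervalIntegral.integral_eq_sub_of_hasDerivAt hd (by
    simp only [hsum]
    exact (continuous_finsetSum _ fun i _ => continuous_const.mul (hc i)).intervalIntegrable _ _)
  simp only [hsum, one_smul, zero_smul, add_zero, add_sub_cancel] at h2
  rw [intervalIntegral.integral_finsetSum (f := fun i t => (y i - w i) *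
    fderiv ℝ F (w + t • (y - w)) (EuclideanSpace.single i 1)) fun i _ =>
      (continuous_const.mul (hc i)).intervalIntegrable (μ := MeasureTheory.volume) 0 1] at h2
  simp only [intervalIntegral.integral_const_mul] at h2
  rw [h2]; ring

end Hadamard

/-! ### Coordinates on superdomains -/

section ModelCoordinates

variable {S : Type u} [TopologicalSpace S] {p q : ℕ}
  {e : OpenPartialHomeomorph S (EuclideanSpace ℝ (Fin p))} {W : Opens S}

lemma modelFn_ext {f g : modelFn e q W} (h : ∀ w, f.1 w = g.1 w) : f = g :=
  Subtype.ext (funext h)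

@[simp] lemma modelFn_mul_apply (f g : modelFn e q W) (w : W) : (f * g).1 w = f.1 w * g.1 w := rfl

@[simp] lemma modelFn_add_apply (f g : modelFn e q W) (w : W) : (f + g).1 w = f.1 w + g.1 w := rfl

@[simp] lemma modelFn_sub_apply (f g : modelFn e q W) (w : W) : (f - g).1 w = f.1 w - g.1 w := rfl

@[simp] lemma modelFn_smul_apply (r : ℝ) (f : modelFn e q W) (w : W) :
    (r • f).1 w = r • f.1 w := rfl

@[simp] lemma modelFn_one_apply (w : W) : (1 : modelFn e q W).1 w = 1 := rfl

@[simp] lemma modelFn_zero_apply (w : W) : (0 : modelFn e q W).1 w = 0 := rfl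

@[simp] lemma modelPost_apply (L : Grassmann q →ₗ[ℝ] Grassmann q) (g : modelFn e q W) (w : W) :
    (modelPost L g).1 w = L (g.1 w) := rfl

@[simp] lemma modelFn_algebraMap_apply (r : ℝ) (w : W) :
    (algebraMap ℝ (modelFn e q W) r).1 w = algebraMap ℝ (Grassmann q) r := rfl

lemma modelEvenCoord_apply (i : Fin p) (w : W) :
    (modelEvenCoord e q W i).1 w = algebraMap ℝ (Grassmann q) (e w i) := rfl

/-- Evaluation at a point. -/
def modelEval (w : W) : modelFn e q W →ₐ[ℝ] Grassmann q :=
  (Pi.evalAlgHom ℝ (fun _ : W => Grassmann q) w).comp (modelFn e q W).val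

lemma modelEval_apply (w : W) (f : modelFn e q W) : modelEval w f = f.1 w := rfl

lemma modelFn_sum_apply {ι : Type*} (s : Finset ι) (f : ι → modelFn e q W) (w : W) :
    (∑ i ∈ s, f i).1 w = ∑ i ∈ s, (f i).1 w := map_sum (modelEval w) f s

/-- The parity involution of the functions on a superdomain. -/
def modelParity (e : OpenPartialHomeomorph S (EuclideanSpace ℝ (Fin p))) (q : ℕ) (W : Opens S) :
    modelFn e q W →ₐ[ℝ] modelFn e q W where
  toFun := modelPost (gParity q).toLinearMap
  map_one' := modelFn_ext fun _ => map_one (gParity q)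
  map_mul' _ _ := modelFn_ext fun _ => map_mul (gParity q) _ _
  map_zero' := modelFn_ext fun _ => map_zero (gParity q)
  map_add' _ _ := modelFn_ext fun _ => map_add (gParity q) _ _
  commutes' r := modelFn_ext fun _ => AlgHom.commutes (gParity q) r

@[simp] lemma modelParity_apply (f : modelFn e q W) (w : W) :
    (modelParity e q W f).1 w = gParity q (f.1 w) := rfl

/-- Constant functions. -/
def modelConst (e : OpenPartialHomeomorph S (EuclideanSpace ℝ (Fin p))) (q : ℕ) (W : Opens S) :
    Grassmann q →ₐ[ℝ] modelFn e q W where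
  toFun a := ⟨fun _ => a, by
    refine (contDiffOn_const (c := a)).congr fun y hy => ?_
    rw [inChart_of_mem e _ hy]⟩
  map_one' := rfl
  map_mul' _ _ := rfl
  map_zero' := rfl
  map_add' _ _ := rfl
  commutes' _ := rfl

@[simp] lemma modelConst_apply (a : Grassmann q) (w : W) : (modelConst e q W a).1 w = a := rfl

/-- Real functions. -/
def modelScalar (e : OpenPartialHomeomorph S (EuclideanSpace ℝ (Fin p))) (q : ℕ) (W : Opens S)
    {φ : EuclideanSpace ℝ (Fin p) → ℝ} (hφ : ContDiffOn ℝ ∞ φ (chartImage e W)) :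
    modelFn e q W :=
  ⟨fun w => algebraMap ℝ (Grassmann q) (φ (e w)), by
    let L : ℝ →L[ℝ] Grassmann q :=
      LinearMap.toContinuousLinearMap (Algebra.linearMap ℝ (Grassmann q))
    refine (L.contDiff.comp_contDiffOn hφ).congr fun y hy => ?_
    rw [inChart_of_mem e _ hy]
    simp only [e.right_inv hy.1]
    rfl⟩

@[simp] lemma modelScalar_apply {φ : EuclideanSpace ℝ (Fin p) → ℝ}
    (hφ : ContDiffOn ℝ ∞ φ (chartImage e W)) (w : W) :
    (modelScalar e q W hφ).1 w = algebraMap ℝ (Grassmann q) (φ (e w)) := rfl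

lemma mem_chartImage (hW : (W : Set S) ⊆ e.source) (w : W) : e w ∈ chartImage e W := by
  have h := hW w.2
  refine ⟨e.map_source h, ?_⟩
  rw [Set.mem_preimage, e.left_inv h]
  exact w.2

lemma inChart_apply (hW : (W : Set S) ⊆ e.source) (g : W → Grassmann q) (w : W) :
    inChart e W g (e w) = g w := by
  rw [inChart_of_mem e _ (mem_chartImage hW w)]
  congr 1
  exact Subtype.ext (e.left_inv (hW w.2))

lemma inChart_comp (L : Grassmann q →ₗ[ℝ] Grassmann q) (g : W → Grassmann q)
    (y : EuclideanSpace ℝ (Fin p)) :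
    inChart e W (fun w => L (g w)) y = L (inChart e W g y) := by
  unfold inChart
  split_ifs
  · rfl
  · exact (map_zero L).symm

lemma inChart_mul (f g : W → Grassmann q) (y : EuclideanSpace ℝ (Fin p)) :
    inChart e W (f * g) y = inChart e W f y * inChart e W g y := by
  unfold inChart
  split_ifs
  · rfl
  · exact (mul_zero _).symm

lemma differentiableAt_inChart (hW : (W : Set S) ⊆ e.source) (g : modelFn e q W) (w : W) :
    DifferentiableAt ℝ (inChart e W g.1) (e w) :=
  (g.2.differentiableOn (by simp)).differentiableAt
    ((isOpen_chartImage e W).mem_nhds (mem_chartImage hW w))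

/-- Multiplication in the Grassmann algebra as a continuous bilinear map. -/
def gMul (q : ℕ) : Grassmann q →L[ℝ] Grassmann q →L[ℝ] Grassmann q :=
  LinearMap.toContinuousLinearMap
    (LinearMap.toContinuousLinearMap.toLinearMap ∘ₗ LinearMap.mul ℝ (Grassmann q))

lemma gMul_apply (a b : Grassmann q) : gMul q a b = a * b := rfl

lemma modelDeriv_apply (i : Fin p) (g : modelFn e q W) (w : W) :
    (modelDeriv i g).1 w = fderiv ℝ (inChart e W g.1) (e w) (EuclideanSpace.single i 1) := rfl

lemma modelDeriv_add (hW : (W : Set S) ⊆ e.source) (i : Fin p) (f g : modelFn e q W) :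
    modelDeriv i (f + g) = modelDeriv i f + modelDeriv i g := by
  refine modelFn_ext fun w => ?_
  have : inChart e W (f + g).1 = inChart e W f.1 + inChart e W g.1 := by
    funext y
    simp only [Pi.add_apply]
    unfold inChart
    split_ifs
    · rfl
    · exact (zero_add _).symm
  rw [modelFn_add_apply, modelDeriv_apply, this, fderiv_add (differentiableAt_inChart hW f w)
    (differentiableAt_inChart hW g w)]
  rfl

lemma modelDeriv_post (hW : (W : Set S) ⊆ e.source) (i : Fin p)
    (L : Grassmann q →ₗ[ℝ] Grassmann q) (g : modelFn e q W) :
    modelDeriv i (modelPost L g) = modelPost L (modelDeriv i g) := by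
  refine modelFn_ext fun w => ?_
  have : inChart e W (modelPost L g).1 =
      LinearMap.toContinuousLinearMap L ∘ inChart e W g.1 := funext (inChart_comp L g.1)
  rw [modelPost_apply, modelDeriv_apply, modelDeriv_apply, this,
    fderiv_comp _ (ContinuousLinearMap.differentiableAt _) (differentiableAt_inChart hW g w),
    ContinuousLinearMap.fderiv]
  rfl

lemma modelDeriv_mul (hW : (W : Set S) ⊆ e.source) (i : Fin p) (f g : modelFn e q W) :
    modelDeriv i (f * g) = modelDeriv i f * g + f * modelDeriv i g := by
  refine modelFn_ext fun w => ?_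
  have : inChart e W (f * g).1 =
      fun y => gMul q (inChart e W f.1 y) (inChart e W g.1 y) := funext (inChart_mul f.1 g.1)
  rw [modelDeriv_apply, this, ContinuousLinearMap.fderiv_of_bilinear _
    (differentiableAt_inChart hW f w) (differentiableAt_inChart hW g w)]
  simp only [_root_.add_apply, ContinuousLinearMap.precompR_apply,
    ContinuousLinearMap.precompL_apply, ContinuousLinearMap.compL_apply,
    ContinuousLinearMap.comp_apply, gMul_apply, inChart_apply hW, modelFn_add_apply,
    modelFn_mul_apply, modelDeriv_apply]
  abel

lemma modelDeriv_scalar (hW : (W : Set S) ⊆ e.source) (i : Fin p)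
    {φ : EuclideanSpace ℝ (Fin p) → ℝ} (hφ : ContDiffOn ℝ ∞ φ (chartImage e W)) (w : W) :
    (modelDeriv i (modelScalar e q W hφ)).1 w =
      algebraMap ℝ _ (fderiv ℝ φ (e w) (EuclideanSpace.single i 1)) := by
  have hn := (isOpen_chartImage e W).mem_nhds (mem_chartImage hW w)
  let L : ℝ →L[ℝ] Grassmann q :=
    LinearMap.toContinuousLinearMap (Algebra.linearMap ℝ (Grassmann q))
  have h1 : inChart e W (modelScalar e q W hφ).1 =ᶠ[nhds (e w)] L ∘ φ := by
    filter_upwards [hn] with y hy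
    rw [inChart_of_mem e _ hy, modelScalar_apply, e.right_inv hy.1]
    rfl
  have h2 : DifferentiableAt ℝ φ (e w) := (hφ.differentiableOn (by simp)).differentiableAt hn
  rw [modelDeriv_apply, h1.fderiv_eq, fderiv_comp _ L.differentiableAt h2, L.fderiv]
  rfl

/-- The partial derivative along the `i`-th even coordinate, as a linear map. -/
def modelDerivₗ (hW : (W : Set S) ⊆ e.source) (i : Fin p) : modelFn e q W →ₗ[ℝ] modelFn e q W where
  toFun := modelDeriv i
  map_add' := modelDeriv_add hW i
  map_smul' r g := by
    have h := modelDeriv_post hW i (r • LinearMap.id) g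
    have h1 : ∀ f : modelFn e q W, modelPost (r • LinearMap.id) f = r • f := fun f => rfl
    rwa [h1, h1] at h

/-- The partial derivative along the `j`-th odd coordinate, as a linear map. -/
def modelGDerivₗ (j : Fin q) : modelFn e q W →ₗ[ℝ] modelFn e q W where
  toFun := modelPost (gDeriv j)
  map_add' _ _ := modelFn_ext fun _ => map_add (gDeriv j) _ _
  map_smul' _ _ := modelFn_ext fun _ => map_smul (gDeriv j) _ _

lemma isSDer_modelDeriv (hW : (W : Set S) ⊆ e.source) (i : Fin p) :
    IsSDer (modelParity e q W) false (modelDerivₗ hW i) :=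
  ⟨fun f => by
    have := modelDeriv_post hW i (gParity q).toLinearMap f
    rw [sgn_false, one_smul]; exact this.symm, modelDeriv_mul hW i⟩

lemma isSDer_modelGDeriv (j : Fin q) :
    IsSDer (modelParity e q W) true (modelGDerivₗ j) :=
  ⟨fun f => modelFn_ext fun w => by
    rw [sgn_true, neg_one_smul]; exact gParity_gDeriv j (f.1 w),
    fun f g => modelFn_ext fun w => gDeriv_mul j (f.1 w) (g.1 w)⟩

lemma twist_modelParity_apply_eq_zero {k : Bool} {f : modelFn e q W} {w : W} (h : f.1 w = 0) :
    (twist (modelParity e q W) k f).1 w = 0 := by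
  cases k
  · exact h
  · rw [twist_true, modelParity_apply, h, map_zero]

/-- Outside `s` the product vanishes near every point, because the support of the bump is a closed
ball inside `s`. Thus a function defined on the chart image becomes a global one, to which
Hadamard's lemma applies. -/
lemma contDiff_bump_mul {y : EuclideanSpace ℝ (Fin p)} (χ : ContDiffBump y)
    {φ : EuclideanSpace ℝ (Fin p) → ℝ} {s : Set (EuclideanSpace ℝ (Fin p))} (hs : IsOpen s)
    (hχ : Metric.closedBall y χ.rOut ⊆ s) (hφ : ContDiffOn ℝ ∞ φ s) :
    ContDiff ℝ ∞ (fun z => χ z * φ z) := by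
  rw [contDiff_iff_contDiffAt]
  intro z
  by_cases hz : z ∈ s
  · exact χ.contDiff.contDiffAt.mul (hφ.contDiffAt (hs.mem_nhds hz))
  · have h1 : z ∈ (Metric.closedBall y χ.rOut)ᶜ := fun h => hz (hχ h)
    refine (contDiffAt_const (c := (0 : ℝ))).congr_of_eventuallyEq ?_
    filter_upwards [Metric.isClosed_closedBall.isOpen_compl.mem_nhds h1] with x hx
    rw [χ.zero_of_le_dist (le_of_lt (by simpa using hx)), zero_mul]

/-- A superderivation that kills the even coordinates kills the real functions. -/
lemma IsSDer.apply_modelScalar (hW : (W : Set S) ⊆ e.source) {k : Bool}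
    {Z : modelFn e q W →ₗ[ℝ] modelFn e q W} (hZ : IsSDer (modelParity e q W) k Z)
    (hx : ∀ i, Z (modelEvenCoord e q W i) = 0)
    {φ : EuclideanSpace ℝ (Fin p) → ℝ} (hφ : ContDiffOn ℝ ∞ φ (chartImage e W)) :
    Z (modelScalar e q W hφ) = 0 := by
  refine modelFn_ext fun w => ?_
  have hZc : ∀ r : ℝ, Z (algebraMap ℝ _ r) = 0 := fun r => by
    rw [Algebra.algebraMap_eq_smul_one, map_smul, hZ.map_one, smul_zero]
  obtain ⟨ε, hε, hball⟩ := Metric.nhds_basis_closedBall.mem_iff.1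
    ((isOpen_chartImage e W).mem_nhds (mem_chartImage hW w))
  let χ : ContDiffBump (e w) := ⟨ε / 2, ε, half_pos hε, half_lt_self hε⟩
  have hφ' : ContDiffOn ℝ ∞ (fun y => φ y - φ (e w)) (chartImage e W) := hφ.sub contDiffOn_const
  have hF := contDiff_bump_mul χ (isOpen_chartImage e W) hball hφ'
  obtain ⟨h, hh, hF'⟩ := exists_hadamard hF (e w)
  have hχ : ContDiffOn ℝ ∞ χ (chartImage e W) := χ.contDiff.contDiffOn
  have hχw : χ (e w) = 1 := χ.one_of_mem_closedBall (Metric.mem_closedBall_self (half_pos hε).le)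
  -- Hadamard is applied to `χ (φ - φ(w))`, which vanishes at `w`; the last product is the part cut
  -- off.
  have e1 : modelScalar e q W hφ = algebraMap ℝ _ (φ (e w)) +
      (∑ i, (modelEvenCoord e q W i - algebraMap ℝ _ (e w i)) *
        modelScalar e q W (hh i).contDiffOn +
      (1 - modelScalar e q W hχ) * modelScalar e q W hφ') := by
    refine modelFn_ext fun v => ?_
    have h1 := hF' (e v)
    simp only [sub_self, mul_zero, zero_add] at h1
    have h2 : φ (e v) = φ (e w) + (∑ i, (e v i - e w i) * h i (e v) +
        (1 - χ (e v)) * (φ (e v) - φ (e w))) := by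
      rw [← h1]; ring
    rw [modelScalar_apply, h2, map_add, map_add, map_sum, modelFn_add_apply, modelFn_add_apply,
      modelFn_sum_apply]
    simp only [map_mul, map_sub, _root_.map_one, modelFn_mul_apply, modelFn_sub_apply,
      modelFn_algebraMap_apply, modelEvenCoord_apply, modelScalar_apply, modelFn_one_apply]
  -- At `w` the first factor of each product vanishes. In the Hadamard terms it is also killed by
  -- `Z`; in the cutoff term the second factor vanishes at `w` as well.
  have e2 : ∀ a b : modelFn e q W, a.1 w = 0 → Z a = 0 ∨ b.1 w = 0 → (Z (a * b)).1 w = 0 := by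
    intro a b ha hb
    rw [hZ.leibniz, modelFn_add_apply, modelFn_mul_apply, modelFn_mul_apply,
      twist_modelParity_apply_eq_zero ha, zero_mul, add_zero]
    rcases hb with hb | hb
    · rw [hb]; exact zero_mul _
    · rw [hb, mul_zero]
  rw [e1, map_add, hZc, zero_add, map_add, map_sum, modelFn_add_apply, modelFn_sum_apply]
  rw [Finset.sum_eq_zero, zero_add]
  · refine e2 _ _ ?_ (Or.inr ?_)
    · rw [modelFn_sub_apply, modelScalar_apply, hχw, _root_.map_one, modelFn_one_apply,
        sub_self]
    · rw [modelScalar_apply, sub_self, map_zero]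
  · intro i _
    refine e2 _ _ ?_ (Or.inl ?_)
    · rw [modelFn_sub_apply, modelFn_algebraMap_apply, modelEvenCoord_apply, sub_self]
    · rw [map_sub, hx, hZc, sub_zero]

/-- A superderivation that kills the coordinates is zero. -/
lemma IsSDer.eq_zero_of_coord (hW : (W : Set S) ⊆ e.source) {k : Bool}
    {Z : modelFn e q W →ₗ[ℝ] modelFn e q W} (hZ : IsSDer (modelParity e q W) k Z)
    (hx : ∀ i, Z (modelEvenCoord e q W i) = 0) (hθ : ∀ j, Z (modelOddCoord e W j) = 0) :
    Z = 0 := by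
  have hconst : ∀ a, Z (modelConst e q W a) = 0 := by
    intro a
    induction a using grassmann_induction with
    | algebraMap r =>
      rw [AlgHom.commutes, Algebra.algebraMap_eq_smul_one, map_smul, hZ.map_one, smul_zero]
    | add a b ha hb => rw [map_add, map_add, ha, hb, add_zero]
    | ι_mul a v ha =>
      have h1 : modelConst e q W (ExteriorAlgebra.ι ℝ v) = ∑ j, v j • modelOddCoord e W j := by
        refine modelFn_ext fun w => ?_
        rw [modelFn_sum_apply, modelConst_apply]
        conv_lhs => rw [pi_eq_sum_univ' v]
        simp only [map_sum, map_smul]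
        rfl
      rw [map_mul, hZ.leibniz, ha, mul_zero, add_zero, h1, map_sum]
      simp [hθ]
  ext1 g
  let L : Finset (Fin q) → Grassmann q →L[ℝ] ℝ := fun I =>
    LinearMap.toContinuousLinearMap ((grassmannBasis q).coord I)
  have hL : ∀ I, ContDiffOn ℝ ∞ (fun y => L I (inChart e W g.1 y)) (chartImage e W) := fun I =>
    (L I).contDiff.comp_contDiffOn g.2
  -- Expansion in the odd coordinates with real coefficient functions; both kinds of factors are
  -- killed by `Z`.
  have h1 : g = ∑ I, modelScalar e q W (hL I) * modelConst e q W (grassmannBasis q I) := by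
    refine modelFn_ext fun w => ?_
    rw [modelFn_sum_apply]
    conv_lhs => rw [← (grassmannBasis q).sum_repr (g.1 w)]
    refine Finset.sum_congr rfl fun I _ => ?_
    rw [modelFn_mul_apply, modelScalar_apply, modelConst_apply, inChart_apply hW,
      ← Algebra.smul_def]
    rfl
  rw [h1, map_sum, LinearMap.zero_apply]
  refine Finset.sum_eq_zero fun I _ => ?_
  rw [hZ.leibniz, hZ.apply_modelScalar hW hx, hconst, zero_mul, mul_zero, add_zero]

/-- The coordinates of a superdomain. -/
def modelCoords (hW : (W : Set S) ⊆ e.source) : Coords (modelParity e q W) p q where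
  x := Sum.elim (modelEvenCoord e q W) (modelOddCoord e W)
  d := Sum.elim (modelDerivₗ hW) modelGDerivₗ
  parity_x
    | .inl i => modelFn_ext fun w => by
        simp only [Sum.elim_inl, Sum.isRight_inl, sgn_false, one_smul]
        exact AlgHom.commutes (gParity q) _
    | .inr j => modelFn_ext fun w => by
        simp only [Sum.elim_inr, Sum.isRight_inr, sgn_true, neg_one_smul]
        exact gParity_ι _
  sder
    | .inl i => isSDer_modelDeriv hW i
    | .inr j => isSDer_modelGDeriv j
  d_x := by
    rintro (i | j) (i' | j')
    · refine modelFn_ext fun w => ?_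
      have hφ : ContDiffOn ℝ ∞ (fun y : EuclideanSpace ℝ (Fin p) => y i') (chartImage e W) :=
        (EuclideanSpace.proj (𝕜 := ℝ) i').contDiff.contDiffOn
      have h1 := modelDeriv_scalar (q := q) hW i hφ w
      have h2 : fderiv ℝ (fun y : EuclideanSpace ℝ (Fin p) => y i') (e w) =
        EuclideanSpace.proj i' := (EuclideanSpace.proj (𝕜 := ℝ) i').fderiv
      rw [h2] at h1
      refine h1.trans ?_
      by_cases h : i = i'
      · subst h; simp
      · have h' : ¬ i' = i := fun h2 => h h2.symm
        simp [h, h']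
    · refine modelFn_ext fun w => ?_
      have h1 : inChart e W (modelOddCoord e W j').1 =ᶠ[nhds (e w)]
          fun _ => ExteriorAlgebra.ι ℝ (Pi.single j' 1) := by
        filter_upwards [(isOpen_chartImage e W).mem_nhds (mem_chartImage hW w)] with y hy
        rw [inChart_of_mem e _ hy]
        rfl
      change fderiv ℝ (inChart e W (modelOddCoord e W j').1) (e w) _ = _
      rw [h1.fderiv_eq]
      simp
    · refine modelFn_ext fun w => ?_
      refine (gDeriv_algebraMap j _).trans ?_
      simp
    · refine modelFn_ext fun w => ?_
      refine (gDeriv_ι j _).trans ?_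
      by_cases h : j = j'
      · subst h; simp
      · simp [h]
  ext k Z hZ h := hZ.eq_zero_of_coord hW (fun i => h (.inl i)) (fun j => h (.inr j))

end ModelCoordinates

/-! ### The bracket as a polarisation -/

section Normalise

variable {R : Type*} [Ring R] [Algebra ℝ R] {α : R →ₐ[ℝ] R} {A : Module.End ℝ R}

/-- The operator `A` with its term of order `0` removed. -/
def normalise (A : Module.End ℝ R) : Module.End ℝ R := A - mulOp (A 1)

lemma normalise_apply (f : R) : normalise A f = A f - A 1 * f := rfl

/-- Removing the term of order 0 changes `[A, A]` only by commutators of `A` with a function, which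
have order at most 1. For odd operators `[D, D] = 2 D²`, so the condition passes to the square. -/
lemma normalise_isBV (hα : IsSuperParity α) (hA : OpHasParity α true A) (hA3 : A ∈ diffOps α 3)
    (hAA : superComm (opParity α) A A ∈ diffOps α 3) : IsBV α (normalise A) := by
  have hm := mulOp_mem_diffOps hα (A 1)
  have h12 := diffOps_le_succ α 1
  have h23 := diffOps_le_succ α 2
  have hp : OpHasParity α true (normalise A) := by
    intro f
    have h1 := hA 1
    simp only [normalise_apply, map_sub, map_mul, hA f, h1, map_one, sgn_true]
    simp
    abel
  refine ⟨hp, by simp [normalise_apply], sub_mem hA3 (h23 (h12 hm)), ?_⟩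
  have h1 : superComm (opParity α) (normalise A) (normalise A) ∈ diffOps α 3 := by
    have h2 : superComm (opParity α) A (mulOp (A 1)) ∈ diffOps α 2 := mem_diffOps_succ.1 hA3 _
    have h3 : superComm (opParity α) (mulOp (A 1)) A ∈ diffOps α 2 :=
      superComm_mem_diffOps hα.invol hα.comm 2 0 2 rfl hm hA3
    have h4 := superComm_mulOp_mulOp hα.invol hα.comm (A 1) (A 1)
    have h5 : superComm (opParity α) (normalise A) (normalise A) =
        superComm (opParity α) A A - superComm (opParity α) A (mulOp (A 1)) -
          superComm (opParity α) (mulOp (A 1)) A + superComm (opParity α) (mulOp (A 1))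
            (mulOp (A 1)) := by
      simp only [normalise, map_sub]
      simp only [LinearMap.sub_apply]
      abel
    rw [h5, h4, add_zero]
    exact sub_mem (sub_mem hAA (h23 h2)) (h23 h3)
  have h2 : superComm (opParity α) (normalise A) (normalise A) =
      (2 : ℝ) • (normalise A).comp (normalise A) := by
    rw [superComm_apply, evenPart, oddPart]
    simp only [LinearMap.smul_apply, LinearMap.add_apply, LinearMap.sub_apply, LinearMap.id_apply,
      opParity_eq_smul hα hp, sgn_true]
    ext f
    simp only [LinearMap.sub_apply, LinearMap.smul_apply, LinearMap.comp_apply,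
      Module.End.mul_apply, LinearMap.add_apply, map_smul]
    module
  have h3 := Submodule.smul_mem _ (2⁻¹ : ℝ) h1
  rwa [h2, smul_smul, inv_mul_cancel₀ two_ne_zero, one_smul] at h3

set_option linter.unusedSimpArgs false in
/-- The derived bracket of functions. -/
lemma derived_eq_polar (hα : IsSuperParity α) (hA : OpHasParity α true A) (f g : R) :
    superComm (opParity α) (mulOp (α f)) (superComm (opParity α) A (mulOp g)) 1 =
      -polar α true (normalise A) f g := by
  induction f using hα.induction with
  | add f f' h1 h2 => simp only [map_add, LinearMap.add_apply, h1, h2]; abel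
  | hom k f hf =>
  induction g using hα.induction with
  | add g g' h1 h2 => simp only [map_add, LinearMap.add_apply, h1, h2]; abel
  | hom l g hg =>
    have hp := opParity_eq_smul hα (superComm_mulOp_parity hα hA hg)
    have hf' : α f = sgn k • f := hf
    have hg' : α g = sgn l • g := hg
    have e2 := hg.mul_comm_of hα (hA.apply HasParity.one)
    have e3 := hg.mul_comm_of hα (hA.apply hf)
    have e4 := hg.mul_comm_of hα hf
    rw [superComm_apply, opParity_mulOp hα.invol, evenPart, oddPart]
    simp only [LinearMap.smul_apply, LinearMap.add_apply, LinearMap.sub_apply, LinearMap.id_apply,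
      hp, Module.End.mul_apply, mulOp_apply, superComm_mulOp_apply hα hA hg, polar_apply,
      normalise_apply, hf', hg', mul_one, twist_true, map_smul]
    simp only [mul_sub, sub_mul, mul_assoc, e2, e3, e4, map_smul, mul_smul_comm, smul_mul_assoc,
      smul_smul]
    cases k <;> cases l <;>
      simp only [sgn_true, sgn_false, Bool.true_xor, Bool.false_xor, Bool.not_true,
        Bool.not_false, Bool.and_true, Bool.and_false, Bool.true_and, Bool.false_and] <;>
      module

end Normalise

/-! ### Functions on a supermanifold -/

namespace SuperSpace

variable {X : SuperSpace.{u}} {U V W : Opens X.space}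

lemma isSuperParity (X : SuperSpace.{u}) (U : Opens X.space) : IsSuperParity (X.parity U) :=
  ⟨X.parity_parity U, X.supercommutative U⟩

lemma res_res (h : V ≤ U) (h' : W ≤ V) (f : X.Fn U) : res h' (res h f) = res (h'.trans h) f := by
  have h1 : X.sheaf.1.map (homOfLE (h'.trans h)).op =
      X.sheaf.1.map (homOfLE h).op ≫ X.sheaf.1.map (homOfLE h').op := by
    rw [← X.sheaf.1.map_comp]; rfl
  exact (congrArg (fun φ => φ.hom f) h1).symm

lemma res_self (f : X.Fn U) : res le_rfl f = f := by
  have h1 : X.sheaf.1.map (homOfLE (le_refl U)).op = 𝟙 _ := by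
    rw [← X.sheaf.1.map_id]; rfl
  exact congrArg (fun φ => φ.hom f) h1

lemma parity_res' (h : V ≤ U) (f : X.Fn U) : X.parity V (res h f) = res h (X.parity U f) :=
  (X.parity_res h f).symm

lemma hasParity_res {k : Bool} {f : X.Fn U} (hf : HasParity (X.parity U) k f) (h : V ≤ U) :
    HasParity (X.parity V) k (res h f) := by
  unfold HasParity at *
  rw [parity_res', hf, map_smul]

/-- Functions are determined locally. -/
lemma eq_of_locally {ι : Type u} (V : ι → Opens X.space) (hV : ∀ i, V i ≤ U)
    (hcov : U ≤ iSup V) {f g : X.Fn U} (h : ∀ i, res (hV i) f = res (hV i) g) : f = g :=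
  X.sheaf.eq_of_locally_eq' V U (fun i => homOfLE (hV i)) hcov f g h

/-- Functions can be glued. -/
lemma exists_glue {ι : Type u} (V : ι → Opens X.space) (hV : ∀ i, V i ≤ U)
    (hcov : U ≤ iSup V) (f : ∀ i, X.Fn (V i))
    (h : ∀ i j, res (inf_le_left : V i ⊓ V j ≤ V i) (f i) = res inf_le_right (f j)) :
    ∃ g : X.Fn U, ∀ i, res (hV i) g = f i := by
  obtain ⟨g, hg, -⟩ := X.sheaf.existsUnique_gluing' V U (fun i => homOfLE (hV i)) hcov f h
  exact ⟨g, hg⟩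

end SuperSpace

open SuperSpace

/-- Transport of coordinates along an isomorphism. -/
def Coords.ofEquiv {R S : Type*} [Ring R] [Algebra ℝ R] [Ring S] [Algebra ℝ S] {α : R →ₐ[ℝ] R}
    {β : S →ₐ[ℝ] S} {p q : ℕ} (φ : R ≃ₐ[ℝ] S) (hφ : ∀ f, φ (α f) = β (φ f))
    (c : Coords β p q) : Coords α p q where
  x a := φ.symm (c.x a)
  d a := φ.symm.toLinearMap ∘ₗ c.d a ∘ₗ φ.toLinearMap
  parity_x a := by
    have h : β (c.x a) = sgn a.isRight • c.x a := c.parity_x a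
    change α _ = _ • _
    apply φ.injective
    simp [hφ, h]
  sder a := by
    refine ⟨fun f => φ.injective ?_, fun f g => φ.injective ?_⟩
    · simpa [hφ] using (c.sder a).parity (φ f)
    · have h : ∀ k, φ (twist α k f) = twist β k (φ f) := fun k => by
        cases k
        · rfl
        · exact hφ f
      simpa [h] using (c.sder a).leibniz (φ f) (φ g)
  d_x a b := by
    apply φ.injective
    have := c.d_x a b
    simp only [LinearMap.comp_apply, AlgEquiv.toLinearMap_apply, AlgEquiv.apply_symm_apply, this]
    split_ifs <;> simp
  ext k Y hY h := by
    have h1 : IsSDer β k (φ.toLinearMap ∘ₗ Y ∘ₗ φ.symm.toLinearMap) := by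
      have hφ' : ∀ f, φ.symm (β f) = α (φ.symm f) := fun f => φ.injective (by simp [hφ])
      refine ⟨fun f => ?_, fun f g => ?_⟩
      · have := congrArg φ (hY.parity (φ.symm f))
        simpa [hφ, hφ'] using this
      · have h : ∀ k, φ (twist α k (φ.symm f)) = twist β k f := fun k => by
          cases k
          · exact φ.apply_symm_apply f
          · exact (hφ _).trans (by simp)
        simp [hY.leibniz, h]
    have h2 := c.ext k _ h1 fun a => by simp [h]
    ext f
    have h3 := LinearMap.congr_fun h2 (φ f)
    simpa using h3

/-! ### Charts as coordinates, compatibly with restriction -/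

namespace Chart

variable {X : SuperSpace.{u}} {p q : ℕ} (c c' : Chart X p q) {W V : Opens X.space}

/-- The coordinates of a chart on an open subset of its domain. -/
def coords (hW : W ≤ c.dom) : Coords (X.parity W) p q :=
  Coords.ofEquiv (c.iso W hW) (fun f => modelFn_ext fun w => c.iso_parity W hW f w)
    (modelCoords hW)

lemma coords_x (hW : W ≤ c.dom) (a) : (c.coords hW).x a = c.coord hW a := by
  cases a <;> rfl

lemma coords_d (hW : W ≤ c.dom) (a) (f : X.Fn W) : (c.coords hW).d a f = c.partialDeriv hW a f := by
  cases a <;> rfl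

lemma lieCoeff_eq (hW : W ≤ c.dom) (r : X.Fn W) (Y : X.Fn W →ₗ[ℝ] X.Fn W) :
    lieCoeff c hW r Y = (c.coords hW).lie r Y := by
  simp [lieCoeff, Coords.lie, coords_x, coords_d]

lemma jacobian_eq (hW : W ≤ c.dom) (hW' : W ≤ c'.dom) :
    jacobian c c' hW hW' = (c.coords hW).jac (c'.coords hW') := by
  ext a b
  simp [jacobian, Coords.jac, coords_x, coords_d]

/-- Equality of functions in a chart can be tested pointwise. -/
lemma ext_iso (hW : W ≤ c.dom) {f g : X.Fn W} (h : ∀ w, (c.iso W hW f).1 w = (c.iso W hW g).1 w) :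
    f = g := (c.iso W hW).injective (modelFn_ext h)

lemma iso_symm_res (hW : W ≤ c.dom) (h : V ≤ W) (g : modelFn c.base q W) (g' : modelFn c.base q V)
    (hg : ∀ w : V, g'.1 w = g.1 ⟨w.1, h w.2⟩) :
    res h ((c.iso W hW).symm g) = (c.iso V (h.trans hW)).symm g' := by
  refine c.ext_iso (h.trans hW) fun w => ?_
  rw [c.iso_res W V hW (h.trans hW) h, AlgEquiv.apply_symm_apply, AlgEquiv.apply_symm_apply, hg]

lemma res_coord (hW : W ≤ c.dom) (h : V ≤ W) (a) :
    res h (c.coord hW a) = c.coord (h.trans hW) a := by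
  cases a
  · exact c.iso_symm_res hW h _ _ fun w => rfl
  · exact c.iso_symm_res hW h _ _ fun w => rfl

lemma res_partialDeriv (hW : W ≤ c.dom) (h : V ≤ W) (a) (f : X.Fn W) :
    res h (c.partialDeriv hW a f) = c.partialDeriv (h.trans hW) a (res h f) := by
  have hV := h.trans hW
  cases a with
  | inl i =>
    refine c.iso_symm_res hW h _ _ fun w => ?_
    rw [modelDeriv_apply, modelDeriv_apply]
    have h1 : inChart c.base V (c.iso V hV (res h f)).1 =ᶠ[nhds (c.base w)]
        inChart c.base W (c.iso W hW f).1 := by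
      filter_upwards [(isOpen_chartImage c.base V).mem_nhds (mem_chartImage hV w)] with y hy
      have hy' : y ∈ chartImage c.base W := ⟨hy.1, h hy.2⟩
      rw [inChart_of_mem _ _ hy, inChart_of_mem _ _ hy', c.iso_res W V hW hV h]
    rw [h1.fderiv_eq]
  | inr j =>
    refine c.iso_symm_res hW h _ _ fun w => ?_
    rw [modelPost_apply, modelPost_apply, c.iso_res W V hW hV h]

lemma res_jac (hW : W ≤ c.dom) (hW' : W ≤ c'.dom) (h : V ≤ W) :
    ((c.coords hW).jac (c'.coords hW')).map (res h) =
      (c.coords (h.trans hW)).jac (c'.coords (h.trans hW')) := by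
  ext a b
  simp only [Coords.jac, Matrix.map_apply, Matrix.of_apply, coords_x, coords_d,
    res_partialDeriv, res_coord]

end Chart

section BerezinianMap

variable {R S : Type*} [Ring R] [Algebra ℝ R] [Ring S] [Algebra ℝ S]
  {α : R →ₐ[ℝ] R} {p q : ℕ}

lemma map_leibnizDet (φ : R →ₐ[ℝ] S) {n : ℕ} (A : Matrix (Fin n) (Fin n) R) :
    φ (leibnizDet A) = leibnizDet (A.map φ) := by
  simp only [leibnizDet, map_sum, map_zsmul, map_list_prod, List.map_ofFn]
  rfl

/-- `Ring.inverse` is preserved by a homomorphism only where a genuine inverse exists. The reverse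
Jacobian supplies inverses of the lower right block and of its determinant. -/
lemma map_berezinian_algHom (hα : IsSuperParity α) (φ : R →ₐ[ℝ] S) (c c' : Coords α p q) :
    φ (berezinian (c.jac c')) = berezinian ((c.jac c').map φ) := by
  have pJ := c.jac_parity c'
  have pK := c'.jac_parity c
  have h := c.jac_mul c' hα
  generalize c.jac c' = J at h pJ
  generalize c'.jac c = K at h pK
  rw [← Matrix.fromBlocks_toBlocks J, ← Matrix.fromBlocks_toBlocks K,
    Matrix.fromBlocks_multiply, ← Matrix.fromBlocks_one, Matrix.fromBlocks_inj] at h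
  have pD : MatParity α false J.toBlocks₂₂ := fun i j => pJ (.inr i) (.inr j)
  obtain ⟨E, pE, hDE, hED⟩ := exists_inverse_of_odd_mul hα pD
    (fun i j => pK (.inr i) (.inr j)) (fun i j => pJ (.inr i) (.inl j))
    (fun i j => pK (.inl i) (.inr j)) h.2.2.2
  obtain ⟨v, hv⟩ := leibnizDet_isUnit hα pD pE hDE
  have hv1 : leibnizDet J.toBlocks₂₂ * (↑v⁻¹ : R) = 1 := by rw [← hv]; simp
  have hv2 : (↑v⁻¹ : R) * leibnizDet J.toBlocks₂₂ = 1 := by rw [← hv]; simp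
  have e1 : Ring.inverse (J.map φ).toBlocks₂₂ = E.map φ := by
    have e2 : (J.map φ).toBlocks₂₂ = J.toBlocks₂₂.map φ := rfl
    rw [e2]
    refine Ring.inverse_eq_of_mul_eq_one ?_ ?_
    · rw [← Matrix.map_mul, hDE, Matrix.map_one _ (map_zero φ) (map_one φ)]
    · rw [← Matrix.map_mul, hED, Matrix.map_one _ (map_zero φ) (map_one φ)]
  have e3 : Ring.inverse (leibnizDet (J.map φ).toBlocks₂₂) = φ (↑v⁻¹ : R) := by
    have e2 : leibnizDet (J.map φ).toBlocks₂₂ = φ (leibnizDet J.toBlocks₂₂) :=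
      (map_leibnizDet φ _).symm
    rw [e2]
    refine Ring.inverse_eq_of_mul_eq_one ?_ ?_
    · rw [← map_mul, hv1, map_one]
    · rw [← map_mul, hv2, map_one]
  rw [berezinian, berezinian, Ring.inverse_eq_of_mul_eq_one hDE hED,
    Ring.inverse_eq_of_mul_eq_one hv1 hv2, e1, e3, map_mul, map_leibnizDet]
  congr 2
  ext i j
  simp [Matrix.mul_apply, Matrix.toBlocks₁₁, Matrix.toBlocks₁₂, Matrix.toBlocks₂₁]

end BerezinianMap

open SuperSpace

/-! ### The odd Laplace operator of a volume form -/

namespace SchoutenStructure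

variable {X : SuperSpace.{u}} (P : SchoutenStructure X) {U V W : Opens X.space}

/-- An odd operator with symbol `𝔖`. -/
def rep : DiffOp X 3 := P.odd.choose

lemma symb_rep : symb P.rep = P.symbol := P.odd.choose_spec.1

lemma rep_parity (U : Opens X.space) : OpHasParity (X.parity U) true (P.rep.1 U) := by
  intro f
  have h := LinearMap.congr_fun (P.odd.choose_spec.2 U) (X.parity U f)
  rw [opParity_apply, X.parity_parity] at h
  rw [sgn_true, neg_one_smul]
  exact h

/-- An odd operator with symbol `𝔖` that annihilates the constants. -/
def op (U : Opens X.space) : X.Fn U →ₗ[ℝ] X.Fn U := normalise (P.rep.1 U)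

/-- A priori this commutator has order at most 3; the vanishing of `(𝔖, 𝔖)` is the vanishing of its
leading symbol. -/
lemma opBracket_rep_mem : opBracket P.rep.1 P.rep.1 ∈ DiffOp X 3 := by
  have h := P.bracket_self
  rw [← P.symb_rep, symBracket_symb] at h
  exact (Submodule.Quotient.mk_eq_zero ((DiffOp X 3).submoduleOf (DiffOp X 4))).1 h

lemma op_isBV (U : Opens X.space) : IsBV (X.parity U) (P.op U) :=
  normalise_isBV (X.isSuperParity U) (P.rep_parity U) (P.rep.2.2 U) (P.opBracket_rep_mem.2 U)

lemma res_op (h : V ≤ U) (f : X.Fn U) : res h (P.op U f) = P.op V (res h f) := by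
  rw [op, op, normalise_apply, normalise_apply, map_sub, map_mul, P.rep.2.1 U V h,
    P.rep.2.1 U V h, map_one]

lemma res_polar (h : V ≤ U) (f g : X.Fn U) :
    res h (polar (X.parity U) true (P.op U) f g) =
      polar (X.parity V) true (P.op V) (res h f) (res h g) := by
  simp only [polar_apply, map_sub, map_mul, res_op, twist_true, parity_res']

lemma bracket_parity (f g : X.Fn U) :
    P.bracket (X.parity U f) g = -polar (X.parity U) true (P.op U) f g := by
  rw [bracket, ← P.symb_rep]
  exact derived_eq_polar (X.isSuperParity U) (P.rep_parity U) f g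

/-- The sign in the definition of `X_f` cancels the sign in `derived_eq_polar`, so the polarisation
is the Hamiltonian field for both parities. -/
lemma ham_eq (f : X.Fn U) (h : V ≤ U) (g : X.Fn V) :
    P.ham f V h g = polar (X.parity V) true (P.op V) (res h f) g := by
  rw [ham, bracket_parity, neg_neg]

lemma bracket_of_even {f : X.Fn U} (hf : HasParity (X.parity U) false f) (g : X.Fn U) :
    P.bracket f g = -polar (X.parity U) true (P.op U) f g := by
  rw [← bracket_parity, show X.parity U f = f by simpa [HasParity] using hf]

end SchoutenStructure

namespace VolumeForm

variable {X : SuperSpace.{u}} {p q : ℕ} (ρ : VolumeForm X p q) (c c' : Chart X p q)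
  {V W : Opens X.space}

lemma inverse_mul : Ring.inverse (ρ.coeff c) * ρ.coeff c = 1 :=
  Ring.inverse_mul_cancel _ (ρ.nondegenerate c)

lemma mul_inverse : ρ.coeff c * Ring.inverse (ρ.coeff c) = 1 :=
  Ring.mul_inverse_cancel _ (ρ.nondegenerate c)

lemma hasParity : HasParity (X.parity c.dom) false (ρ.coeff c) := by
  rw [HasParity, sgn_false, one_smul]
  exact ρ.even c

lemma isVol (hW : W ≤ c.dom) : Coords.IsVol (X.parity W) (res hW (ρ.coeff c))
    (res hW (Ring.inverse (ρ.coeff c))) := by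
  refine ⟨hasParity_res (ρ.hasParity c) hW, hasParity_res ?_ hW, ?_⟩
  · exact (ρ.hasParity c).of_mul_eq_one (ρ.inverse_mul c) (ρ.mul_inverse c)
  · rw [← map_mul, ρ.inverse_mul, map_one]

lemma transform_res (hW : W ≤ c.dom) (hW' : W ≤ c'.dom) :
    res hW (ρ.coeff c) = berezinian ((c.coords hW).jac (c'.coords hW')) *
      res hW' (ρ.coeff c') := by
  have h := congrArg (res (le_inf hW hW')) (ρ.transform c c')
  rw [map_mul, res_res, res_res, c.jacobian_eq, map_berezinian_algHom (X.isSuperParity _),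
    c.res_jac] at h
  exact h

end VolumeForm

lemma Coords.IsVol.res {X : SuperSpace.{u}} {U V : Opens X.space} {g u : X.Fn U}
    (hg : Coords.IsVol (X.parity U) g u) (h : V ≤ U) :
    Coords.IsVol (X.parity V) (SuperSpace.res h g) (SuperSpace.res h u) :=
  ⟨hasParity_res hg.even _, hasParity_res hg.even' _, by rw [← map_mul, hg.inv, map_one]⟩

lemma Coords.map_lie {R S : Type*} [Ring R] [Algebra ℝ R] [Ring S] [Algebra ℝ S]
    {α : R →ₐ[ℝ] R} {β : S →ₐ[ℝ] S} {p q : ℕ} (φ : R →ₐ[ℝ] S) (hφ : ∀ f, φ (α f) = β (φ f))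
    (c : Coords α p q) (c' : Coords β p q) (hx : ∀ a, φ (c.x a) = c'.x a)
    (hd : ∀ a f, φ (c.d a f) = c'.d a (φ f)) {Y : R →ₗ[ℝ] R} {Z : S →ₗ[ℝ] S}
    (hYZ : ∀ f, φ (Y f) = Z (φ f)) (r : R) : φ (c.lie r Y) = c'.lie (φ r) Z := by
  have ht : ∀ k f, φ (twist α k f) = twist β k (φ f) := fun k f => by
    cases k
    · rfl
    · exact hφ f
  simp only [Coords.lie, map_sum, hd, map_mul, ht, hYZ, hx]

namespace SchoutenStructure

section Local

variable {X : SuperSpace.{u}} (P : SchoutenStructure X) {p q : ℕ} (ρ : VolumeForm X p q)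
  (c c' : Chart X p q) {U V W : Opens X.space}

/-- The odd Laplace operator in a chart. -/
def locLap (hW : W ≤ c.dom) : X.Fn W →ₗ[ℝ] X.Fn W :=
  (c.coords hW).laplace (P.op W) (res hW (ρ.coeff c)) (res hW (Ring.inverse (ρ.coeff c)))

lemma res_locLap (hW : W ≤ c.dom) (h : V ≤ W) (f : X.Fn W) :
    res h (P.locLap ρ c hW f) = P.locLap ρ c (h.trans hW) (res h f) := by
  change res h (_ * (c.coords hW).lie _ _) = _ * (c.coords _).lie _ _
  rw [map_mul, res_res, Coords.map_lie (res h) (X.parity_res h) (c.coords hW)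
    (c.coords (h.trans hW)), res_res]
  · intro a; rw [c.coords_x, c.coords_x, c.res_coord]
  · intro a f; rw [c.coords_d, c.coords_d, c.res_partialDeriv]
  · intro g; rw [res_polar]

/-- Chart independence reduces to homogeneous `f`, where `X_f` is a superderivation and the
transformation law of the volume form feeds `Coords.lie_change`. -/
lemma locLap_eq (hW : W ≤ c.dom) (hW' : W ≤ c'.dom) :
    P.locLap ρ c hW = P.locLap ρ c' hW' := by
  ext f
  induction f using (X.isSuperParity W).induction with
  | add f g h1 h2 => rw [map_add, map_add, h1, h2]
  | hom k f hf =>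
    exact Coords.lie_change _ _ (X.isSuperParity W)
      ((P.op_isBV W).sder (X.isSuperParity W) hf) (ρ.isVol c hW) (ρ.isVol c' hW')
      (ρ.transform_res c c' hW hW')

lemma isLaplacian_iff (f h : X.Fn U) : P.IsLaplacian ρ f h ↔ ∀ c : Chart X p q,
    res inf_le_right h = P.locLap ρ c (inf_le_left : c.dom ⊓ U ≤ c.dom) (res inf_le_right f) := by
  refine forall_congr' fun c => ?_
  have h1 : P.ham f (c.dom ⊓ U) inf_le_right =
      (polar (X.parity _) true (P.op (c.dom ⊓ U)) (res inf_le_right f) :) :=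
    funext fun g => P.ham_eq f _ g
  have h2 := (ρ.isVol c (inf_le_left : c.dom ⊓ U ≤ c.dom))
  have h3 := h2.even.comm (X.isSuperParity _)
  rw [h1, c.lieCoeff_eq]
  change _ ↔ _ = _ * (c.coords _).lie _ _
  constructor
  · intro h; rw [h, ← h3, ← mul_assoc, h2.inv, one_mul]
  · intro h; rw [h, ← h3, ← mul_assoc, h3, h2.inv, one_mul]

end Local

/-! ### Gluing the local Laplacians -/

section Global

variable {p q : ℕ} {M : Supermanifold.{u} p q} (P : SchoutenStructure M.toSuperSpace)
  (ρ ρ' : VolumeForm M.toSuperSpace p q) {U V W : Opens M.space}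

/-- A chart around a point. -/
def _root_.OddPoisson.Supermanifold.chart (M : Supermanifold.{u} p q) (x : M.space) :
    Chart M.toSuperSpace p q := (M.exists_chart x).choose

lemma _root_.OddPoisson.Supermanifold.mem_chart (M : Supermanifold.{u} p q) (x : M.space) :
    x ∈ (M.chart x).dom := (M.exists_chart x).choose_spec

lemma _root_.OddPoisson.Supermanifold.le_iSup (M : Supermanifold.{u} p q) (U : Opens M.space) :
    U ≤ ⨆ x, (M.chart x).dom ⊓ U := fun x hx =>
  Opens.mem_iSup.2 ⟨x, M.mem_chart x, hx⟩

lemma _root_.OddPoisson.Supermanifold.eq_of_charts {f g : M.Fn U}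
    (h : ∀ (c : Chart M.toSuperSpace p q) (V : Opens M.space) (hV : V ≤ U), V ≤ c.dom →
      res hV f = res hV g) : f = g :=
  eq_of_locally (fun x => (M.chart x).dom ⊓ U) (fun _ => inf_le_right) (M.le_iSup U)
    fun x => h (M.chart x) _ _ inf_le_left

/-- One chart around each point suffices for the gluing. The defining condition quantifies over all
charts, so the glued function is compared with every other chart through `locLap_eq`. -/
lemma exists_isLaplacian (f : M.Fn U) : ∃ h, P.IsLaplacian ρ f h := by
  obtain ⟨h, hh⟩ := exists_glue (fun x => (M.chart x).dom ⊓ U) (fun _ => inf_le_right)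
    (M.le_iSup U) (fun x => P.locLap ρ (M.chart x) inf_le_left (res inf_le_right f))
    fun x y => by
      rw [res_locLap, res_locLap, res_res, res_res,
        P.locLap_eq ρ (M.chart x) (M.chart y) _ (inf_le_right.trans inf_le_left)]
  refine ⟨h, (P.isLaplacian_iff ρ f h).2 fun c => ?_⟩
  refine eq_of_locally (fun x => (M.chart x).dom ⊓ (c.dom ⊓ U)) (fun _ => inf_le_right)
    (M.le_iSup _) fun x => ?_
  have h1 := congrArg (res (inf_le_inf_left _ inf_le_right :
    (M.chart x).dom ⊓ (c.dom ⊓ U) ≤ (M.chart x).dom ⊓ U)) (hh x)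
  rw [res_locLap, res_res, res_res] at h1
  rw [res_locLap, res_res, res_res, h1,
    P.locLap_eq ρ (M.chart x) c _ (inf_le_right.trans inf_le_left)]

lemma isLaplacian_unique {f h h' : M.Fn U} (H : P.IsLaplacian ρ f h) (H' : P.IsLaplacian ρ f h') :
    h = h' := by
  rw [isLaplacian_iff] at H H'
  exact eq_of_locally (fun x => (M.chart x).dom ⊓ U) (fun _ => inf_le_right) (M.le_iSup U)
    fun x => (H _).trans (H' _).symm

lemma isLaplacian_laplacian (f : M.Fn U) : P.IsLaplacian ρ f (P.laplacian ρ f) :=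
  Classical.epsilon_spec (P.exists_isLaplacian ρ f)

lemma isLaplacian_iff_eq (f h : M.Fn U) : P.IsLaplacian ρ f h ↔ h = P.laplacian ρ f :=
  ⟨fun H => P.isLaplacian_unique ρ H (P.isLaplacian_laplacian ρ f),
    fun H => H ▸ P.isLaplacian_laplacian ρ f⟩

/-- The odd Laplace operator in a chart. -/
lemma res_laplacian (c : Chart M.toSuperSpace p q) (h : V ≤ U) (hV : V ≤ c.dom) (f : M.Fn U) :
    res h (P.laplacian ρ f) = P.locLap ρ c hV (res h f) := by
  have h1 := congrArg (res (le_inf hV h))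
    ((P.isLaplacian_iff ρ f _).1 (P.isLaplacian_laplacian ρ f) c)
  rwa [res_locLap, res_res, res_res] at h1

lemma res_laplacian_res (h : V ≤ U) (f : M.Fn U) :
    res h (P.laplacian ρ f) = P.laplacian ρ (res h f) := by
  refine M.eq_of_charts fun c W hW hc => ?_
  rw [res_res, P.res_laplacian ρ c _ hc, P.res_laplacian ρ c _ hc, res_res]

/-- The odd Laplace operator as a linear operator. -/
def lap (U : Opens M.space) : M.Fn U →ₗ[ℝ] M.Fn U where
  toFun f := P.laplacian ρ f
  map_add' f g := by
    refine M.eq_of_charts fun c W hW hc => ?_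
    simp only [map_add, P.res_laplacian ρ c _ hc]
  map_smul' t f := by
    refine M.eq_of_charts fun c W hW hc => ?_
    simp only [map_smul, P.res_laplacian ρ c _ hc, RingHom.id_apply]

lemma lap_apply (f : M.Fn U) : P.lap ρ U f = P.laplacian ρ f := rfl

lemma res_lap (c : Chart M.toSuperSpace p q) (h : V ≤ U) (hV : V ≤ c.dom) (f : M.Fn U) :
    res h (P.lap ρ U f) = P.locLap ρ c hV (res h f) := P.res_laplacian ρ c h hV f

/-- All three identities are compatible with restriction, so they are inherited from charts. -/
lemma lap_isOddLaplace (U : Opens M.space) :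
    IsOddLaplace (M.parity U) (P.op U) (P.lap ρ U) := by
  refine ⟨fun f => ?_, fun f g => ?_, fun k f g hf => ?_⟩
  all_goals
    refine M.eq_of_charts fun c W hW hc => ?_
    have hα := M.isSuperParity W
    have hD := P.op_isBV W
    have hr := ρ.isVol c hc
  · have h := (c.coords hc).laplace_parity hα hD hr (res hW f)
    rw [← parity_res', P.res_lap ρ c hW hc, map_smul, P.res_lap ρ c hW hc, ← parity_res']
    exact h
  · have h := (c.coords hc).laplace_mul hα hD hr (res hW f) (res hW g)
    simp only [map_add, map_mul, map_smul, P.res_lap ρ c hW hc, res_polar, ← parity_res']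
    exact h
  · have h := (c.coords hc).laplace_polar hα hD hr (hasParity_res hf hW) (res hW g)
    simp only [map_add, map_zero, map_smul, P.res_lap ρ c hW hc, res_polar]
    exact h

/-- The change of the odd Laplace operator under rescaling of the volume form. -/
lemma lap_rescale {g u : M.Fn ⊤} (hg : Coords.IsVol (M.parity ⊤) g u)
    (h : ∀ c, ρ'.coeff c = resTop c.dom g * ρ.coeff c) (U : Opens M.space) (f : M.Fn U) :
    P.lap ρ' U f = P.lap ρ U f + resTop U u * polar (M.parity U) true (P.op U) (resTop U g) f := by
  refine M.eq_of_charts fun c W hW hc => ?_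
  rw [map_add, map_mul, res_polar, P.res_lap ρ c hW hc, P.res_lap ρ' c hW hc, res_res, res_res]
  have hgW := hg.res (le_top : W ≤ ⊤)
  have h1 := (c.coords hc).laplace_rescale (M.isSuperParity W) (P.op_isBV W) (ρ.isVol c hc) hgW
    (res hW f)
  have h2 : res hc (ρ'.coeff c) = resTop W g * res hc (ρ.coeff c) := by
    rw [h c, map_mul, res_res]
  have h3 := ρ'.isVol c hc
  have h4 := ρ.isVol c hc
  -- Both sides are inverse to the density of the new volume form.
  have h5 : res hc (Ring.inverse (ρ'.coeff c)) = resTop W u * res hc (Ring.inverse (ρ.coeff c)) := by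
    refine left_inv_eq_right_inv h3.inv ?_
    have cc := fun x => h4.even'.comm (M.isSuperParity W) x
    have cu := fun x => hgW.even'.comm (M.isSuperParity W) x
    rw [h2, ← cc, mul_assoc, ← mul_assoc (res hc (ρ.coeff c)), ← cc, h4.inv, one_mul, ← cu,
      hgW.inv]
  rw [← h5, ← h2] at h1
  exact h1

end Global

end SchoutenStructure

/-! ### Exponentials -/

section Exp

variable {q : ℕ}

/-- Identification with the exponential of nilpotents, from which the addition rule for commuting
elements is inherited. -/
lemma gExp_eq (a : Grassmann q) : gExp a =
    Real.exp (gBody q a) • IsNilpotent.exp (a - algebraMap ℝ (Grassmann q) (gBody q a)) := by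
  have h : (a - algebraMap ℝ (Grassmann q) (gBody q a)) ^ (q + 1) = 0 :=
    grassmann_pow_eq_zero (by simp)
  rw [IsNilpotent.exp_eq_sum h, gExp]
  congr 1
  refine Finset.sum_congr rfl fun k _ => ?_
  rw [← algebraMap_smul ℝ ((k.factorial : ℚ)⁻¹)]
  simp

lemma gExp_add {a b : Grassmann q} (h : Commute a b) : gExp (a + b) = gExp a * gExp b := by
  have hn : ∀ c : Grassmann q, IsNilpotent (c - algebraMap ℝ (Grassmann q) (gBody q c)) :=
    fun c => ⟨q + 1, grassmann_pow_eq_zero (by simp)⟩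
  have hc : Commute (a - algebraMap ℝ (Grassmann q) (gBody q a))
      (b - algebraMap ℝ (Grassmann q) (gBody q b)) :=
    (h.sub_left (Algebra.commutes _ _)).sub_right
      ((Algebra.commutes _ _).symm : Commute _ _)
  rw [gExp_eq, gExp_eq, gExp_eq, smul_mul_smul_comm, ← Real.exp_add, ← map_add,
    ← IsNilpotent.exp_add_of_commute hc (hn a) (hn b)]
  congr 2
  rw [map_add, map_add]
  abel

lemma gExp_zero : gExp (0 : Grassmann q) = 1 := by
  rw [gExp_eq]; simp [IsNilpotent.exp_zero]

lemma gBody_gExp (a : Grassmann q) : gBody q (gExp a) = Real.exp (gBody q a) := by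
  rw [gExp, map_smul, map_sum, Finset.sum_range_succ', Finset.sum_eq_zero fun k _ => by simp]
  simp

end Exp

section SuperAlgebra

variable {R : Type*} [Ring R] [Algebra ℝ R] {α : R →ₐ[ℝ] R} {k : Bool} {Y : R →ₗ[ℝ] R} {ν : R}

lemma HasParity.pow (hν : HasParity α false ν) (n : ℕ) : HasParity α false (ν ^ n) := by
  have h : α ν = ν := by simpa [HasParity] using hν
  simp [HasParity, h]

lemma IsSDer.map_pow (hα : IsSuperParity α) (hY : IsSDer α k Y) (hν : HasParity α false ν)
    (n : ℕ) : Y (ν ^ (n + 1)) = ((n : ℝ) + 1) • (ν ^ n * Y ν) := by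
  induction n with
  | zero => simp
  | succ n ih =>
    rw [pow_succ' ν (n + 1), hY.leibniz, ih, twist_of_even hν, ← (hν.pow _).comm hα, mul_smul_comm,
      ← mul_assoc, ← pow_succ']
    push_cast
    module

/-- The exponential of a nilpotent element. -/
lemma isLogOf_sum_pow (hα : IsSuperParity α) (hν : HasParity α false ν) {m : ℕ}
    (hm : ν ^ (m + 1) = 0) :
    IsLogOf α ν (∑ k ∈ Finset.range (m + 1), ((k.factorial : ℝ)⁻¹) • ν ^ k) := by
  intro k Y hY
  -- Differentiating `ν ^ (m + 1) = 0` kills this term, so truncating the series does not spoil the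
  -- chain rule at the top degree.
  have h1 : ν ^ m * Y ν = 0 := by
    have h := hY.map_pow hα hν m
    rw [hm, map_zero] at h
    exact (smul_eq_zero.1 h.symm).resolve_left (by positivity)
  rw [map_sum, Finset.sum_range_succ', Finset.sum_range_succ, add_mul, smul_mul_assoc, h1,
    smul_zero, add_zero, Finset.sum_mul, pow_zero, map_smul, hY.map_one, smul_zero, add_zero]
  refine Finset.sum_congr rfl fun n _ => ?_
  rw [map_smul, hY.map_pow hα hν, smul_smul, smul_mul_assoc]
  congr 1
  rw [Nat.factorial_succ]
  have : (n.factorial : ℝ) ≠ 0 := by positivity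
  have : (n : ℝ) + 1 ≠ 0 := by positivity
  push_cast
  field_simp

lemma IsLogOf.mul (hα : IsSuperParity α) {σ τ g h : R} (hg : IsLogOf α σ g) (hh : IsLogOf α τ h)
    (pg : HasParity α false g) (ph : HasParity α false h) : IsLogOf α (σ + τ) (g * h) := by
  intro k Y hY
  rw [hY.leibniz, twist_of_even pg, hg _ _ hY, hh _ _ hY, map_add, mul_add, mul_assoc g,
    ← ph.comm hα, mul_assoc, mul_assoc]

lemma Coords.isLogOf {p q : ℕ} (hα : IsSuperParity α) (c : Coords α p q) {σ g : R}
    (hg : HasParity α false g) (h : ∀ a, c.d a g = g * c.d a σ) : IsLogOf α σ g := by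
  intro k Y hY
  rw [c.apply_eq_sum hα hY, c.apply_eq_sum hα hY σ, Finset.mul_sum]
  refine Finset.sum_congr rfl fun a _ => ?_
  rw [h, ← mul_assoc, ← mul_assoc, hg.comm hα]

end SuperAlgebra

section Model

variable {S : Type u} [TopologicalSpace S] {p q : ℕ}
  {e : OpenPartialHomeomorph S (EuclideanSpace ℝ (Fin p))} {W : Opens S}

lemma contDiffOn_body (g : modelFn e q W) :
    ContDiffOn ℝ ∞ (fun y => gBody q (inChart e W g.1 y)) (chartImage e W) :=
  (LinearMap.toContinuousLinearMap (gBody q).toLinearMap).contDiff.comp_contDiffOn g.2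

/-- The underlying real function. -/
def modelBody (g : modelFn e q W) : modelFn e q W := modelScalar e q W (contDiffOn_body g)

lemma modelBody_apply (hW : (W : Set S) ⊆ e.source) (g : modelFn e q W) (w : W) :
    (modelBody g).1 w = algebraMap ℝ _ (gBody q (g.1 w)) := by
  rw [modelBody, modelScalar_apply, inChart_apply hW]

lemma modelNil_pow (hW : (W : Set S) ⊆ e.source) (g : modelFn e q W) :
    (g - modelBody g) ^ (q + 1) = 0 := by
  refine modelFn_ext fun w => ?_
  have h : ((g - modelBody g) ^ (q + 1)).1 w = ((g - modelBody g).1 w) ^ (q + 1) :=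
    map_pow (modelEval w) _ _
  rw [h, modelFn_sub_apply, modelBody_apply hW]
  exact grassmann_pow_eq_zero (by simp)

/-- The exponential of a function on a superdomain. -/
def modelExp (g : modelFn e q W) : modelFn e q W :=
  modelScalar e q W (contDiffOn_body g).exp *
    ∑ k ∈ Finset.range (q + 1), ((k.factorial : ℝ)⁻¹) • (g - modelBody g) ^ k

lemma modelExp_apply (hW : (W : Set S) ⊆ e.source) (g : modelFn e q W) (w : W) :
    (modelExp g).1 w = gExp (g.1 w) := by
  rw [modelExp, modelFn_mul_apply, modelScalar_apply, inChart_apply hW, modelFn_sum_apply, gExp,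
    ← Algebra.smul_def]
  congr 1
  refine Finset.sum_congr rfl fun k _ => ?_
  have h : ((g - modelBody g) ^ k).1 w = ((g - modelBody g).1 w) ^ k :=
    map_pow (modelEval w) _ _
  rw [modelFn_smul_apply, h, modelFn_sub_apply, modelBody_apply hW]

lemma modelScalar_hasParity {φ : EuclideanSpace ℝ (Fin p) → ℝ}
    (hφ : ContDiffOn ℝ ∞ φ (chartImage e W)) :
    HasParity (modelParity e q W) false (modelScalar e q W hφ) := by
  rw [HasParity, sgn_false, one_smul]
  exact modelFn_ext fun w => by simp

lemma modelExp_hasParity {g : modelFn e q W} (hg : HasParity (modelParity e q W) false g) :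
    HasParity (modelParity e q W) false (modelExp g) :=
  (modelScalar_hasParity _).mul (HasParity.sum fun k _ =>
    ((hg.sub (modelScalar_hasParity _)).pow k).smul _)

/-- The underlying real function obeys the classical chain rule and the nilpotent remainder that of
the finite series; logarithms add under products. -/
lemma isLogOf_modelExp (hα : IsSuperParity (modelParity e q W)) (hW : (W : Set S) ⊆ e.source)
    {g : modelFn e q W} (hg : HasParity (modelParity e q W) false g) :
    IsLogOf (modelParity e q W) g (modelExp g) := by
  have hb : HasParity (modelParity e q W) false (modelBody g) := modelScalar_hasParity _
  have hν := hg.sub hb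
  have h1 := isLogOf_sum_pow hα hν (modelNil_pow hW g)
  have h2 : IsLogOf (modelParity e q W) (modelBody g)
      (modelScalar e q W (contDiffOn_body g).exp) := by
    refine (modelCoords hW).isLogOf hα (modelScalar_hasParity _) fun a => modelFn_ext fun w => ?_
    have hn := (isOpen_chartImage e W).mem_nhds (mem_chartImage hW w)
    have hd := ((contDiffOn_body g).differentiableOn (by simp)).differentiableAt hn
    cases a with
    | inl i =>
      change (modelDeriv i _).1 w = _ * (modelDeriv i _).1 w
      rw [modelBody, modelDeriv_scalar hW, modelDeriv_scalar hW, modelScalar_apply, ← map_mul,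
        fderiv_exp hd]
      rfl
    | inr j =>
      change gDeriv j (algebraMap ℝ _ _) = _ * gDeriv j (algebraMap ℝ _ _)
      rw [gDeriv_algebraMap, gDeriv_algebraMap, mul_zero]
  have h3 := h2.mul hα h1 (modelScalar_hasParity _) (HasParity.sum fun k _ => (hν.pow k).smul _)
  rwa [add_sub_cancel] at h3

/-- A function on a superdomain is invertible where its underlying real function does not vanish. -/
lemma isUnit_of_gBody_ne_zero (hW : (W : Set S) ⊆ e.source) {g : modelFn e q W}
    (hg : ∀ w, gBody q (g.1 w) ≠ 0) : IsUnit g := by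
  have hs : ContDiffOn ℝ ∞ (fun y => (gBody q (inChart e W g.1 y))⁻¹) (chartImage e W) :=
    (contDiffOn_body g).inv fun y hy => by rw [inChart_of_mem e _ hy]; exact hg _
  have h1 : modelBody g * modelScalar e q W hs = 1 := modelFn_ext fun w => by
    rw [modelFn_mul_apply, modelBody_apply hW, modelScalar_apply, inChart_apply hW, ← map_mul,
      mul_inv_cancel₀ (hg w), map_one]; rfl
  have hc : ∀ f, Commute (modelBody g) f := fun f => modelFn_ext fun w => by
    rw [modelFn_mul_apply, modelFn_mul_apply, modelBody_apply hW, Algebra.commutes]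
  have h2 : IsUnit (modelBody g) := isUnit_iff_exists.2 ⟨_, h1, (hc _).symm.eq.trans h1⟩
  have h3 : IsNilpotent (g - modelBody g) := ⟨q + 1, modelNil_pow hW g⟩
  have h4 := h3.isUnit_add_left_of_commute h2 (hc _).symm
  rwa [add_sub_cancel] at h4

end Model

open SuperSpace

lemma IsSuperParity.of_equiv {R S : Type*} [Ring R] [Algebra ℝ R] [Ring S] [Algebra ℝ S]
    {α : R →ₐ[ℝ] R} {β : S →ₐ[ℝ] S} (hα : IsSuperParity α) (φ : R ≃ₐ[ℝ] S)
    (hφ : ∀ f, φ (α f) = β (φ f)) : IsSuperParity β := by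
  refine ⟨fun x => ?_, fun a b => ?_⟩
  · obtain ⟨x, rfl⟩ := φ.surjective x
    rw [← hφ, ← hφ, hα.invol]
  · obtain ⟨a, rfl⟩ := φ.surjective a
    obtain ⟨b, rfl⟩ := φ.surjective b
    have h := congrArg φ (hα.comm a b)
    simpa [superComm_apply, evenPart, oddPart, hφ] using h

/-! ### Chart independence and injectivity of the exponential -/

namespace Chart

variable {X : SuperSpace.{u}} {p q : ℕ} (c c' : Chart X p q) {W V : Opens X.space}

lemma iso_parity' (hW : W ≤ c.dom) (f : X.Fn W) :
    c.iso W hW (X.parity W f) = modelParity c.base q W (c.iso W hW f) :=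
  modelFn_ext fun w => c.iso_parity W hW f w

lemma isSuperParity_model (hW : W ≤ c.dom) : IsSuperParity (modelParity c.base q W) :=
  (X.isSuperParity W).of_equiv (c.iso W hW) (c.iso_parity' hW)

lemma hasParity_iso (hW : W ≤ c.dom) {k : Bool} {f : X.Fn W} :
    HasParity (modelParity c.base q W) k (c.iso W hW f) ↔ HasParity (X.parity W) k f := by
  rw [HasParity, HasParity, ← c.iso_parity', ← map_smul, (c.iso W hW).injective.eq_iff]

/-- The underlying real number of a function at a point. -/
def body (hW : W ≤ c.dom) (f : X.Fn W) (w : W) : ℝ := gBody q ((c.iso W hW f).1 w)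

lemma body_map_unit (hW : W ≤ c.dom) {f : X.Fn W} (hf : IsUnit f) (w : W) :
    c.body hW f w ≠ 0 :=
  (((hf.map (c.iso W hW)).map (modelEval w)).map (gBody q)).ne_zero

/-- Invertibility near a point is intrinsic. If the two values differed, subtracting the first would
give a function invertible near `w` by the second chart, yet with value zero at `w` in the first. -/
lemma body_eq (hW : W ≤ c.dom) (hW' : W ≤ c'.dom) (f : X.Fn W) (w : W) :
    c.body hW f w = c'.body hW' f w := by
  by_contra hne
  let g : X.Fn W := f - algebraMap ℝ _ (c.body hW f w)
  have h1 : c.body hW g w = 0 := by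
    simp [g, body, ← modelEval_apply]
  have h2 : c'.body hW' g w ≠ 0 := by
    have : c'.body hW' g w = c'.body hW' f w - c.body hW f w := by
      simp [g, body, ← modelEval_apply]
    rw [this, sub_ne_zero]
    exact fun h => hne h.symm
  have h3 : ContinuousOn (fun y => gBody q (inChart c'.base W (c'.iso W hW' g).1 y))
      (chartImage c'.base W) := (contDiffOn_body _).continuousOn
  have hO : IsOpen (c'.base.source ∩ c'.base ⁻¹' (chartImage c'.base W ∩
      (fun y => gBody q (inChart c'.base W (c'.iso W hW' g).1 y)) ⁻¹' {0}ᶜ)) :=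
    c'.base.isOpen_inter_preimage
      (h3.isOpen_inter_preimage (isOpen_chartImage _ _) isOpen_compl_singleton)
  let V : Opens X.space := ⟨_, hO⟩ ⊓ W
  have hV : V ≤ W := inf_le_right
  have hw : w.1 ∈ V := by
    refine ⟨⟨hW' w.2, mem_chartImage hW' w, ?_⟩, w.2⟩
    change gBody q (inChart c'.base W _ (c'.base w)) ≠ 0
    rw [inChart_apply hW']
    exact h2
  have h4 : IsUnit (res hV g) := by
    have h5 : IsUnit (c'.iso V (hV.trans hW') (res hV g)) := by
      refine isUnit_of_gBody_ne_zero (hV.trans hW') fun v => ?_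
      have h6 : gBody q (inChart c'.base W (c'.iso W hW' g).1 (c'.base v)) ≠ 0 := v.2.1.2.2
      rw [c'.iso_res W V hW' (hV.trans hW') hV]
      rwa [inChart_apply hW' _ ⟨v.1, hV v.2⟩] at h6
    simpa using h5.map (c'.iso V (hV.trans hW')).symm
  refine c.body_map_unit (hV.trans hW) h4 ⟨w.1, hw⟩ ?_
  rw [body, c.iso_res W V hW (hV.trans hW) hV]
  exact h1

/-- A function all of whose odd partial derivatives vanish is determined by the underlying real
function. -/
lemma eq_algebraMap_body (hW : W ≤ c.dom) {f : X.Fn W}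
    (hf : ∀ j, c.partialDeriv hW (.inr j) f = 0) (w : W) :
    (c.iso W hW f).1 w = algebraMap ℝ _ (c.body hW f w) := by
  refine eq_algebraMap_of_gDeriv fun j => ?_
  have h := congrArg (fun g => (c.iso W hW g).1 w) (hf j)
  simpa [partialDeriv] using h

/-- The exponential in a chart. -/
def exp (hW : W ≤ c.dom) (σ : X.Fn W) : X.Fn W := (c.iso W hW).symm (modelExp (c.iso W hW σ))

lemma iso_exp (hW : W ≤ c.dom) (σ : X.Fn W) (w : W) :
    (c.iso W hW (c.exp hW σ)).1 w = gExp ((c.iso W hW σ).1 w) := by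
  rw [exp, AlgEquiv.apply_symm_apply, modelExp_apply hW]

lemma res_exp (hW : W ≤ c.dom) (h : V ≤ W) (σ : X.Fn W) :
    res h (c.exp hW σ) = c.exp (h.trans hW) (res h σ) := by
  refine c.ext_iso (h.trans hW) fun w => ?_
  rw [iso_exp, c.iso_res W V hW (h.trans hW) h, c.iso_res W V hW (h.trans hW) h, iso_exp]

lemma body_exp (hW : W ≤ c.dom) (σ : X.Fn W) (w : W) :
    c.body hW (c.exp hW σ) w = Real.exp (c.body hW σ w) := by
  rw [body, iso_exp, gBody_gExp, body]

lemma exp_hasParity (hW : W ≤ c.dom) {σ : X.Fn W} (hσ : HasParity (X.parity W) false σ) :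
    HasParity (X.parity W) false (c.exp hW σ) := by
  rw [← c.hasParity_iso hW, exp, AlgEquiv.apply_symm_apply]
  exact modelExp_hasParity ((c.hasParity_iso hW).2 hσ)

lemma exp_isLogOf (hW : W ≤ c.dom) {σ : X.Fn W} (hσ : HasParity (X.parity W) false σ) :
    IsLogOf (X.parity W) σ (c.exp hW σ) := by
  refine (c.coords hW).isLogOf (X.isSuperParity W) (c.exp_hasParity hW hσ) fun a => ?_
  have h := isLogOf_modelExp (c.isSuperParity_model hW) hW ((c.hasParity_iso hW).2 hσ) _ _
    ((modelCoords hW).sder a)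
  apply (c.iso W hW).injective
  rw [map_mul]
  have h1 : ∀ f, c.iso W hW ((c.coords hW).d a f) = (modelCoords hW).d a (c.iso W hW f) :=
    fun f => (c.iso W hW).apply_symm_apply _
  rw [h1, h1, exp, AlgEquiv.apply_symm_apply, h]

lemma exp_add (hW : W ≤ c.dom) {σ τ : X.Fn W} (hσ : HasParity (X.parity W) false σ) :
    c.exp hW (σ + τ) = c.exp hW σ * c.exp hW τ := by
  refine c.ext_iso hW fun w => ?_
  have h : c.iso W hW σ * c.iso W hW τ = c.iso W hW τ * c.iso W hW σ :=
    ((c.hasParity_iso hW).2 hσ).comm (c.isSuperParity_model hW) _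
  rw [iso_exp, map_mul, modelFn_mul_apply, iso_exp, iso_exp, ← gExp_add]
  · rw [map_add]; rfl
  · exact congrArg (modelEval w) h

lemma exp_zero (hW : W ≤ c.dom) : c.exp hW 0 = 1 := by
  refine c.ext_iso hW fun w => ?_
  rw [iso_exp, map_zero, map_one]
  exact gExp_zero

lemma exp_mul_exp_neg (hW : W ≤ c.dom) {σ : X.Fn W} (hσ : HasParity (X.parity W) false σ) :
    c.exp hW σ * c.exp hW (-σ) = 1 := by
  rw [← c.exp_add hW hσ, add_neg_cancel, exp_zero]

lemma exp_isVol (hW : W ≤ c.dom) {σ : X.Fn W} (hσ : HasParity (X.parity W) false σ) :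
    Coords.IsVol (X.parity W) (c.exp hW σ) (c.exp hW (-σ)) := by
  have h := c.exp_hasParity hW hσ
  refine ⟨h, c.exp_hasParity hW hσ.neg, ?_⟩
  rw [← h.comm (X.isSuperParity W), c.exp_mul_exp_neg hW hσ]

/-- The exponential does not depend on the chart. -/
lemma exp_eq (hW : W ≤ c.dom) (hW' : W ≤ c'.dom) {σ : X.Fn W}
    (hσ : HasParity (X.parity W) false σ) : c.exp hW σ = c'.exp hW' σ := by
  have hα := X.isSuperParity W
  have hv := c.exp_isVol hW hσ
  have hv' := c'.exp_isVol hW' hσ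
  have h1 := (c.exp_isLogOf hW hσ).mul hα (c'.exp_isLogOf hW' hσ.neg) hv.even hv'.even'
  -- The logarithm of this product is `σ - σ = 0`, so every derivation kills it. Vanishing odd
  -- derivatives reduce it to its underlying real function, which is `1` by the addition rule for
  -- the real exponential.
  have h2 : c.exp hW σ * c'.exp hW' (-σ) = 1 := by
    refine c.ext_iso hW fun w => ?_
    rw [c.eq_algebraMap_body hW (fun j => ?_), map_one]
    · have h3 : c.body hW (c.exp hW σ * c'.exp hW' (-σ)) w = 1 := by
        have h4 : c.body hW (c.exp hW σ * c'.exp hW' (-σ)) w =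
            c.body hW (c.exp hW σ) w * c.body hW (c'.exp hW' (-σ)) w := by
          simp [body]
        rw [h4, body_exp, c.body_eq c' hW hW' (c'.exp hW' (-σ)), body_exp, ← c.body_eq c' hW hW',
            ← Real.exp_add]
        simp [body]
      rw [h3, map_one]; rfl
    · have h3 := h1 _ _ ((c.coords hW).sder (.inr j))
      rwa [add_neg_cancel, map_zero, mul_zero, c.coords_d] at h3
  have h3 := congrArg (· * c'.exp hW' σ) h2
  simpa only [mul_assoc, hv'.inv, mul_one, one_mul] using h3

lemma exp_injective (hW : W ≤ c.dom) {σ τ : X.Fn W} (hσ : HasParity (X.parity W) false σ)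
    (hτ : HasParity (X.parity W) false τ) (h : c.exp hW σ = c.exp hW τ) : σ = τ := by
  have hv := c.exp_isVol hW hσ
  rw [← sub_eq_zero]
  refine c.ext_iso hW fun w => ?_
  -- The real parts agree by injectivity of the real exponential. The odd derivatives of `σ` and `τ`
  -- agree because both are the logarithmic derivatives of one element, so nothing nilpotent
  -- remains.
  have h0 : c.body hW (σ - τ) w = 0 := by
    have h1 := congrArg (fun f => c.body hW f w) h
    simp only [body_exp, Real.exp_eq_exp] at h1
    have h2 : c.body hW (σ - τ) w = c.body hW σ w - c.body hW τ w := by simp [body]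
    rw [h2, h1, sub_self]
  rw [c.eq_algebraMap_body hW (fun j => ?_), h0, map_zero, map_zero]
  · rfl
  · have h1 := c.exp_isLogOf hW hσ _ _ ((c.coords hW).sder (.inr j))
    have h2 := c.exp_isLogOf hW hτ _ _ ((c.coords hW).sder (.inr j))
    rw [← h, h1] at h2
    have h3 := congrArg (c.exp hW (-σ) * ·) h2
    simp only [← mul_assoc, hv.inv, one_mul] at h3
    rw [← c.coords_d, map_sub, h3, sub_self]

end Chart

open SuperSpace

lemma SuperSpace.IsEven.hasParity {X : SuperSpace.{u}} {U : Opens X.space} {f : X.Fn U}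
    (h : IsEven f) : HasParity (X.parity U) false f := by
  rw [HasParity, sgn_false, one_smul]
  exact h

lemma HasParity.isEven {X : SuperSpace.{u}} {U : Opens X.space} {f : X.Fn U}
    (h : HasParity (X.parity U) false f) : IsEven f := by
  rw [HasParity, sgn_false, one_smul] at h
  exact h

/-! ### Global exponentials and rescalings of volume forms -/

section GlobalExp

variable {p q : ℕ} {M : Supermanifold.{u} p q} {σ τ E F : M.Fn ⊤} {U W : Opens M.space}

lemma isExp_iff : IsExp p q σ E ↔ ∀ c : Chart M.toSuperSpace p q,
    resTop c.dom E = c.exp le_rfl (resTop c.dom σ) := by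
  refine forall_congr' fun c => ⟨fun h => c.ext_iso le_rfl fun w => ?_, fun h w => ?_⟩
  · rw [c.iso_exp]; exact h w
  · rw [h]; exact c.iso_exp le_rfl _ w

lemma IsExp.res_eq (h : IsExp p q σ E) (c : Chart M.toSuperSpace p q) (hW : W ≤ c.dom) :
    resTop W E = c.exp hW (resTop W σ) := by
  have h1 := congrArg (res hW) (isExp_iff.1 h c)
  rwa [c.res_exp, res_res, res_res] at h1

lemma IsExp.of_res (h : ∀ (c : Chart M.toSuperSpace p q) (W : Opens M.space) (hW : W ≤ c.dom),
    resTop W E = c.exp hW (resTop W σ)) : IsExp p q σ E :=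
  isExp_iff.2 fun c => h c _ le_rfl

lemma exists_isExp (hσ : HasParity (M.parity ⊤) false σ) : ∃ E, IsExp p q σ E := by
  have hσ' := fun W : Opens M.space => hasParity_res hσ (le_top : W ≤ ⊤)
  obtain ⟨E, hE⟩ := exists_glue (fun x => (M.chart x).dom ⊓ ⊤) (fun _ => inf_le_right)
    (M.le_iSup ⊤) (fun x => (M.chart x).exp inf_le_left (resTop _ σ)) fun x y => by
      rw [Chart.res_exp, Chart.res_exp, res_res, res_res]
      exact (M.chart x).exp_eq (M.chart y) _ _ (hσ' _)
  refine ⟨E, IsExp.of_res fun c W hW => ?_⟩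
  refine eq_of_locally (fun x => (M.chart x).dom ⊓ W) (fun _ => inf_le_right)
    (M.le_iSup _) fun x => ?_
  have h1 := congrArg (res (inf_le_inf_left _ le_top :
    (M.chart x).dom ⊓ W ≤ (M.chart x).dom ⊓ ⊤)) (hE x)
  rw [Chart.res_exp, res_res, res_res] at h1
  rw [Chart.res_exp, res_res, res_res, h1]
  exact (M.chart x).exp_eq c _ _ (hσ' _)

lemma IsExp.hasParity (hσ : HasParity (M.parity ⊤) false σ) (h : IsExp p q σ E) :
    HasParity (M.parity ⊤) false E := by
  refine M.eq_of_charts fun c W hW hc => ?_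
  have h1 := c.exp_hasParity hc (hasParity_res hσ hW)
  rw [← h.res_eq c hc] at h1
  rw [← parity_res', map_smul]
  exact h1

lemma IsExp.add (hσ : HasParity (M.parity ⊤) false σ) (h : IsExp p q σ E) (h' : IsExp p q τ F) :
    IsExp p q (σ + τ) (E * F) :=
  IsExp.of_res fun c W hW => by
    rw [map_mul, map_add, h.res_eq c hW, h'.res_eq c hW, c.exp_add hW (hasParity_res hσ _)]

lemma isExp_zero : IsExp p q (0 : M.Fn ⊤) 1 :=
  IsExp.of_res fun c W hW => by rw [map_one, map_zero, c.exp_zero]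

lemma IsExp.unique (h : IsExp p q σ E) (h' : IsExp p q σ F) : E = F :=
  M.eq_of_charts fun c _ _ hc => (h.res_eq c hc).trans (h'.res_eq c hc).symm

lemma IsExp.injective (hσ : HasParity (M.parity ⊤) false σ) (hτ : HasParity (M.parity ⊤) false τ)
    (h : IsExp p q σ E) (h' : IsExp p q τ E) : σ = τ :=
  M.eq_of_charts fun c _ hW hc => c.exp_injective hc (hasParity_res hσ hW) (hasParity_res hτ hW)
    ((h.res_eq c hc).symm.trans (h'.res_eq c hc))

lemma IsExp.isVol (hσ : HasParity (M.parity ⊤) false σ) (h : IsExp p q σ E)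
    (h' : IsExp p q (-σ) F) : Coords.IsVol (M.parity ⊤) E F := by
  refine ⟨h.hasParity hσ, h'.hasParity hσ.neg, ?_⟩
  have h1 := h'.add hσ.neg h
  rw [neg_add_cancel] at h1
  exact h1.unique isExp_zero

variable {ρ ρ' ρ'' : VolumeForm M.toSuperSpace p q}

/-- Nondegeneracy determines the ratio `E`, and `E` determines its even logarithm. This makes the
choice of `σ` inside `masterH` harmless. -/
lemma IsExpMul.unique (h : IsExpMul σ ρ ρ') (h' : IsExpMul τ ρ ρ') : σ = τ := by
  obtain ⟨hσ, E, hE, hρ⟩ := h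
  obtain ⟨hτ, F, hF, hρ'⟩ := h'
  have : E = F := M.eq_of_charts fun c W hW hc => by
    have h1 := congrArg (res hc) (((hρ c).symm.trans (hρ' c)))
    rwa [map_mul, map_mul, res_res, res_res,
      ((ρ.nondegenerate c).map (res hc)).mul_left_inj] at h1
  subst this
  exact hE.injective hσ.hasParity hτ.hasParity hF

lemma IsExpMul.refl (ρ : VolumeForm M.toSuperSpace p q) : IsExpMul 0 ρ ρ :=
  ⟨map_zero _, 1, isExp_zero, fun c => by rw [map_one, one_mul]⟩

lemma IsExpMul.symm (h : IsExpMul σ ρ ρ') : IsExpMul (-σ) ρ' ρ := by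
  obtain ⟨hσ, E, hE, hρ⟩ := h
  obtain ⟨F, hF⟩ := exists_isExp hσ.hasParity.neg
  have hv := hE.isVol hσ.hasParity hF
  refine ⟨hσ.hasParity.neg.isEven, F, hF, fun c => ?_⟩
  rw [hρ, ← mul_assoc, ← map_mul, hv.inv, map_one, one_mul]

lemma IsExpMul.trans (h : IsExpMul σ ρ ρ') (h' : IsExpMul τ ρ' ρ'') :
    IsExpMul (σ + τ) ρ ρ'' := by
  obtain ⟨hσ, E, hE, hρ⟩ := h
  obtain ⟨hτ, F, hF, hρ'⟩ := h'
  refine ⟨(hσ.hasParity.add hτ.hasParity).isEven, E * F, hE.add hσ.hasParity hF, fun c => ?_⟩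
  rw [hρ', hρ, ← mul_assoc, ← map_mul, (hE.hasParity hσ.hasParity).comm (M.isSuperParity ⊤)]

end GlobalExp

/-! ### The function `H` and its cocycle conditions -/

namespace SchoutenStructure

variable {p q : ℕ} {M : Supermanifold.{u} p q} (P : SchoutenStructure M.toSuperSpace)
  {ρ ρ' ρ'' : VolumeForm M.toSuperSpace p q} {σ τ E F : M.Fn ⊤} {U W : Opens M.space}

lemma res_rescaleH (ρ : VolumeForm M.toSuperSpace p q) (h : W ≤ U) (g u : M.Fn U) :
    res h (rescaleH (M.parity U) (P.op U) (P.lap ρ U) g u) =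
      rescaleH (M.parity W) (P.op W) (P.lap ρ W) (res h g) (res h u) := by
  rw [rescaleH, rescaleH, map_sub, map_smul, map_mul, map_mul, map_mul, res_polar, lap_apply,
    res_laplacian_res, lap_apply]

lemma masterH_eq (h : IsExpMul σ ρ ρ') : P.masterH ρ' ρ =
    P.lap ρ ⊤ σ + (2⁻¹ : ℝ) • polar (M.parity ⊤) true (P.op ⊤) σ σ := by
  have h1 : Classical.epsilon (fun σ => IsExpMul σ ρ ρ') = σ :=
    (Classical.epsilon_spec (p := fun σ => IsExpMul σ ρ ρ') ⟨σ, h⟩).unique h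
  change P.laplacian ρ (Classical.epsilon _) -
    (2⁻¹ : ℝ) • P.bracket (Classical.epsilon _) (Classical.epsilon _) = _
  rw [h1, P.bracket_of_even h.1.hasParity, smul_neg, sub_neg_eq_add, lap_apply]

lemma polar_exp (hσ : HasParity (M.parity ⊤) false σ) (hE : IsExp p q σ E) (f : M.Fn U) :
    polar (M.parity U) true (P.op U) (resTop U E) f =
      resTop U E * polar (M.parity U) true (P.op U) (resTop U σ) f := by
  refine M.eq_of_charts fun c W hW hc => ?_
  have hs := hasParity_res hσ (le_top : W ≤ ⊤)
  have h1 := (c.exp_isLogOf hc hs).polar_left (M.isSuperParity W) (P.op_isBV W) hs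
    (c.exp_hasParity hc hs) (res hW f)
  rw [map_mul, res_polar, res_polar, res_res, res_res]
  rwa [← hE.res_eq c hc] at h1

lemma lap_exp (ρ : VolumeForm M.toSuperSpace p q) (hσ : HasParity (M.parity ⊤) false σ)
    (hE : IsExp p q σ E) : P.lap ρ ⊤ E =
      E * (P.lap ρ ⊤ σ + polar (M.parity ⊤) true (P.op ⊤) σ σ) := by
  refine M.eq_of_charts fun c W hW hc => ?_
  have hs := hasParity_res hσ (le_top : W ≤ ⊤)
  have h1 := (c.coords hc).laplace_exp (M.isSuperParity W) (P.op_isBV W) (ρ.isVol c hc)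
    (c.exp_isLogOf hc hs) hs (c.exp_hasParity hc hs)
  rw [← hE.res_eq c hc] at h1
  rw [map_mul, map_add, res_polar, P.res_lap ρ c _ hc, P.res_lap ρ c _ hc]
  exact h1

/-- With `g = e^σ` the first term of `rescaleH` is `Δσ + X_σ σ` and the second removes half of the
bracket. -/
lemma rescaleH_eq_masterH (h : IsExpMul σ ρ ρ') (hE : IsExp p q σ E) (hF : IsExp p q (-σ) F) :
    rescaleH (M.parity ⊤) (P.op ⊤) (P.lap ρ ⊤) E F = P.masterH ρ' ρ := by
  have hσ := h.1.hasParity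
  have hv := hE.isVol hσ hF
  have hp := P.polar_exp hσ hE (U := ⊤)
  have hd := P.op_isBV ⊤
  have hα := M.isSuperParity ⊤
  have hr : ∀ f : M.Fn ⊤, resTop ⊤ f = f := res_self
  simp only [hr] at hp
  rw [rescaleH, P.lap_exp ρ hσ hE, hp, hd.symm_of_even hα hσ E, hp, ← mul_assoc, hv.inv,
    one_mul, mul_assoc F, ← mul_assoc F E, hv.inv, one_mul, ← mul_assoc, hv.inv, one_mul,
    P.masterH_eq h]
  module

lemma laplacian_sq (h : IsExpMul σ ρ ρ') (f : M.Fn U) :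
    P.laplacian ρ' (P.laplacian ρ' f) =
      P.laplacian ρ (P.laplacian ρ f) - P.ham (P.masterH ρ' ρ) U le_top f := by
  obtain ⟨hσ, E, hE, hρ⟩ := id h
  obtain ⟨F, hF⟩ := exists_isExp hσ.hasParity.neg
  have hv := hE.isVol hσ.hasParity hF
  rw [ham_eq, ← P.rescaleH_eq_masterH h hE hF, res_rescaleH]
  exact (P.lap_isOddLaplace ρ U).rescale_sq (M.isSuperParity U) (P.op_isBV U)
    (hv.res le_top) (P.lap_rescale ρ ρ' hv hρ U) f

lemma masterH_parity (h : IsExpMul σ ρ ρ') : HasParity (M.parity ⊤) true (P.masterH ρ' ρ) := by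
  obtain ⟨hσ, E, hE, hρ⟩ := id h
  obtain ⟨F, hF⟩ := exists_isExp hσ.hasParity.neg
  rw [← P.rescaleH_eq_masterH h hE hF]
  exact rescaleH_parity (M.isSuperParity ⊤) (P.op_isBV ⊤) (P.lap_isOddLaplace ρ ⊤)
    (hE.isVol hσ.hasParity hF)

/-- Halving the exponent scales `Δσ` by `½` and the quadratic bracket by `¼`; the prefactor 2
restores the coefficients `1` and `½`. -/
lemma masterH_eq_exp (h : IsExpMul σ ρ ρ') : ∃ E E' : M.Fn ⊤, IsExp p q ((2⁻¹ : ℝ) • σ) E ∧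
    IsExp p q (-((2⁻¹ : ℝ) • σ)) E' ∧
    P.masterH ρ' ρ = (2 : ℝ) • (E' * P.laplacian ρ E) := by
  have hσ := h.1.hasParity.smul (2⁻¹ : ℝ)
  obtain ⟨E, hE⟩ := exists_isExp hσ
  obtain ⟨F, hF⟩ := exists_isExp hσ.neg
  refine ⟨E, F, hE, hF, ?_⟩
  rw [← lap_apply, P.lap_exp ρ hσ hE, ← mul_assoc, (hE.isVol hσ hF).inv, one_mul, P.masterH_eq h]
  simp only [map_smul, LinearMap.smul_apply]
  module

lemma lap_expMul (h : IsExpMul σ ρ ρ') (f : M.Fn ⊤) :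
    P.lap ρ' ⊤ f = P.lap ρ ⊤ f + polar (M.parity ⊤) true (P.op ⊤) σ f := by
  obtain ⟨hσ, E, hE, hρ⟩ := h
  obtain ⟨F, hF⟩ := exists_isExp hσ.hasParity.neg
  have hv := hE.isVol hσ.hasParity hF
  rw [P.lap_rescale ρ ρ' hv hρ, P.polar_exp hσ.hasParity hE, ← mul_assoc, ← map_mul, hv.inv,
    map_one, one_mul, resTop, res_self]

lemma masterH_self (ρ : VolumeForm M.toSuperSpace p q) : P.masterH ρ ρ = 0 := by
  rw [P.masterH_eq (IsExpMul.refl ρ)]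
  simp

lemma masterH_symm (h : IsExpMul σ ρ ρ') : P.masterH ρ' ρ = -P.masterH ρ ρ' := by
  rw [P.masterH_eq h, P.masterH_eq h.symm, P.lap_expMul h]
  simp only [map_neg, LinearMap.neg_apply]
  module

/-- The cross term of the quadratic part in `σ + τ` is `X_σ τ` by symmetry, which is precisely the
difference between `Δ_{ρ'} τ` and `Δ_ρ τ`. -/
lemma masterH_trans (h : IsExpMul σ ρ ρ') (h' : IsExpMul τ ρ' ρ'') :
    P.masterH ρ'' ρ = P.masterH ρ'' ρ' + P.masterH ρ' ρ := by
  rw [P.masterH_eq h, P.masterH_eq h', P.masterH_eq (h.trans h'), P.lap_expMul h]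
  simp only [map_add, LinearMap.add_apply]
  rw [(P.op_isBV ⊤).symm_of_even (M.isSuperParity ⊤) h'.1.hasParity σ]
  module

end SchoutenStructure

open SuperSpace

/-! ### The modular class -/

section Algebra

variable {R : Type*} [Ring R] [Algebra ℝ R] {α : R →ₐ[ℝ] R} {A L : R →ₗ[ℝ] R}

/-- Modulo functions the commutator of `A` with `f` is `X_f`: the symbol of a Hamiltonian field is
the differential of its Hamiltonian. -/
lemma superComm_normalise_sub (hα : IsSuperParity α) (hA : IsBV α (normalise A)) {k : Bool} {f : R}
    (hf : HasParity α k f) : superComm (opParity α) A (mulOp f) -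
      polar α true (normalise A) f ∈ diffOps α 1 := by
  have h1 : A = normalise A + mulOp (A 1) := by rw [normalise, sub_add_cancel]
  have h2 : superComm (opParity α) A (mulOp f) - polar α true (normalise A) f =
      mulOp (normalise A f) := by
    conv_lhs => rw [h1]
    rw [map_add, LinearMap.add_apply, superComm_mulOp_mulOp hα.invol hα.comm, add_zero, ← h1]
    ext x
    rw [LinearMap.sub_apply, superComm_mulOp_apply hα hA.odd hf]
    simp [polar_apply]
  rw [h2]
  exact mulOp_mem_diffOps hα _

/-- The operator `Δ²` commutes with an operator of symbol `𝔖` up to lower order. -/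
lemma IsOddLaplace.superComm_sq_mem (hα : IsSuperParity α) (hA : IsBV α (normalise A))
    (hL : IsOddLaplace α (normalise A) L) :
    superComm (opParity α) A (L.comp L) ∈ diffOps α 2 := by
  have hY := hL.sq_isSDer hα
  -- Both terms have the same defect from the Leibniz rule, twice the bracket. So `A` is half of `L`
  -- up to a derivation and a function.
  have hZ : IsSDer α true (L - (2 : ℝ) • normalise A) := by
    refine ⟨fun f => ?_, fun f g => ?_⟩
    · simp only [LinearMap.sub_apply, LinearMap.smul_apply, map_sub, map_smul, hL.odd f, hA.odd f]
      module
    · simp only [LinearMap.sub_apply, LinearMap.smul_apply, hL.mul, polar_apply, twist_true,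
        smul_sub, sub_mul, mul_sub, smul_mul_assoc, mul_smul_comm]
      module
  have h1 : A = (2⁻¹ : ℝ) • L - (2⁻¹ : ℝ) • (L - (2 : ℝ) • normalise A) + mulOp (A 1) := by
    rw [normalise]; module
  have h2 : superComm (opParity α) L (L.comp L) = 0 := by
    have h3 := opParity_eq_smul hα hY.parity
    rw [sgn_false, one_smul] at h3
    rw [superComm_apply, evenPart, oddPart]
    simp only [LinearMap.smul_apply, LinearMap.add_apply, LinearMap.sub_apply, LinearMap.id_apply,
      h3, sub_self, smul_zero, zero_mul, add_zero]
    ext x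
    simp only [LinearMap.sub_apply, LinearMap.smul_apply, Module.End.mul_apply,
      LinearMap.add_apply, LinearMap.comp_apply, LinearMap.zero_apply]
    module
  generalize L - (2 : ℝ) • normalise A = Z at hZ h1
  rw [h1]
  simp only [map_add, map_sub, map_smul, LinearMap.add_apply, LinearMap.sub_apply,
    LinearMap.smul_apply, h2, smul_zero, zero_sub]
  -- `L` commutes with `L²`, and the commutators of the derivation `L²` with a derivation and with a
  -- function have order at most 1 and 0.
  refine add_mem (neg_mem (Submodule.smul_mem _ _ ?_)) (diffOps_le_succ α 1 ?_)
  · exact superComm_mem_diffOps hα.invol hα.comm 2 1 1 rfl (hZ.mem_diffOps hα) (hY.mem_diffOps hα)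
  · exact superComm_mem_diffOps hα.invol hα.comm 1 0 1 rfl (mulOp_mem_diffOps hα _)
      (hY.mem_diffOps hα)

end Algebra

/-! ### Ratios of volume forms -/

section Ratio

variable {p q : ℕ} {M : Supermanifold.{u} p q} (ρ ρ' : VolumeForm M.toSuperSpace p q)

/-- Both densities are multiplied by the same Berezinian under a change of chart, so the local
quotients agree and glue. -/
lemma VolumeForm.exists_ratio : ∃ g : M.Fn ⊤, HasParity (M.parity ⊤) false g ∧
    ∀ c, ρ'.coeff c = resTop c.dom g * ρ.coeff c := by
  have key : ∀ (c c' : Chart M.toSuperSpace p q) (W : Opens M.space) (hc : W ≤ c.dom)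
      (hc' : W ≤ c'.dom), res hc (ρ'.coeff c * Ring.inverse (ρ.coeff c)) =
        res hc' (ρ'.coeff c' * Ring.inverse (ρ.coeff c')) := by
    intro c c' W hc hc'
    have hα := M.isSuperParity W
    have h1 := ρ.transform_res c c' hc hc'
    have h2 := ρ'.transform_res c c' hc hc'
    have v := ρ.isVol c hc
    have v' := ρ.isVol c' hc'
    rw [map_mul, map_mul]
    generalize berezinian ((c.coords hc).jac (c'.coords hc')) = B at h1 h2
    have h3 : res hc (ρ.coeff c) * res hc' (Ring.inverse (ρ.coeff c')) = B := by
      rw [h1, mul_assoc, v'.even.comm hα, v'.inv, mul_one]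
    rw [h2, ← h3, ← v.even'.comm hα, ← mul_assoc, ← mul_assoc, v.inv, one_mul, v'.even'.comm hα]
  obtain ⟨g, hg⟩ := exists_glue (fun x => (M.chart x).dom ⊓ ⊤) (fun _ => inf_le_right)
    (M.le_iSup ⊤) (fun x => res inf_le_left (ρ'.coeff (M.chart x) *
      Ring.inverse (ρ.coeff (M.chart x)))) fun x y => by
        rw [res_res, res_res]; exact key _ _ _ _ _
  have hg' : ∀ (c : Chart M.toSuperSpace p q) (W : Opens M.space) (hW : W ≤ c.dom),
      resTop W g = res hW (ρ'.coeff c * Ring.inverse (ρ.coeff c)) := by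
    intro c W hW
    refine eq_of_locally (fun x => (M.chart x).dom ⊓ W) (fun _ => inf_le_right)
      (M.le_iSup _) fun x => ?_
    have h1 := congrArg (res (inf_le_inf_left _ le_top :
      (M.chart x).dom ⊓ W ≤ (M.chart x).dom ⊓ ⊤)) (hg x)
    rw [res_res, res_res] at h1
    rw [res_res, res_res, h1]
    exact key _ _ _ _ _
  refine ⟨g, M.eq_of_charts fun c W hW hc => ?_, fun c => ?_⟩
  · have h1 := (ρ'.isVol c hc).even.mul (ρ.isVol c hc).even'
    rw [← map_mul, ← hg' c W hc] at h1
    rw [← parity_res', map_smul]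
    simpa [HasParity] using h1
  · have h1 := hg' c _ le_rfl
    rw [res_self] at h1
    rw [h1, mul_assoc, ρ.inverse_mul, mul_one]

lemma VolumeForm.exists_isVol_ratio : ∃ g u : M.Fn ⊤, Coords.IsVol (M.parity ⊤) g u ∧
    ∀ c, ρ'.coeff c = resTop c.dom g * ρ.coeff c := by
  obtain ⟨g, pg, hg⟩ := ρ.exists_ratio ρ'
  obtain ⟨u, pu, hu⟩ := ρ'.exists_ratio ρ
  refine ⟨g, u, ⟨pg, pu, M.eq_of_charts fun c W hW hc => ?_⟩, hg⟩
  have h1 := congrArg (res hc) (hu c)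
  rw [hg, map_mul, map_mul, res_res, res_res, ← mul_assoc] at h1
  have h2 := ((ρ.nondegenerate c).map (res hc)).mul_left_inj.1 ((one_mul _).trans h1)
  rw [map_mul, map_one]
  exact h2.symm

end Ratio

namespace SchoutenStructure

variable {p q : ℕ} {M : Supermanifold.{u} p q} (P : SchoutenStructure M.toSuperSpace)
  (ρ ρ' : VolumeForm M.toSuperSpace p q)

/-- The operator `Δ_ρ²`. -/
def lapSq : DiffOp M.toSuperSpace 2 :=
  ⟨fun U => (P.lap ρ U).comp (P.lap ρ U), fun U V h f => by
    simp only [LinearMap.comp_apply, lap_apply, res_laplacian_res],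
    fun U => ((P.lap_isOddLaplace ρ U).sq_isSDer (M.isSuperParity U)).mem_diffOps
      (M.isSuperParity U)⟩

lemma lapSq_cocycle : symb (P.lapSq ρ) ∈ LinearMap.ker (P.slDiff 1) := by
  rw [LinearMap.mem_ker, slDiff, ← P.symb_rep, symBracket_symb]
  refine (Submodule.Quotient.mk_eq_zero _).2 ?_
  exact ⟨(opBracket_mem (m := 2) (n := 1) rfl P.rep.2 (P.lapSq ρ).2).1, fun U =>
    (P.lap_isOddLaplace ρ U).superComm_sq_mem (M.isSuperParity U) (P.op_isBV U)⟩

/-- Multiplication by a global function. -/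
def mulTop (f : M.Fn ⊤) : DiffOp M.toSuperSpace 1 :=
  ⟨fun U => mulOp (resTop U f), fun U V h g => by
    rw [mulOp_apply, mulOp_apply, map_mul, res_res],
    fun U => mulOp_mem_diffOps (M.isSuperParity U) _⟩

/-- The primitive is the function `H` built from the ratio `g` and its inverse alone. Hence it
exists for every pair of volume forms, also when the ratio is not an exponential. -/
lemma symb_lapSq_sub : symb (P.lapSq ρ) - symb (P.lapSq ρ') ∈ LinearMap.range (P.slDiff 0) := by
  obtain ⟨g, u, hv, hg⟩ := ρ.exists_isVol_ratio ρ'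
  have hH := rescaleH_parity (M.isSuperParity ⊤) (P.op_isBV ⊤) (P.lap_isOddLaplace ρ ⊤) hv
  refine ⟨symb (mulTop (rescaleH (M.parity ⊤) (P.op ⊤) (P.lap ρ ⊤) g u)), ?_⟩
  rw [slDiff, ← P.symb_rep, symBracket_symb, ← map_sub]
  refine (Submodule.Quotient.eq _).2 ?_
  refine ⟨(sub_mem (opBracket_mem (m := 2) (n := 0) rfl P.rep.2 (mulTop _).2)
    (sub_mem (P.lapSq ρ).2 (P.lapSq ρ').2)).1, fun U => ?_⟩
  have h1 := superComm_normalise_sub (M.isSuperParity U) (P.op_isBV U)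
    (hasParity_res hH (le_top : U ≤ ⊤))
  have h2 : polar (M.parity U) true (P.op U)
      (resTop U (rescaleH (M.parity ⊤) (P.op ⊤) (P.lap ρ ⊤) g u)) =
      (P.lap ρ U).comp (P.lap ρ U) - (P.lap ρ' U).comp (P.lap ρ' U) := by
    ext f
    rw [res_rescaleH, LinearMap.sub_apply, LinearMap.comp_apply, LinearMap.comp_apply,
      (P.lap_isOddLaplace ρ U).rescale_sq (M.isSuperParity U) (P.op_isBV U)
        (hv.res le_top) (P.lap_rescale ρ ρ' hv hg U) f, sub_sub_cancel]
  rw [← op, h2] at h1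
  exact h1

lemma exists_modularClass : ∃ m : P.Cohomology 0, ∀ ρ : VolumeForm M.toSuperSpace p q,
    P.IsModularClass ρ m := by
  by_cases h : Nonempty (VolumeForm M.toSuperSpace p q)
  · obtain ⟨ρ₀⟩ := h
    refine ⟨Submodule.Quotient.mk ⟨symb (P.lapSq ρ₀), P.lapSq_cocycle ρ₀⟩, fun ρ =>
      ⟨P.lapSq ρ, P.lapSq_cocycle ρ, fun U f => rfl, ?_⟩⟩
    exact (Submodule.Quotient.eq _).2 (P.symb_lapSq_sub ρ₀ ρ)
  -- If there are no volume forms, any class serves.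
  · exact ⟨0, fun ρ => (h ⟨ρ⟩).elim⟩

end SchoutenStructure

end OddPoisson

end

theorem mainTheorem3 {p q : ℕ} (M : OddPoisson.Supermanifold.{u} p q)
    (P : OddPoisson.SchoutenStructure M.toSuperSpace) :
    -- the operators `Δ_ρ` are well defined: `h = Δ_ρ f` if and only if `L_{X_f} ρ = h ρ`
    (∀ (ρ : OddPoisson.VolumeForm M.toSuperSpace p q) (U : TopologicalSpace.Opens M.space)
      (f h : M.Fn U), P.IsLaplacian ρ f h ↔ h = P.laplacian ρ f) ∧
    -- the change of `Δ_ρ²` and the two expressions of `H(ρ', ρ)`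
    (∀ (ρ ρ' : OddPoisson.VolumeForm M.toSuperSpace p q) (σ : M.Fn ⊤),
      OddPoisson.IsExpMul σ ρ ρ' →
        (∀ (U : TopologicalSpace.Opens M.space) (f : M.Fn U),
          P.laplacian ρ' (P.laplacian ρ' f) =
            P.laplacian ρ (P.laplacian ρ f) - P.ham (P.masterH ρ' ρ) U le_top f) ∧
        P.masterH ρ' ρ = P.laplacian ρ σ - (2⁻¹ : ℝ) • P.bracket σ σ ∧
        (∃ E E' : M.Fn ⊤, OddPoisson.IsExp p q ((2⁻¹ : ℝ) • σ) E ∧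
          OddPoisson.IsExp p q (-((2⁻¹ : ℝ) • σ)) E' ∧
          P.masterH ρ' ρ = (2 : ℝ) • (E' * P.laplacian ρ E)) ∧
        OddPoisson.SuperSpace.IsOdd (P.masterH ρ' ρ)) ∧
    -- the cocycle conditions
    (∀ ρ : OddPoisson.VolumeForm M.toSuperSpace p q, P.masterH ρ ρ = 0) ∧
    (∀ (ρ ρ' : OddPoisson.VolumeForm M.toSuperSpace p q) (σ : M.Fn ⊤),
      OddPoisson.IsExpMul σ ρ ρ' → P.masterH ρ' ρ = -P.masterH ρ ρ') ∧
    (∀ (ρ ρ' ρ'' : OddPoisson.VolumeForm M.toSuperSpace p q) (σ τ : M.Fn ⊤),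
      OddPoisson.IsExpMul σ ρ ρ' → OddPoisson.IsExpMul τ ρ' ρ'' →
        P.masterH ρ'' ρ = P.masterH ρ'' ρ' + P.masterH ρ' ρ) ∧
    -- the class of `Δ_ρ²` in the first Schouten–Lichnerowicz cohomology is the same for all `ρ`
    (∃ m : P.Cohomology 0, ∀ ρ : OddPoisson.VolumeForm M.toSuperSpace p q,
      P.IsModularClass ρ m) := by
  refine ⟨fun ρ U f h => P.isLaplacian_iff_eq ρ f h, fun ρ ρ' σ h => ⟨fun U f =>
    P.laplacian_sq h f, ?_, P.masterH_eq_exp h, ?_⟩, P.masterH_self, fun ρ ρ' σ h =>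
    P.masterH_symm h, fun ρ ρ' ρ'' σ τ h h' => P.masterH_trans h h', P.exists_modularClass⟩
  · rw [P.masterH_eq h, P.bracket_of_even h.1.hasParity, smul_neg, sub_neg_eq_add]
    rfl
  · have h1 := P.masterH_parity h
    rwa [OddPoisson.HasParity, OddPoisson.sgn_true, neg_one_smul] at h1
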